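/- Work in the external memory model: disk blocks of $B\ge 2$ words, a memory of $M$ words, words of $w$ bits; a word can also hold one real value, and real values can only be copied and compared. An I/O reads or writes one block, CPU calculation is free, the space of a structure is the number of disk blocks it occupies, and only the disk is kept between operations. Write $\lg_b x=\max\{1,\log_b x\}$ and $\lg=\lg_2$. An $(f,l)$-group is a sequence $G=(G_1,\dots,G_f)$ of pairwise disjoint sets of at most $l$ real values each. The rank of $x\in\mathbb R\cup\{-\infty\}$ in a finite set $L$ of reals is $|\{e\in L: e\ge x\}|$. A query on $G$ is given integers $1\le\alpha_1\le\alpha_2\le f$ and a real number $k\in[1,|U|]$, where $U=\bigcup_{\alpha_1\le i\le\alpha_2}G_i$; with a constant $c_2$ fixed, a correct answer is an $x$ that is either $-\infty$ or an element of $U$ and whose rank in $U$ lies in $[k,c_2k)$. An update inserts a value that belongs to no $G_j$ into a set $G_i$ with $|G_i|<l$, or deletes a value from a set $G_i$. There is an absolute constant $c_2\ge 2$ such that for all constants $0<\epsilon<1$, $a$, $c\in\mathbb N$ and $c_w>0$ there are constants $c_M$ and $C$, depending only on $\epsilon,a,c,c_w$, with the following property. Let $f,l\ge 1$ and $N\ge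 fl$ be integers such that $$l\le a\lg^{c}N,\qquad f\le\sqrt B\,\lg^{\epsilon}N,\qquad w\ge c_w\lg N,\qquad M\ge c_M B .$$ Then there is a structure for $(f,l)$-groups that occupies at most $C\lceil fl/B\rceil$ blocks, answers every query correctly in at most $C\lg_B(fl)$ I/Os in the worst case, and supports insertions and deletions in $C\lg_B(fl)$ I/Os amortized: starting from the initial layout of any $(f,l)$-group (for the empty group: blank blocks), and for every sequence of legal insertions, deletions and queries, the $u$ updates in the sequence take at most $u\cdot C\lg_B(fl)$ I/Os in total. The initial layout depends only on the relative order of the values in the group. -/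

import Mathlib

namespace EM

/-- The logarithm `lg_b x = max {1, log_b x}`. -/
noncomputable def lg (b x : ℝ) : ℝ := max 1 (Real.logb b x)

/-! ### The external memory model -/

/-- An external memory machine: blocks of `B` words, a main memory of `M` words,
words of `w` bits. -/
structure Params where
  B : ℕ
  M : ℕ
  w : ℕ
  two_le_B : 2 ≤ B
  B_le_M : B ≤ M

/-- A word holds either a `w`-bit number or one real value, which is an atom: see `Program`. -/
inductive Word (w : ℕ) where
  | num (n : Fin (2 ^ w))
  | val (x : ℝ)

/-- The blank word, that is, the number `0`. -/
def Word.blank (w : ℕ) : Word w := Word.num ⟨0, Nat.two_pow_pos w⟩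

/-- Replace the real value in a word (if there is one) by its image under `σ`. -/
def Word.map {w : ℕ} (σ : ℝ → ℝ) : Word w → Word w
  | .num n => .num n
  | .val x => .val (σ x)

/-- The value that a word stands for as the answer to a query: a real value stands for itself,
a number stands for `-∞`. -/
def Word.toAnswer {w : ℕ} : Word w → WithBot ℝ
  | .num _ => ⊥
  | .val x => (x : WithBot ℝ)

/-- The contents of a block. -/
abbrev Block (P : Params) := Fin P.B → Word P.w

/-- The contents of the main memory. -/
abbrev Mem (P : Params) := Fin P.M → Word P.w

/-- The contents of `S` blocks of the disk. -/
abbrev Disk (P : Params) (S : ℕ) := Fin S → Block P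

def Mem.map {P : Params} (σ : ℝ → ℝ) (m : Mem P) : Mem P := fun j => (m j).map σ

def Disk.map {P : Params} {S : ℕ} (σ : ℝ → ℝ) (d : Disk P S) : Disk P S :=
  fun a j => (d a j).map σ

def Mem.blank (P : Params) : Mem P := fun _ => Word.blank P.w

def Disk.blank (P : Params) (S : ℕ) : Disk P S := fun _ _ => Word.blank P.w

/-- Position `0` of the main memory. -/
def Params.first (P : Params) : Fin P.M :=
  ⟨0, lt_of_lt_of_le Nat.zero_lt_two (P.two_le_B.trans P.B_le_M)⟩

/-- The memory in which an operation with argument `x` starts: `x` in the first word, everything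
else blank. -/
def Mem.arg (P : Params) (x : ℝ) : Mem P := Function.update (Mem.blank P) P.first (Word.val x)

/-- The memory after reading the block `b`, which goes to the first `B` words. (Moving words inside
the memory is free, so a fixed place for the transfer is no restriction.) -/
def Mem.load {P : Params} (m : Mem P) (b : Block P) : Mem P :=
  fun j => if h : j.1 < P.B then b ⟨j.1, h⟩ else m j

/-- The first `B` words of the memory: what an output operation writes to a block. -/
def Mem.buffer {P : Params} (m : Mem P) : Block P := fun j => m (Fin.castLE P.B_le_M j)

/-- What a program does next: stop, or perform one I/O on one of the `S` blocks. -/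
inductive Action (S : ℕ) where
  | halt
  | read (a : Fin S)
  | write (a : Fin S)

/-- A program on `S` blocks of disk. The `M` words of memory are all it remembers. In one step it
changes the memory by a calculation that is free of charge, and then stops or performs one I/O.
Calculations are arbitrary on numbers; real values may only be copied and compared with each
other, i.e. the steps commute with every order automorphism of `ℝ`. -/
structure Program (P : Params) (S : ℕ) where
  step : Mem P → Mem P × Action S
  equivariant : ∀ (σ : ℝ ≃o ℝ) (m : Mem P), step (m.map σ) = ((step m).1.map σ, (step m).2)

/-- `Q.Runs m d t m' d'`: started with memory `m` and disk `d`, the program `Q` stops after exactly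
`t` I/Os, with memory `m'` and disk `d'`. -/
inductive Program.Runs {P : Params} {S : ℕ} (Q : Program P S) :
    Mem P → Disk P S → ℕ → Mem P → Disk P S → Prop
  | halt {m : Mem P} {d : Disk P S} (h : (Q.step m).2 = Action.halt) :
      Q.Runs m d 0 (Q.step m).1 d
  | read {m m' : Mem P} {d d' : Disk P S} {t : ℕ} {a : Fin S}
      (h : (Q.step m).2 = Action.read a)
      (hr : Q.Runs ((Q.step m).1.load (d a)) d t m' d') :
      Q.Runs m d (t + 1) m' d'
  | write {m m' : Mem P} {d d' : Disk P S} {t : ℕ} {a : Fin S}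
      (h : (Q.step m).2 = Action.write a)
      (hr : Q.Runs (Q.step m).1 (Function.update d a (Q.step m).1.buffer) t m' d') :
      Q.Runs m d (t + 1) m' d'

/-! ### Groups, queries, updates -/

/-- `G` is an `(f, l)`-group: `f` pairwise disjoint sets of at most `l` real values each. -/
def IsGroup {f : ℕ} (l : ℕ) (G : Fin f → Finset ℝ) : Prop :=
  (∀ i j, i ≠ j → Disjoint (G i) (G j)) ∧ ∀ i, (G i).card ≤ l

/-- The union of the sets `G i` with `α₁ ≤ i ≤ α₂`. -/
noncomputable def unionOn {f : ℕ} (G : Fin f → Finset ℝ) (α₁ α₂ : Fin f) : Finset ℝ :=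
  (Finset.Icc α₁ α₂).biUnion G

open Classical in
/-- The rank of `x` in `L`: the number of elements of `L` that are at least `x`. -/
noncomputable def rank (L : Finset ℝ) (x : WithBot ℝ) : ℕ :=
  (L.filter fun e => x ≤ (e : WithBot ℝ)).card

/-- `x` may be inserted into the set `G i`: it is a new element, and there is room for it. -/
def CanInsert {f : ℕ} (l : ℕ) (G : Fin f → Finset ℝ) (i : Fin f) (x : ℝ) : Prop :=
  (∀ j, x ∉ G j) ∧ (G i).card + 1 ≤ l

noncomputable def insertAt {f : ℕ} (G : Fin f → Finset ℝ) (i : Fin f) (x : ℝ) :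
    Fin f → Finset ℝ := Function.update G i (insert x (G i))

noncomputable def eraseAt {f : ℕ} (G : Fin f → Finset ℝ) (i : Fin f) (x : ℝ) :
    Fin f → Finset ℝ := Function.update G i ((G i).erase x)

/-- The query with interval `[α₁, α₂]` and real parameter `k` is legal. -/
def CanQuery {f : ℕ} (G : Fin f → Finset ℝ) (α₁ α₂ : Fin f) (k : ℝ) : Prop :=
  α₁ ≤ α₂ ∧ 1 ≤ k ∧ k ≤ ((unionOn G α₁ α₂).card : ℝ)

/-- `x` is a correct answer to the query with interval `[α₁, α₂]` and parameter `k`. -/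
def IsAnswer {f : ℕ} (c₂ : ℝ) (G : Fin f → Finset ℝ) (α₁ α₂ : Fin f) (k : ℝ)
    (x : WithBot ℝ) : Prop :=
  (x = ⊥ ∨ ∃ e ∈ unionOn G α₁ α₂, x = (e : WithBot ℝ)) ∧
    k ≤ (rank (unionOn G α₁ α₂) x : ℝ) ∧ (rank (unionOn G α₁ α₂) x : ℝ) < c₂ * k

/-! ### Data structures -/

/-- A dynamic structure for groups of `f` sets that occupies `S` disk blocks: how a given group is
laid out initially, and the programs for the operations. The initial layout depends only on the
order of the real values, and the empty group is laid out as blank blocks. -/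
structure GroupStructure (P : Params) (S f : ℕ) where
  build : (Fin f → Finset ℝ) → Disk P S
  build_equivariant : ∀ (σ : ℝ ≃o ℝ) (G : Fin f → Finset ℝ),
    build (fun i => (G i).map σ.toEquiv.toEmbedding) = (build G).map σ
  build_empty : build (fun _ => ∅) = Disk.blank P S
  insertProg : Fin f → Program P S
  deleteProg : Fin f → Program P S
  queryProg : Fin f → Fin f → ℝ → Program P S

/-- `D.Reach l G d u t`: from the initial layout of some `(f, l)`-group, a sequence of legal
insertions, deletions and queries, `u` of them updates, leads to the group `G`, stored as `d`, and
the updates took `t` I/Os in total. Only the disk is kept between two operations. -/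
inductive GroupStructure.Reach {P : Params} {S f : ℕ} (D : GroupStructure P S f) (l : ℕ) :
    (Fin f → Finset ℝ) → Disk P S → ℕ → ℕ → Prop
  | init {G : Fin f → Finset ℝ} (hG : IsGroup l G) : D.Reach l G (D.build G) 0 0
  | insert {G : Fin f → Finset ℝ} {d d' : Disk P S} {u t s : ℕ} {m' : Mem P} {i : Fin f} {x : ℝ}
      (h : D.Reach l G d u t) (hx : CanInsert l G i x)
      (hr : (D.insertProg i).Runs (Mem.arg P x) d s m' d') :
      D.Reach l (insertAt G i x) d' (u + 1) (t + s)
  | delete {G : Fin f → Finset ℝ} {d d' : Disk P S} {u t s : ℕ} {m' : Mem P} {i : Fin f} {x : ℝ}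
      (h : D.Reach l G d u t) (hx : x ∈ G i)
      (hr : (D.deleteProg i).Runs (Mem.arg P x) d s m' d') :
      D.Reach l (eraseAt G i x) d' (u + 1) (t + s)
  | query {G : Fin f → Finset ℝ} {d d' : Disk P S} {u t s : ℕ} {m' : Mem P} {α₁ α₂ : Fin f} {k : ℝ}
      (h : D.Reach l G d u t) (hk : CanQuery G α₁ α₂ k)
      (hr : (D.queryProg α₁ α₂ k).Runs (Mem.blank P) d s m' d') :
      D.Reach l G d' u t

/-- In every situation that can arise, updates have cost at most `T` I/Os amortized, every legal
update is carried out (its program stops), and every legal query is answered correctly, with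
approximation factor `c₂`, within `T` I/Os in the worst case. -/
def GroupStructure.Solves {P : Params} {S f : ℕ} (D : GroupStructure P S f) (l : ℕ)
    (c₂ T : ℝ) : Prop :=
  ∀ (G : Fin f → Finset ℝ) (d : Disk P S) (u t : ℕ), D.Reach l G d u t →
    (t : ℝ) ≤ u * T ∧
    (∀ (i : Fin f) (x : ℝ), CanInsert l G i x →
      ∃ (s : ℕ) (m' : Mem P) (d' : Disk P S), (D.insertProg i).Runs (Mem.arg P x) d s m' d') ∧
    (∀ (i : Fin f) (x : ℝ), x ∈ G i →
      ∃ (s : ℕ) (m' : Mem P) (d' : Disk P S), (D.deleteProg i).Runs (Mem.arg P x) d s m' d') ∧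
    (∀ (α₁ α₂ : Fin f) (k : ℝ), CanQuery G α₁ α₂ k →
      ∃ (s : ℕ) (m' : Mem P) (d' : Disk P S),
        (D.queryProg α₁ α₂ k).Runs (Mem.blank P) d s m' d' ∧
        (s : ℝ) ≤ T ∧ IsAnswer c₂ G α₁ α₂ k (m' P.first).toAnswer)

end EM

/-! All values of all groups are kept in one B-tree, sorted by value. A leaf holds up to `2 * B`
entries, each a value with the indicator of its group, or with zero counts if the value has been
deleted. An internal node has up to `2 * q` children, where `q` is the maximum of 2 and the integer
square root of `B`; for each child and each group it stores the number of values of the group below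
that child. Summing the counts over an interval of groups, a query descends to the element of rank
exactly `⌈k⌉`, and `⌈k⌉ < k + 1 ≤ 2 * k`. So `c₂ = 2` works, and the answer is never `-∞`. Since `B
≤ q ^ 4`, the height is `O(lg_B (f * l))` (`clog_add_one_le`).

The crux is that a node fits into a constant number of blocks. Its counts take about `2 * q * f *
log₂ l` bits. As `l` is polylogarithmic in `N`, `log₂ l` is `O(lg ^ (1 - ε) N)`
(`logb_le_of_le_mul_pow`); together with `f ≤ √B * lg ^ ε N` and `q = O(√B)` this gives `O(B * lg
N)` bits, that is, `O(B)` words (`listBits_le`).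

Every update puts one leaf entry into the tree, and a deletion overwrites the entry by one with zero
counts. The change of the counts is known before the descent, so the counts are corrected, and full
children split, on the way down (`prep_spec`, `put_spec`). Nodes are never merged. With `n = f * l`,
once the counter of the tree would reach `2 * n`, the live entries are copied into a second tree,
from the largest to the smallest, by repeated selection (`rebuild_loop`). At most `n` entries are
live, so at least `n` updates pass between two rebuilds, and a potential proportional to the excess
of the counter over `n` pays for the copying (`Dim.Inv.update`). There are fewer than `2 * n ≤ 2 *
(B * q ^ H)` entries before each put, hence the root is never full and the height `H` can be fixed
in advance (`WF.length_root_lt`). The number of nodes is `O(n / B + H)`, up to an additive constant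
(`WF.length_addrs`), and `H ≤ n / B`.

The algorithm is written as a `NodeMachine`, which transfers whole nodes; `Layout.run_steps` turns
it into a program with `K` I/Os for each step. Programs have to commute with the order automorphisms
of `ℝ`. Real values therefore get words of their own, while everything else, the shape, is coded in
bits; decoding is equivariant because codes are injective (`Code.decode_map`). The initial layout is
what the insertion program produces from the blank disk, element by element, so it inherits
equivariance. An empty node is coded by zeros and a tree may consist of an empty root alone, which
makes the layout of the empty group blank. -/

namespace EM

/-! ### Runs of a program -/

/-- `Reach` speaks of arbitrary runs. Determinism identifies them with the runs that the simulation
provides, and makes the outcome of a program well defined. -/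
theorem Program.Runs.det {P : Params} {S : ℕ} {Q : Program P S} {m m₁ : Mem P} {d d₁ : Disk P S}
    {t₁ : ℕ} (h₁ : Q.Runs m d t₁ m₁ d₁) :
    ∀ {t₂ : ℕ} {m₂ : Mem P} {d₂ : Disk P S}, Q.Runs m d t₂ m₂ d₂ → t₁ = t₂ ∧ m₁ = m₂ ∧ d₁ = d₂ := by
  induction h₁ with
  | halt h =>
    intro t₂ m₂ d₂ h₂
    cases h₂ with
    | halt _ => exact ⟨rfl, rfl, rfl⟩
    | read h' _ => rw [h] at h'; cases h'
    | write h' _ => rw [h] at h'; cases h'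
  | read h _ ih =>
    intro t₂ m₂ d₂ h₂
    cases h₂ with
    | halt h' => rw [h] at h'; cases h'
    | read h' hr =>
      rw [h] at h'; cases h'
      obtain ⟨rfl, h3, h4⟩ := ih hr
      exact ⟨rfl, h3, h4⟩
    | write h' _ => rw [h] at h'; cases h'
  | write h _ ih =>
    intro t₂ m₂ d₂ h₂
    cases h₂ with
    | halt h' => rw [h] at h'; cases h'
    | read h' _ => rw [h] at h'; cases h'
    | write h' hr =>
      rw [h] at h'; cases h'
      obtain ⟨rfl, h3, h4⟩ := ih hr
      exact ⟨rfl, h3, h4⟩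

theorem Mem.map_load {P : Params} (σ : ℝ → ℝ) (m : Mem P) (b : Block P) :
    (m.load b).map σ = (m.map σ).load (fun j => (b j).map σ) := by
  funext j
  simp only [Mem.map, Mem.load]
  split <;> rfl

/-- Each step commutes with `σ`, and the action chosen does not depend on the real values
themselves. Equivariance of the initial layout comes from this. -/
theorem Program.Runs.map {P : Params} {S : ℕ} {Q : Program P S} {m m' : Mem P} {d d' : Disk P S}
    {t : ℕ} (h : Q.Runs m d t m' d') (σ : ℝ ≃o ℝ) :
    Q.Runs (m.map σ) (d.map σ) t (m'.map σ) (d'.map σ) := by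
  induction h with
  | @halt m d h =>
    have := Program.Runs.halt (Q := Q) (m := m.map σ) (d := d.map σ) (by rw [Q.equivariant]; exact h)
    rw [Q.equivariant] at this
    exact this
  | @read m m' d d' t a h _ ih =>
    refine Program.Runs.read (a := a) (by rw [Q.equivariant]; exact h) ?_
    rw [Q.equivariant]
    rw [Mem.map_load] at ih
    exact ih
  | @write m m' d d' t a h _ ih =>
    refine Program.Runs.write (a := a) (by rw [Q.equivariant]; exact h) ?_
    rw [Q.equivariant]
    convert ih using 1
    funext b j
    by_cases hb : b = a
    · subst hb
      simp [Disk.map, Mem.buffer, Mem.map]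
    · simp [Disk.map, hb]

theorem Word.map_symm_map {w : ℕ} (σ : ℝ ≃o ℝ) (x : Word w) : (x.map σ).map σ.symm = x := by
  cases x <;> simp [Word.map]

theorem Word.map_blank {w : ℕ} (σ : ℝ → ℝ) : (Word.blank w).map σ = Word.blank w := rfl

/-- The real value in a word, if there is one. -/
def Word.real {w : ℕ} : Word w → Option ℝ
  | .num _ => none
  | .val x => some x

theorem Word.real_map {w : ℕ} (σ : ℝ → ℝ) (x : Word w) : (x.map σ).real = x.real.map σ := by
  cases x <;> rfl

/-- The word for an optional real value. -/
def Word.ofOption (w : ℕ) : Option ℝ → Word w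
  | none => Word.blank w
  | some x => .val x

theorem Word.ofOption_map {w : ℕ} (σ : ℝ → ℝ) (x : Option ℝ) :
    Word.ofOption w (x.map σ) = (Word.ofOption w x).map σ := by
  cases x <;> rfl

/-! ### Codes for data that contain real values -/

/-- Data on which the order automorphisms of `ℝ` act. -/
class Relabel (T : Type) where
  relabel : (ℝ ≃o ℝ) → T → T

def relabel {T : Type} [Relabel T] (σ : ℝ ≃o ℝ) (t : T) : T := Relabel.relabel σ t

instance {T : Type} [Relabel T] : Relabel (T × ℕ) := ⟨fun σ t => (Relabel.relabel σ t.1, t.2)⟩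

/-- A code for the valid elements of `T` by words that are indexed by `ι`. -/
structure Code (w : ℕ) (T : Type) [Relabel T] (ι : Type) where
  valid : T → Prop
  code : T → ι → Word w
  valid_relabel : ∀ (σ : ℝ ≃o ℝ) (t : T), valid t → valid (relabel σ t)
  code_inj : ∀ t t', valid t → valid t' → code t = code t' → t = t'
  code_relabel : ∀ (σ : ℝ ≃o ℝ) (t : T), valid t →
    code (relabel σ t) = fun k => (code t k).map σ

namespace Code

variable {w : ℕ} {T : Type} [Relabel T] {ι : Type} (E : Code w T ι)

open Classical in
/-- The valid element with a given code, if there is one. -/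
noncomputable def decode (u : ι → Word w) : Option T :=
  if h : ∃ t, E.valid t ∧ E.code t = u then some h.choose else none

theorem decode_code {t : T} (h : E.valid t) : E.decode (E.code t) = some t := by
  have hex : ∃ t', E.valid t' ∧ E.code t' = E.code t := ⟨t, h, rfl⟩
  rw [decode, dif_pos hex]
  exact congrArg some (E.code_inj _ _ hex.choose_spec.1 h hex.choose_spec.2)

/-- Decoding uses choice, but injectivity leaves only one candidate. If the relabelled words are a
code, applying `σ.symm` shows that the original words are one too, so both sides fail together. -/
theorem decode_map (σ : ℝ ≃o ℝ) (u : ι → Word w) :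
    E.decode (fun k => (u k).map σ) = (E.decode u).map (relabel σ) := by
  by_cases hex : ∃ t, E.valid t ∧ E.code t = u
  · obtain ⟨t, ht, rfl⟩ := hex
    rw [← E.code_relabel σ t ht, E.decode_code ht, E.decode_code (E.valid_relabel σ t ht)]
    rfl
  · have hex' : ¬ ∃ t, E.valid t ∧ E.code t = fun k => (u k).map σ := by
      rintro ⟨t, ht, hu⟩
      refine hex ⟨relabel σ.symm t, E.valid_relabel _ t ht, ?_⟩
      rw [E.code_relabel _ t ht, hu]
      funext k
      exact Word.map_symm_map σ (u k)
    rw [decode, dif_neg hex', decode, dif_neg hex]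
    rfl

end Code

/-! ### Machines that read and write nodes -/

/-- What a node machine does next. -/
inductive NodeAct (Nd : Type) where
  | halt (o : Option ℝ)
  | read (a : ℕ)
  | write (a : ℕ) (n : Nd)

def NodeAct.relabel {Nd : Type} [Relabel Nd] (σ : ℝ ≃o ℝ) : NodeAct Nd → NodeAct Nd
  | .halt o => .halt (o.map σ)
  | .read a => .read a
  | .write a n => .write a (EM.relabel σ n)

/-- A machine with states in `St` that reads and writes the elements of `Nd` as a whole. The next
state depends on the node that has just been read or written. -/
structure NodeMachine (Nd St : Type) [Relabel Nd] [Relabel St] where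
  start : Option ℝ → St
  act : St → NodeAct Nd
  next : St → Nd → St
  start_relabel : ∀ (σ : ℝ ≃o ℝ) (o : Option ℝ), start (o.map σ) = relabel σ (start o)
  act_relabel : ∀ (σ : ℝ ≃o ℝ) (s : St), act (relabel σ s) = (act s).relabel σ
  next_relabel : ∀ (σ : ℝ ≃o ℝ) (s : St) (n : Nd),
    next (relabel σ s) (relabel σ n) = relabel σ (next s n)

/-- `Q.Steps vs vn S s A t s' A'`: from state `s` and store `A`, the machine gets to state `s'` and
store `A'` in `t` steps; the states passed through satisfy `vs`, the nodes written satisfy `vn`, and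
the addresses are less than `S`. -/
inductive NodeMachine.Steps {Nd St : Type} [Relabel Nd] [Relabel St] (Q : NodeMachine Nd St)
    (vs : St → Prop) (vn : Nd → Prop) (S : ℕ) : St → (ℕ → Nd) → ℕ → St → (ℕ → Nd) → Prop
  | refl (s : St) (A : ℕ → Nd) : Steps Q vs vn S s A 0 s A
  | read {s s' : St} {A A' : ℕ → Nd} {t a : ℕ} (hs : vs s) (h : Q.act s = .read a) (ha : a < S)
      (hr : Steps Q vs vn S (Q.next s (A a)) A t s' A') : Steps Q vs vn S s A (t + 1) s' A'
  | write {s s' : St} {A A' : ℕ → Nd} {t a : ℕ} {n : Nd} (hs : vs s) (h : Q.act s = .write a n)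
      (ha : a < S) (hn : vn n)
      (hr : Steps Q vs vn S (Q.next s n) (Function.update A a n) t s' A') :
      Steps Q vs vn S s A (t + 1) s' A'

theorem NodeMachine.Steps.trans {Nd St : Type} [Relabel Nd] [Relabel St] {Q : NodeMachine Nd St}
    {vs : St → Prop} {vn : Nd → Prop} {S : ℕ} {s s' s'' : St} {A A' A'' : ℕ → Nd} {t t' : ℕ}
    (h : Q.Steps vs vn S s A t s' A') (h' : Q.Steps vs vn S s' A' t' s'' A'') :
    Q.Steps vs vn S s A (t + t') s'' A'' := by
  induction h with
  | refl s A => simpa using h'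
  | @read s s' A A' t a hs h ha _ ih =>
    rw [Nat.add_right_comm]
    exact .read hs h ha (ih h')
  | @write s s' A A' t a n hs h ha hn _ ih =>
    rw [Nat.add_right_comm]
    exact .write hs h ha hn (ih h')

theorem NodeMachine.Steps.valid {Nd St : Type} [Relabel Nd] [Relabel St] {Q : NodeMachine Nd St}
    {vs : St → Prop} {vn : Nd → Prop} {S : ℕ} {s s' : St} {A A' : ℕ → Nd} {t : ℕ}
    (h : Q.Steps vs vn S s A t s' A') (hA : ∀ a, vn (A a)) : ∀ a, vn (A' a) := by
  induction h with
  | refl s A => exact hA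
  | read hs h ha _ ih => exact ih hA
  | @write s s' A A' t a n hs h ha hn _ ih =>
    refine ih fun b => ?_
    by_cases hb : b = a
    · subst hb; simpa using hn
    · simpa [hb] using hA b

/-! ### Simulation by programs -/

/-- How the nodes and the states of a node machine are represented in blocks and in the main memory;
a state comes with the number of blocks of the current node that have been transferred. -/
structure Layout (P : Params) (K : ℕ) (Nd St : Type) [Relabel Nd] [Relabel St] where
  node : Code P.w Nd (Fin K × Fin P.B)
  ι : Type
  st : Code P.w (St × ℕ) ι
  st_ne_blank : ∀ s, st.valid s → st.code s ≠ fun _ => Word.blank P.w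
  pos : ι ⊕ (Fin K × Fin P.B) → Fin P.M
  pos_inj : Function.Injective pos
  le_pos : ∀ k, P.B ≤ (pos k).1

namespace Layout

variable {P : Params} {K : ℕ} {Nd St : Type} [Relabel Nd] [Relabel St] (E : Layout P K Nd St)

/-- A state of the simulation: a state of the node machine, the number of blocks of its current
node that have been requested, and the blocks read so far. -/
structure _root_.EM.SimState (w : ℕ) (St κ : Type) where
  s : St
  j : ℕ
  part : κ → Word w

def _root_.EM.SimState.map {w : ℕ} {St κ : Type} [Relabel St] (σ : ℝ ≃o ℝ) (c : SimState w St κ) :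
    SimState w St κ := ⟨relabel σ c.s, c.j, fun k => (c.part k).map σ⟩

variable (Q : NodeMachine Nd St)

open Classical in
/-- The state that the main memory represents; only blank words outside the buffer stand for the
start of an operation. -/
noncomputable def load (m : Mem P) : Option (SimState P.w St (Fin K × Fin P.B)) :=
  if ∀ k, m (E.pos k) = Word.blank P.w then
    some ⟨Q.start (m P.first).real, 0, fun _ => Word.blank P.w⟩
  else (E.st.decode fun k => m (E.pos (.inl k))).map
    fun c => ⟨c.1, c.2, fun k => m (E.pos (.inr k))⟩

/-- Take account of the last I/O. -/
noncomputable def settle (b : Block P) (c : SimState P.w St (Fin K × Fin P.B)) :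
    Option (SimState P.w St (Fin K × Fin P.B)) :=
  match Q.act c.s with
  | .halt _ => some c
  | .read _ =>
    -- With `j = 0` nothing has been requested yet; otherwise the buffer holds block `j - 1` of the
    -- node, and `j = K` means that the node is complete.
    if c.j = 0 then some c
    else if c.j < K then some ⟨c.s, c.j, fun k => if k.1.1 + 1 = c.j then b k.2 else c.part k⟩
    else (E.node.decode fun k => if k.1.1 + 1 = c.j then b k.2 else c.part k).map
      fun n => ⟨Q.next c.s n, 0, fun _ => Word.blank P.w⟩
  | .write _ n =>
    if c.j < K then some c else some ⟨Q.next c.s n, 0, fun _ => Word.blank P.w⟩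

/-- The main memory with buffer `b` that represents the state `c`. -/
noncomputable def store (b : Block P) (c : SimState P.w St (Fin K × Fin P.B)) : Mem P :=
  fun i => if h : i.1 < P.B then b ⟨i.1, h⟩
    else Function.extend E.pos (Sum.elim (E.st.code (c.s, c.j)) c.part) (fun _ => Word.blank P.w) i

open Classical in
/-- Perform the next I/O. -/
noncomputable def issue (S : ℕ) (m : Mem P) (c : SimState P.w St (Fin K × Fin P.B)) :
    Mem P × Action (S * K) :=
  -- Codes are equivariant on valid elements only, so the program has to give up on states that
  -- cannot be stored. Runs within the bounds never get there.
  if E.st.valid (c.s, c.j + 1) then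
    match Q.act c.s with
    | .halt o => (Function.update m P.first (Word.ofOption P.w o), .halt)
    | .read a => if h : a * K + c.j < S * K then
        (E.store m.buffer ⟨c.s, c.j + 1, c.part⟩, .read ⟨a * K + c.j, h⟩) else (m, .halt)
    | .write a n => if h : E.node.valid n ∧ a * K + c.j < S * K ∧ c.j < K then
        (E.store (fun i => E.node.code n (⟨c.j, h.2.2⟩, i)) ⟨c.s, c.j + 1, c.part⟩,
          .write ⟨a * K + c.j, h.2.1⟩) else (m, .halt)
  else (m, .halt)

theorem map_buffer (σ : ℝ → ℝ) (m : Mem P) : (m.map σ).buffer = fun j => (m.buffer j).map σ := rfl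

theorem _root_.EM.Word.map_eq_blank {w : ℕ} (σ : ℝ → ℝ) (x : Word w) :
    x.map σ = Word.blank w ↔ x = Word.blank w := by
  cases x <;> simp [Word.map, Word.blank]

theorem load_map (σ : ℝ ≃o ℝ) (m : Mem P) :
    E.load Q (m.map σ) = (E.load Q m).map (SimState.map σ) := by
  by_cases h : ∀ k, m (E.pos k) = Word.blank P.w
  · have h' : ∀ k, m.map σ (E.pos k) = Word.blank P.w := fun k => (Word.map_eq_blank _ _).2 (h k)
    unfold load
    rw [if_pos h, if_pos h']
    simp only [Option.map_some, SimState.map, Mem.map, Word.real_map, Q.start_relabel]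
    rfl
  · have h' : ¬ ∀ k, m.map σ (E.pos k) = Word.blank P.w :=
      fun h' => h fun k => (Word.map_eq_blank _ _).1 (h' k)
    unfold load
    rw [if_neg h, if_neg h']
    simp only [Mem.map]
    rw [E.st.decode_map σ, Option.map_map, Option.map_map]
    rfl

theorem settle_map (σ : ℝ ≃o ℝ) (b : Block P) (c : SimState P.w St (Fin K × Fin P.B)) :
    E.settle Q (fun j => (b j).map σ) (c.map σ) = (E.settle Q b c).map (SimState.map σ) := by
  obtain ⟨s, j, part⟩ := c
  have hpart : (fun k : Fin K × Fin P.B => if k.1.1 + 1 = j then (b k.2).map σ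
      else (part k).map σ) =
      fun k => ((if k.1.1 + 1 = j then b k.2 else part k).map σ) := by
    funext k; split <;> rfl
  dsimp only [settle, SimState.map]
  rw [Q.act_relabel]
  cases hact : Q.act s with
  | halt o => rfl
  | read a =>
    simp only [NodeAct.relabel]
    by_cases h0 : j = 0
    · rw [if_pos h0, if_pos h0]; rfl
    rw [if_neg h0, if_neg h0]
    by_cases h1 : j < K
    · rw [if_pos h1, if_pos h1]; simp [SimState.map, hpart]
    rw [if_neg h1, if_neg h1, hpart, E.node.decode_map σ, Option.map_map, Option.map_map]
    congr 1
    funext n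
    simp only [Function.comp, Q.next_relabel, SimState.map]
    rfl
  | write a n =>
    simp only [NodeAct.relabel]
    by_cases h1 : j < K
    · rw [if_pos h1, if_pos h1]; rfl
    · rw [if_neg h1, if_neg h1]
      simp only [Option.map_some, SimState.map, Q.next_relabel]
      rfl

theorem store_map (σ : ℝ ≃o ℝ) (b : Block P) (c : SimState P.w St (Fin K × Fin P.B))
    (hv : E.st.valid (c.s, c.j)) :
    E.store (fun j => (b j).map σ) (c.map σ) = (E.store b c).map σ := by
  funext i
  simp only [store, Mem.map, SimState.map]
  split
  · rfl
  · by_cases hi : ∃ k, E.pos k = i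
    · obtain ⟨k, rfl⟩ := hi
      rw [E.pos_inj.extend_apply, E.pos_inj.extend_apply]
      cases k with
      | inl k =>
        have := congrFun (E.st.code_relabel σ _ hv) k
        exact this
      | inr k => rfl
    · rw [Function.extend_apply' _ _ _ hi, Function.extend_apply' _ _ _ hi]
      rfl

/-- Codes only promise one direction; the inverse automorphism gives the other. The equivalence is
needed because `issue` branches on validity. -/
theorem valid_relabel_iff {w : ℕ} {T ι : Type} [Relabel T] (E : Code w T ι)
    (h : ∀ (σ : ℝ ≃o ℝ) (t : T), relabel σ.symm (relabel σ t) = t) (σ : ℝ ≃o ℝ) (t : T) :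
    E.valid (relabel σ t) ↔ E.valid t :=
  ⟨fun h' => by simpa [h] using E.valid_relabel σ.symm _ h', E.valid_relabel σ t⟩

theorem issue_map (hSt : ∀ (σ : ℝ ≃o ℝ) (t : St), relabel σ.symm (relabel σ t) = t)
    (hNd : ∀ (σ : ℝ ≃o ℝ) (t : Nd), relabel σ.symm (relabel σ t) = t)
    (S : ℕ) (σ : ℝ ≃o ℝ) (m : Mem P) (c : SimState P.w St (Fin K × Fin P.B)) :
    E.issue Q S (m.map σ) (c.map σ) = ((E.issue Q S m c).1.map σ, (E.issue Q S m c).2) := by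
  have hSt' : ∀ (σ : ℝ ≃o ℝ) (t : St × ℕ), relabel σ.symm (relabel σ t) = t :=
    fun σ t => Prod.ext (hSt σ t.1) rfl
  have hval := valid_relabel_iff E.st hSt' σ (c.s, c.j + 1)
  unfold issue
  by_cases hv : E.st.valid (c.s, c.j + 1)
  · rw [if_pos hv, if_pos (show E.st.valid ((c.map σ).s, (c.map σ).j + 1) from hval.2 hv)]
    simp only [show (c.map σ).s = relabel σ c.s from rfl, Q.act_relabel,
      show (c.map σ).j = c.j from rfl]
    cases hact : Q.act c.s with
    | halt o =>
      simp only [NodeAct.relabel, Word.ofOption_map]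
      congr 1
      funext i
      by_cases hi : i = P.first
      · subst hi; simp [Mem.map]
      · simp [Mem.map, hi]
    | read a =>
      simp only [NodeAct.relabel]
      split
      · exact Prod.ext (E.store_map σ m.buffer ⟨c.s, c.j + 1, c.part⟩ hv) rfl
      · rfl
    | write a n =>
      simp only [NodeAct.relabel]
      have hvn := valid_relabel_iff E.node hNd σ n
      by_cases h : E.node.valid n ∧ a * K + c.j < S * K ∧ c.j < K
      · rw [dif_pos h, dif_pos ⟨hvn.2 h.1, h.2⟩]
        refine Prod.ext ?_ rfl
        have := E.store_map σ (fun i => E.node.code n (⟨c.j, h.2.2⟩, i)) ⟨c.s, c.j + 1, c.part⟩ hv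
        simp only [E.node.code_relabel σ n h.1]
        exact this
      · rw [dif_neg h, dif_neg (fun h' => h ⟨hvn.1 h'.1, h'.2⟩)]
  · rw [if_neg hv, if_neg (fun h : E.st.valid ((c.map σ).s, (c.map σ).j + 1) => hv (hval.1 h))]

/-- The program that simulates the node machine `Q`. -/
noncomputable def program (hSt : ∀ (σ : ℝ ≃o ℝ) (t : St), relabel σ.symm (relabel σ t) = t)
    (hNd : ∀ (σ : ℝ ≃o ℝ) (t : Nd), relabel σ.symm (relabel σ t) = t) (S : ℕ) :
    Program P (S * K) where
  step m := match (E.load Q m).bind (E.settle Q m.buffer) with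
    | none => (m, .halt)
    | some c => E.issue Q S m c
  equivariant σ m := by
    have h : (E.load Q (m.map σ)).bind (E.settle Q (m.map σ).buffer) =
        ((E.load Q m).bind (E.settle Q m.buffer)).map (SimState.map σ) := by
      rw [E.load_map, map_buffer]
      cases E.load Q m with
      | none => rfl
      | some c => simpa using E.settle_map Q σ m.buffer c
    rw [h]
    cases (E.load Q m).bind (E.settle Q m.buffer) with
    | none => rfl
    | some c => exact E.issue_map Q hSt hNd S σ m c

/-- The disk that represents the store `A`. -/
def disk (S : ℕ) (A : ℕ → Nd) : Disk P (S * K) := fun i j =>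
  E.node.code (A (i.1 / K)) (⟨i.1 % K, Nat.mod_lt _ (Nat.pos_of_ne_zero fun h => by
    subst h; exact absurd i.2 (by simp))⟩, j)

variable {hSt : ∀ (σ : ℝ ≃o ℝ) (t : St), relabel σ.symm (relabel σ t) = t}
  {hNd : ∀ (σ : ℝ ≃o ℝ) (t : Nd), relabel σ.symm (relabel σ t) = t} {S : ℕ}

/-- The memory `m` represents the state `c` once the last I/O is taken into account. -/
def Ready (m : Mem P) (c : SimState P.w St (Fin K × Fin P.B)) : Prop :=
  (E.load Q m).bind (E.settle Q m.buffer) = some c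

theorem Ready.step {m : Mem P} {c : SimState P.w St (Fin K × Fin P.B)} (h : E.Ready Q m c) :
    (E.program Q hSt hNd S).step m = E.issue Q S m c := by
  unfold Ready at h
  simp only [program, h]

theorem buffer_store (b : Block P) (c : SimState P.w St (Fin K × Fin P.B)) :
    (E.store b c).buffer = b := by
  funext j
  simp [store, Mem.buffer]

theorem store_load (b b' : Block P) (c : SimState P.w St (Fin K × Fin P.B)) :
    (E.store b c).load b' = E.store b' c := by
  funext j
  simp only [store, Mem.load]
  split <;> rfl

theorem load_store (b : Block P) (c : SimState P.w St (Fin K × Fin P.B))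
    (hv : E.st.valid (c.s, c.j)) : E.load Q (E.store b c) = some c := by
  have hpos : ∀ k, E.store b c (E.pos k) = Sum.elim (E.st.code (c.s, c.j)) c.part k := by
    intro k
    rw [store, dif_neg (not_lt.2 (E.le_pos k)), E.pos_inj.extend_apply]
  unfold load
  rw [if_neg]
  · simp only [hpos, Sum.elim_inl, Sum.elim_inr]
    rw [show (fun k => E.st.code (c.s, c.j) k) = E.st.code (c.s, c.j) from rfl, E.st.decode_code hv]
    rfl
  · intro h
    -- A stored state is never all blank, so it cannot be mistaken for the start of an operation.
    refine E.st_ne_blank _ hv (funext fun k => ?_)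
    have := h (.inl k)
    rwa [hpos] at this

theorem block_div {K a j : ℕ} (hj : j < K) : (a * K + j) / K = a ∧ (a * K + j) % K = j := by
  have hK : 0 < K := by omega
  constructor
  · rw [mul_comm, Nat.mul_add_div hK, Nat.div_eq_of_lt hj, add_zero]
  · rw [mul_comm, Nat.mul_add_mod, Nat.mod_eq_of_lt hj]

theorem block_lt {K a j S : ℕ} (hj : j < K) (ha : a < S) : a * K + j < S * K :=
  calc a * K + j < a * K + K := by omega
    _ = (a + 1) * K := by ring
    _ ≤ S * K := Nat.mul_le_mul_right _ ha

theorem disk_block (A : ℕ → Nd) {a j : ℕ} (hj : j < K) (ha : a * K + j < S * K) :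
    E.disk S A ⟨a * K + j, ha⟩ = fun i => E.node.code (A a) (⟨j, hj⟩, i) := by
  funext i
  obtain ⟨h1, h2⟩ := block_div (a := a) hj
  simp only [disk, h1, h2]

variable (hSt hNd S) in
/-- Started with memory `m` and disk `d`, the program stops after `t` I/Os with disk `d'` and
answer `x`. -/
def Finishes (m : Mem P) (d : Disk P (S * K)) (t : ℕ) (d' : Disk P (S * K)) (x : Word P.w) : Prop :=
  ∃ m', (E.program Q hSt hNd S).Runs m d t m' d' ∧ m' P.first = x

variable {E Q} in
theorem Finishes.read {m : Mem P} {d d' : Disk P (S * K)} {t : ℕ} {x : Word P.w} {a : Fin (S * K)}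
    (h : ((E.program Q hSt hNd S).step m).2 = .read a)
    (hr : E.Finishes Q hSt hNd S (((E.program Q hSt hNd S).step m).1.load (d a)) d t d' x) :
    E.Finishes Q hSt hNd S m d (t + 1) d' x := by
  obtain ⟨m', h1, h2⟩ := hr
  exact ⟨m', .read h h1, h2⟩

variable {E Q} in
theorem Finishes.write {m : Mem P} {d d' : Disk P (S * K)} {t : ℕ} {x : Word P.w} {a : Fin (S * K)}
    (h : ((E.program Q hSt hNd S).step m).2 = .write a)
    (hr : E.Finishes Q hSt hNd S ((E.program Q hSt hNd S).step m).1
      (Function.update d a ((E.program Q hSt hNd S).step m).1.buffer) t d' x) :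
    E.Finishes Q hSt hNd S m d (t + 1) d' x := by
  obtain ⟨m', h1, h2⟩ := hr
  exact ⟨m', .write h h1, h2⟩

/-- Induction on the number of blocks still to be read. The continuation `hr` is stated for every
memory that is `Ready` for the next state, since the last block is decoded only at the beginning of
the following step. -/
theorem run_read {a : ℕ} {s : St} (hs : ∀ j ≤ K, E.st.valid (s, j)) (hact : Q.act s = .read a)
    (ha : a < S) {A : ℕ → Nd} (hA : E.node.valid (A a)) {t : ℕ} {x : Word P.w}
    {d' : Disk P (S * K)}
    (hr : ∀ m part, E.Ready Q m ⟨Q.next s (A a), 0, part⟩ →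
      E.Finishes Q hSt hNd S m (E.disk S A) t d' x) (r : ℕ) :
    ∀ (j : ℕ) (m : Mem P) (part : Fin K × Fin P.B → Word P.w), r + 1 + j = K →
      (∀ k : Fin K × Fin P.B, k.1.1 < j → part k = E.node.code (A a) k) →
      E.Ready Q m ⟨s, j, part⟩ →
      E.Finishes Q hSt hNd S m (E.disk S A) (t + (r + 1)) d' x := by
  induction r with
  | zero =>
    intro j m part hj hpart hm
    have hlt : a * K + j < S * K := block_lt (by omega) ha
    have hv : E.st.valid (s, j + 1) := hs _ (by omega)
    have hiss : E.issue Q S m ⟨s, j, part⟩ =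
        (E.store m.buffer ⟨s, j + 1, part⟩, .read ⟨a * K + j, hlt⟩) := by
      simp only [issue, hv, hact, hlt, dite_true, if_true]
    have hstep := (hm.step (hSt := hSt) (hNd := hNd) (S := S)).trans hiss
    refine Finishes.read (a := ⟨a * K + j, hlt⟩) (by rw [hstep]) ?_
    rw [hstep]
    refine hr _ (fun _ => Word.blank P.w) ?_
    simp only [store_load, Ready, buffer_store]
    rw [E.load_store Q _ _ hv]
    simp only [Option.bind_some, settle, hact]
    rw [if_neg (by omega), if_neg (by omega), E.disk_block A (by omega)]
    have : (fun k : Fin K × Fin P.B => if k.1.1 + 1 = j + 1 then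
        E.node.code (A a) (⟨j, by omega⟩, k.2) else part k) = E.node.code (A a) := by
      funext k
      split
      · rename_i h
        have : (⟨j, by omega⟩ : Fin K) = k.1 := Fin.ext (by simp; omega)
        rw [this]
      · exact hpart k (by have := k.1.2; omega)
    rw [this, E.node.decode_code hA]
    rfl
  | succ r ih =>
    intro j m part hj hpart hm
    have hlt : a * K + j < S * K := block_lt (by omega) ha
    have hv : E.st.valid (s, j + 1) := hs _ (by omega)
    have hiss : E.issue Q S m ⟨s, j, part⟩ =
        (E.store m.buffer ⟨s, j + 1, part⟩, .read ⟨a * K + j, hlt⟩) := by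
      simp only [issue, hv, hact, hlt, dite_true, if_true]
    have hstep := (hm.step (hSt := hSt) (hNd := hNd) (S := S)).trans hiss
    refine Finishes.read (a := ⟨a * K + j, hlt⟩) (by rw [hstep]) ?_
    rw [hstep]
    simp only [store_load]
    rw [E.disk_block A (by omega)]
    refine ih (j + 1) _ (fun k => if k.1.1 + 1 = j + 1 then
        E.node.code (A a) (⟨j, by omega⟩, k.2) else part k) (by omega) ?_ ?_
    · intro k hk
      split
      · rename_i h
        have : (⟨j, by omega⟩ : Fin K) = k.1 := Fin.ext (by simp; omega)
        rw [this]
      · exact hpart k (by omega)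
    · simp only [Ready, buffer_store]
      rw [E.load_store Q _ _ hv]
      simp only [Option.bind_some, settle, hact]
      rw [if_neg (by omega), if_pos (by omega)]

/-- The disk that represents `A`, except that the first `j` blocks of the node at `a` represent
`n`. -/
def mixedDisk (S : ℕ) (A : ℕ → Nd) (a : ℕ) (n : Nd) (j : ℕ) : Disk P (S * K) := fun i =>
  if i.1 / K = a ∧ i.1 % K < j then E.disk S (Function.update A a n) i else E.disk S A i

theorem mixedDisk_zero (A : ℕ → Nd) (a : ℕ) (n : Nd) :
    E.mixedDisk S A a n 0 = E.disk S A := by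
  funext i
  simp [mixedDisk]

theorem mixedDisk_all (A : ℕ → Nd) (a : ℕ) (n : Nd) :
    E.mixedDisk S A a n K = E.disk S (Function.update A a n) := by
  funext i
  unfold mixedDisk
  split
  · rfl
  · rename_i h
    have hK : 0 < K := Nat.pos_of_ne_zero fun h => by subst h; exact absurd i.2 (by simp)
    have : i.1 / K ≠ a := fun h' => h ⟨h', Nat.mod_lt _ hK⟩
    funext k
    simp [disk, this]

theorem mixedDisk_succ (A : ℕ → Nd) {a : ℕ} (n : Nd) {j : ℕ} (hj : j < K)
    (hlt : a * K + j < S * K) :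
    Function.update (E.mixedDisk S A a n j) ⟨a * K + j, hlt⟩
      (fun i => E.node.code n (⟨j, hj⟩, i)) = E.mixedDisk S A a n (j + 1) := by
  obtain ⟨h1, h2⟩ := block_div (a := a) hj
  funext i
  by_cases hi : i = ⟨a * K + j, hlt⟩
  · subst hi
    rw [Function.update_self]
    simp only [mixedDisk]
    rw [if_pos ⟨h1, by rw [h2]; omega⟩, E.disk_block _ hj]
    simp
  · rw [Function.update_of_ne hi]
    have : i.1 / K = a → i.1 % K ≠ j := by
      intro h h'
      apply hi
      apply Fin.ext
      have := Nat.div_add_mod i.1 K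
      rw [h, h', mul_comm] at this
      exact this.symm
    simp only [mixedDisk]
    by_cases h : i.1 / K = a
    · have := this h
      by_cases h' : i.1 % K < j
      · rw [if_pos ⟨h, h'⟩, if_pos ⟨h, by omega⟩]
      · rw [if_neg (fun hh => h' hh.2), if_neg (fun hh => by omega)]
    · rw [if_neg (fun hh => h hh.1), if_neg (fun hh => h hh.1)]

/-- Until the last block is written the disk represents no store at all; `mixedDisk` describes these
intermediate contents. -/
theorem run_write {a : ℕ} {s : St} {n : Nd} (hs : ∀ j ≤ K, E.st.valid (s, j))
    (hact : Q.act s = .write a n) (ha : a < S) (hn : E.node.valid n) {A : ℕ → Nd} {t : ℕ}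
    {x : Word P.w} {d' : Disk P (S * K)}
    (hr : ∀ m part, E.Ready Q m ⟨Q.next s n, 0, part⟩ →
      E.Finishes Q hSt hNd S m (E.disk S (Function.update A a n)) t d' x) (r : ℕ) :
    ∀ (j : ℕ) (m : Mem P) (part : Fin K × Fin P.B → Word P.w), r + 1 + j = K →
      E.Ready Q m ⟨s, j, part⟩ →
      E.Finishes Q hSt hNd S m (E.mixedDisk S A a n j) (t + (r + 1)) d' x := by
  induction r with
  | zero =>
    intro j m part hj hm
    have hlt : a * K + j < S * K := block_lt (by omega) ha
    have hv : E.st.valid (s, j + 1) := hs _ (by omega)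
    have hjK : j < K := by omega
    have hiss : E.issue Q S m ⟨s, j, part⟩ =
        (E.store (fun i => E.node.code n (⟨j, hjK⟩, i)) ⟨s, j + 1, part⟩,
          .write ⟨a * K + j, hlt⟩) := by
      simp only [issue, hv, hact, hlt, hn, hjK, and_self, dite_true, if_true]
    have hstep := (hm.step (hSt := hSt) (hNd := hNd) (S := S)).trans hiss
    refine Finishes.write (a := ⟨a * K + j, hlt⟩) (by rw [hstep]) ?_
    rw [hstep]
    simp only [buffer_store]
    rw [E.mixedDisk_succ A n hjK, show j + 1 = K by omega, mixedDisk_all]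
    refine hr _ (fun _ => Word.blank P.w) ?_
    simp only [Ready, buffer_store]
    rw [E.load_store Q _ _ (hs _ le_rfl)]
    simp only [Option.bind_some, settle, hact]
    rw [if_neg (by omega)]
  | succ r ih =>
    intro j m part hj hm
    have hlt : a * K + j < S * K := block_lt (by omega) ha
    have hv : E.st.valid (s, j + 1) := hs _ (by omega)
    have hjK : j < K := by omega
    have hiss : E.issue Q S m ⟨s, j, part⟩ =
        (E.store (fun i => E.node.code n (⟨j, hjK⟩, i)) ⟨s, j + 1, part⟩,
          .write ⟨a * K + j, hlt⟩) := by
      simp only [issue, hv, hact, hlt, hn, hjK, and_self, dite_true, if_true]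
    have hstep := (hm.step (hSt := hSt) (hNd := hNd) (S := S)).trans hiss
    refine Finishes.write (a := ⟨a * K + j, hlt⟩) (by rw [hstep]) ?_
    rw [hstep]
    simp only [buffer_store]
    rw [E.mixedDisk_succ A n hjK]
    refine ih (j + 1) _ part (by omega) ?_
    simp only [Ready, buffer_store]
    rw [E.load_store Q _ _ hv]
    simp only [Option.bind_some, settle, hact]
    rw [if_pos (by omega)]

/-- A run of the node machine is simulated with `K` I/Os for each step. -/
theorem run_steps (hK : 0 < K) {s s' : St} {A A' : ℕ → Nd} {t : ℕ} {o : Option ℝ}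
    (h : Q.Steps (fun s => ∀ j ≤ K, E.st.valid (s, j)) E.node.valid S s A t s' A')
    (hs' : ∀ j ≤ K, E.st.valid (s', j)) (hact : Q.act s' = .halt o)
    (hA : ∀ a, E.node.valid (A a)) (m : Mem P) (part : Fin K × Fin P.B → Word P.w)
    (hm : E.Ready Q m ⟨s, 0, part⟩) :
    E.Finishes Q hSt hNd S m (E.disk S A) (t * K) (E.disk S A') (Word.ofOption P.w o) := by
  obtain ⟨k, rfl⟩ : ∃ k, K = k + 1 := ⟨K - 1, by omega⟩
  induction h generalizing m part with
  | refl s A =>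
    have hiss : E.issue Q S m ⟨s, 0, part⟩ =
        (Function.update m P.first (Word.ofOption P.w o), .halt) := by
      simp only [issue, zero_add, hs' 1 hK, hact, if_true]
    have hstep := (hm.step (hSt := hSt) (hNd := hNd) (S := S)).trans hiss
    rw [zero_mul]
    refine ⟨((E.program Q hSt hNd S).step m).1, Program.Runs.halt (by rw [hstep]), ?_⟩
    rw [hstep]; simp
  | @read s s' A A' t a hs h ha _ ih =>
    rw [Nat.add_mul, one_mul]
    exact E.run_read Q hs h ha (hA a) (fun m part hm => ih hact m hs' hA part hm) k 0 m part rfl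
      (fun k hk => absurd hk (by omega)) hm
  | @write s s' A A' t a n hs h ha hn _ ih =>
    rw [Nat.add_mul, one_mul, ← E.mixedDisk_zero A a n]
    refine E.run_write Q hs h ha hn (fun m part hm => ih hact m hs' (fun b => ?_) part hm) k 0 m
      part rfl hm
    by_cases hb : b = a
    · subst hb; simpa using hn
    · simpa [hb] using hA b

end Layout

/-! ### Lists of entries -/

/-- An entry of a node: in a leaf, a value with the indicator of its group (or `0`, if it has been
deleted); otherwise a lower bound for the values in a child, its address, and the number of its
values in each group. -/
@[ext]
structure Entry (f : ℕ) where
  key : ℝ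
  ptr : ℕ
  cnt : Fin f → ℕ

variable {f : ℕ}

def total (L : List (Entry f)) : Fin f → ℕ := (L.map Entry.cnt).sum

@[simp] theorem total_nil : total ([] : List (Entry f)) = 0 := rfl

@[simp] theorem total_cons (e : Entry f) (L : List (Entry f)) :
    total (e :: L) = e.cnt + total L := by simp [total]

@[simp] theorem total_append (L L' : List (Entry f)) : total (L ++ L') = total L + total L' := by
  simp [total]

theorem cnt_le_total {e : Entry f} {L : List (Entry f)} (h : e ∈ L) (i : Fin f) :
    e.cnt i ≤ total L i := by
  induction L with
  | nil => cases h
  | cons d L ih =>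
    rcases List.mem_cons.1 h with rfl | h
    · simp
    · simpa using (ih h).trans (Nat.le_add_left _ _)

/-- The keys of the list are strictly increasing. -/
def KeySorted (L : List (Entry f)) : Prop := L.Pairwise fun e e' => e.key < e'.key

/-- Put the entry `y` into a sorted list, in place of the entry with the same key if there is
one. -/
noncomputable def upsert (y : Entry f) : List (Entry f) → List (Entry f)
  | [] => [y]
  | e :: L => if y.key < e.key then y :: e :: L
    else if y.key = e.key then y :: L else e :: upsert y L

theorem mem_upsert_self (y : Entry f) (L : List (Entry f)) : y ∈ upsert y L := by
  induction L with
  | nil => simp [upsert]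
  | cons e L ih =>
    simp only [upsert]
    split
    · simp
    · split
      · simp
      · simp [ih]

theorem mem_of_mem_upsert {y e : Entry f} {L : List (Entry f)} (h : e ∈ upsert y L) :
    e = y ∨ e ∈ L := by
  induction L with
  | nil => simpa [upsert] using h
  | cons d L ih =>
    simp only [upsert] at h
    split at h
    · simpa using h
    · split at h
      · simp only [List.mem_cons] at h ⊢; tauto
      · simp only [List.mem_cons] at h ⊢; tauto

theorem mem_upsert_iff {y : Entry f} {L : List (Entry f)} (hL : KeySorted L) (e : Entry f) :
    e ∈ upsert y L ↔ e = y ∨ (e ∈ L ∧ e.key ≠ y.key) := by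
  induction L with
  | nil => simp [upsert]
  | cons d L ih =>
    have hd := (List.pairwise_cons.1 hL).1
    simp only [upsert]
    split
    · rename_i h
      simp only [List.mem_cons]
      constructor
      · rintro (rfl | rfl | he)
        · exact .inl rfl
        · exact .inr ⟨.inl rfl, h.ne'⟩
        · exact .inr ⟨.inr he, (h.trans (hd e he)).ne'⟩
      · tauto
    · split
      · rename_i h h'
        simp only [List.mem_cons]
        constructor
        · rintro (rfl | he)
          · exact .inl rfl
          · exact .inr ⟨.inr he, by rw [h']; exact (hd e he).ne'⟩
        · rintro (rfl | ⟨rfl | he, hne⟩)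
          · exact .inl rfl
          · exact absurd h'.symm hne
          · exact .inr he
      · rename_i h h'
        simp only [List.mem_cons, ih (List.pairwise_cons.1 hL).2]
        constructor
        · rintro (rfl | rfl | he)
          · exact .inr ⟨.inl rfl, fun h'' => h' h''.symm⟩
          · exact .inl rfl
          · exact .inr ⟨.inr he.1, he.2⟩
        · tauto

theorem KeySorted.upsert {y : Entry f} {L : List (Entry f)} (hL : KeySorted L) :
    KeySorted (upsert y L) := by
  induction L with
  | nil => simp [EM.upsert, KeySorted]
  | cons d L ih =>
    have hd := (List.pairwise_cons.1 hL).1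
    have hL' := (List.pairwise_cons.1 hL).2
    simp only [EM.upsert]
    split
    · rename_i h
      refine List.pairwise_cons.2 ⟨fun e he => ?_, hL⟩
      rcases List.mem_cons.1 he with rfl | he
      · exact h
      · exact h.trans (hd e he)
    · split
      · rename_i h h'
        exact List.pairwise_cons.2 ⟨fun e he => h' ▸ hd e he, hL'⟩
      · rename_i h h'
        refine List.pairwise_cons.2 ⟨fun e he => ?_, ih hL'⟩
        rcases mem_of_mem_upsert he with rfl | he
        · exact lt_of_le_of_ne (not_lt.1 h) (Ne.symm h')
        · exact hd e he

theorem length_upsert_le (y : Entry f) (L : List (Entry f)) :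
    (upsert y L).length ≤ L.length + 1 := by
  induction L with
  | nil => simp [upsert]
  | cons d L ih =>
    simp only [upsert]
    split
    · simp
    · split
      · simp
      · simpa using ih

theorem le_length_upsert (y : Entry f) (L : List (Entry f)) :
    L.length ≤ (upsert y L).length := by
  induction L with
  | nil => simp
  | cons d L ih =>
    simp only [upsert]
    split
    · simp
    · split
      · simp
      · simpa using ih

theorem upsert_append_right {y : Entry f} {L L' : List (Entry f)} (h : ∀ e ∈ L, e.key < y.key) :
    upsert y (L ++ L') = L ++ upsert y L' := by
  induction L with
  | nil => rfl
  | cons d L ih =>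
    have hd := h d (by simp)
    simp only [List.cons_append, upsert]
    rw [if_neg hd.not_gt, if_neg hd.ne', ih fun e he => h e (List.mem_cons_of_mem _ he)]

theorem upsert_of_lt {y : Entry f} {L : List (Entry f)} (h : ∀ e ∈ L, y.key < e.key) :
    upsert y L = y :: L := by
  cases L with
  | nil => rfl
  | cons d L => simp [upsert, h d (by simp)]

/-- Together with `upsert_append_right`: putting an entry into the subtree where it belongs is the
same as putting it into the sorted list of all leaf entries. -/
theorem upsert_append_left {y : Entry f} {L L' : List (Entry f)} (h : ∀ e ∈ L', y.key < e.key) :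
    upsert y (L ++ L') = upsert y L ++ L' := by
  induction L with
  | nil => simpa [upsert] using upsert_of_lt h
  | cons d L ih =>
    simp only [List.cons_append, upsert]
    split
    · rfl
    · split
      · rfl
      · simp [ih]

open Classical in
/-- The counts of the entries with key `x`. -/
noncomputable def countsAt (x : ℝ) (L : List (Entry f)) : Fin f → ℕ :=
  total (L.filter fun e => e.key = x)

theorem countsAt_eq_zero {x : ℝ} {L : List (Entry f)} (h : ∀ e ∈ L, e.key ≠ x) :
    countsAt x L = 0 := by
  rw [countsAt, List.filter_eq_nil_iff.2 (by simpa using h)]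
  rfl

theorem countsAt_append (x : ℝ) (L L' : List (Entry f)) :
    countsAt x (L ++ L') = countsAt x L + countsAt x L' := by
  simp [countsAt]

/-- The counts of the replaced entry are on the left, so that no truncated subtraction is involved.
This justifies the counts in `bumpEntry`. -/
theorem total_upsert {y : Entry f} {L : List (Entry f)} (hL : KeySorted L) :
    total (upsert y L) + countsAt y.key L = total L + y.cnt := by
  induction L with
  | nil => simp [upsert, countsAt]
  | cons d L ih =>
    have hd := (List.pairwise_cons.1 hL).1
    simp only [upsert]
    split
    · rename_i h
      rw [countsAt_eq_zero]
      · simp [add_comm]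
      · intro e he
        rcases List.mem_cons.1 he with rfl | he
        · exact h.ne'
        · exact (h.trans (hd e he)).ne'
    · split
      · rename_i h h'
        have : countsAt y.key (d :: L) = d.cnt := by
          rw [← List.singleton_append, countsAt_append,
            countsAt_eq_zero (L := L) (fun e he => by rw [h']; exact (hd e he).ne')]
          simp [countsAt, h']
        rw [this]
        simp only [total_cons]
        abel
      · rename_i h h'
        have : countsAt y.key (d :: L) = countsAt y.key L := by
          rw [← List.singleton_append, countsAt_append, countsAt_eq_zero (L := [d]), zero_add]
          intro e he
          simp only [List.mem_singleton] at he
          subst he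
          exact fun h'' => h' h''.symm
        rw [this, total_cons, total_cons, add_assoc, ih (List.pairwise_cons.1 hL).2, add_assoc]

/-- The position of the child in which the value `x` belongs. -/
noncomputable def routeIdx (x : ℝ) (L : List (Entry f)) : ℕ :=
  (L.takeWhile fun e => decide (e.key ≤ x)).length - 1

/-- The child sought is the last one whose key is at most `x`. If all keys exceed `x`, the truncated
subtraction in `routeIdx` yields the first child; hence `e.key ≤ x` is guaranteed only when `pre` is
nonempty, and the key of the first child may have to be lowered later. -/
theorem route_spec (x : ℝ) {L : List (Entry f)} (hL : KeySorted L) (hne : L ≠ []) :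
    ∃ pre e post, L = pre ++ e :: post ∧ routeIdx x L = pre.length ∧
      (∀ d ∈ post, x < d.key) ∧ (pre ≠ [] → e.key ≤ x) := by
  induction L with
  | nil => exact absurd rfl hne
  | cons d L ih =>
    have hd := (List.pairwise_cons.1 hL).1
    by_cases h : d.key ≤ x
    · cases L with
      | nil =>
        exact ⟨[], d, [], rfl, by simp [routeIdx, h], by simp, by simp⟩
      | cons d' L =>
        by_cases h' : d'.key ≤ x
        · obtain ⟨pre, e, post, h1, h2, h3, h4⟩ := ih (List.pairwise_cons.1 hL).2 (by simp)
          refine ⟨d :: pre, e, post, by simp [h1], ?_, h3, fun _ => ?_⟩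
          · simp [routeIdx, h, h'] at h2 ⊢
            omega
          · by_cases hp : pre = []
            · subst hp
              simp only [List.nil_append, List.cons.injEq] at h1
              exact h1.1 ▸ h'
            · exact h4 hp
        · refine ⟨[], d, d' :: L, rfl, by simp [routeIdx, h, h'], ?_, by simp⟩
          intro e he
          rcases List.mem_cons.1 he with rfl | he
          · exact not_le.1 h'
          · exact (not_le.1 h').trans
              ((List.pairwise_cons.1 (List.pairwise_cons.1 hL).2).1 e he)
    · exact ⟨[], d, L, rfl, by simp [routeIdx, h], fun e he => (not_le.1 h).trans (hd e he), by simp⟩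

/-- Replace the entry at position `i` by a list of entries. -/
def replaceAt (L : List (Entry f)) (i : ℕ) (R : List (Entry f)) : List (Entry f) :=
  L.take i ++ R ++ L.drop (i + 1)

theorem replaceAt_append (pre : List (Entry f)) (e : Entry f) (post R : List (Entry f)) :
    replaceAt (pre ++ e :: post) pre.length R = pre ++ R ++ post := by
  simp [replaceAt]

/-- The entry for the child in which `y` is put: its counts change by those of `y`, less those
in `o`. -/
noncomputable def bumpEntry (y : Entry f) (o : Fin f → ℕ) (e : Entry f) : Entry f :=
  ⟨min e.key y.key, e.ptr, e.cnt + y.cnt - o⟩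

noncomputable def bump (y : Entry f) (o : Fin f → ℕ) (L : List (Entry f)) : List (Entry f) :=
  replaceAt L (routeIdx y.key L) (L[routeIdx y.key L]?.toList.map (bumpEntry y o))

/-- The entries for the two halves of the child with entry `e` and node `C`, the second of which
gets address `a`. -/
def splitEntry (e : Entry f) (a k : ℕ) (C : List (Entry f)) : List (Entry f) :=
  ⟨e.key, e.ptr, total (C.take k)⟩ ::
    (C.drop k).head?.toList.map fun c => ⟨c.key, a, total (C.drop k)⟩

noncomputable def splitChild (x : ℝ) (a k : ℕ) (L C : List (Entry f)) : List (Entry f) :=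
  replaceAt L (routeIdx x L) (L[routeIdx x L]?.toList.flatMap fun e => splitEntry e a k C)

/-- The entry of the child that contains the element with index `r`, and its index there; `wt` is
the number of elements for an entry. -/
def pick (wt : Entry f → ℕ) : List (Entry f) → ℕ → Option (Entry f × ℕ)
  | [], _ => none
  | e :: L, r => if r < wt e then some (e, r) else pick wt L (r - wt e)

/-! ### Trees -/

/-- A table of nodes. -/
abbrev Table (f : ℕ) := ℕ → List (Entry f)

/-- The entries in the leaves of the tree of height `h` with root `v`. -/
def flat (N : Table f) : ℕ → ℕ → List (Entry f)
  | 0, v => N v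
  | h + 1, v => (N v).flatMap fun e => flat N h e.ptr

/-- The addresses of the nodes of the tree of height `h` with root `v`. -/
def addrs (N : Table f) : ℕ → ℕ → List ℕ
  | 0, v => [v]
  | h + 1, v => v :: (N v).flatMap fun e => addrs N h e.ptr

/-- An entry of a leaf. -/
def IsLeafEntry (e : Entry f) : Prop := e.ptr = 0 ∧ (e.cnt = 0 ∨ ∃ i, e.cnt = Pi.single i 1)

/-- Well-formed trees. Nodes at level `h` have at most `2 * m h` entries, and at least `m h` if they
are thick (`t = false`); nodes that are not thick are the root and, below a node with a single
child, that child. -/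
def WF (m : ℕ → ℕ) (N : Table f) : Bool → ℕ → ℕ → Prop
  | t, 0, v => KeySorted (N v) ∧ (∀ e ∈ N v, IsLeafEntry e) ∧ (N v).length ≤ 2 * m 0 ∧
      (t = false → m 0 ≤ (N v).length)
  | t, h + 1, v =>
      (N v).Pairwise (fun e e' => e.key < e'.key ∧ ∀ y ∈ flat N h e.ptr, y.key < e'.key) ∧
      (∀ e ∈ N v, (∀ y ∈ flat N h e.ptr, e.key ≤ y.key) ∧ e.cnt = total (flat N h e.ptr) ∧
        WF m N (t && decide ((N v).length ≤ 1)) h e.ptr) ∧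
      (N v).length ≤ 2 * m (h + 1) ∧ (t = false → m (h + 1) ≤ (N v).length)

theorem addrs_self (N : Table f) (h v : ℕ) : v ∈ addrs N h v := by
  cases h <;> simp [addrs]

/-- A tree depends only on the nodes at its own addresses. This is the frame rule that carries
siblings through every change of a table. -/
theorem congr_of_eqOn {N N' : Table f} {h : ℕ} : ∀ {v : ℕ}, (∀ a ∈ addrs N h v, N' a = N a) →
    flat N' h v = flat N h v ∧ addrs N' h v = addrs N h v ∧
      ∀ m t, WF m N t h v → WF m N' t h v := by
  induction h with
  | zero =>
    intro v hN
    have hv : N' v = N v := hN v (addrs_self N 0 v)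
    exact ⟨hv, rfl, fun m t h => by simpa only [WF, hv] using h⟩
  | succ h ih =>
    intro v hN
    have hv : N' v = N v := hN v (addrs_self N _ v)
    have hc : ∀ e ∈ N v, ∀ a ∈ addrs N h e.ptr, N' a = N a := fun e he a ha =>
      hN a (List.mem_cons_of_mem _ (List.mem_flatMap.2 ⟨e, he, ha⟩))
    have h1 : ∀ e ∈ N v, flat N' h e.ptr = flat N h e.ptr := fun e he => (ih (hc e he)).1
    refine ⟨?_, ?_, fun m t hw => ?_⟩
    · simp only [flat, hv]
      exact List.flatMap_congr h1
    · simp only [addrs, hv]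
      exact congrArg _ (List.flatMap_congr fun e he => (ih (hc e he)).2.1)
    · simp only [WF, hv] at hw ⊢
      refine ⟨?_, fun e he => ?_, hw.2.2⟩
      · exact hw.1.imp_of_mem fun {a b} ha hb hab => by rw [h1 a ha]; exact hab
      · rw [h1 e he]
        exact ⟨(hw.2.1 e he).1, (hw.2.1 e he).2.1, (ih (hc e he)).2.2 m _ (hw.2.1 e he).2.2⟩

theorem WF.keySorted_node {m : ℕ → ℕ} {N : Table f} {t : Bool} {h v : ℕ} (hw : WF m N t h v) :
    KeySorted (N v) := by
  cases h with
  | zero => exact hw.1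
  | succ h => exact hw.1.imp fun hab => hab.1

theorem WF.length_le {m : ℕ → ℕ} {N : Table f} {t : Bool} {h v : ℕ} (hw : WF m N t h v) :
    (N v).length ≤ 2 * m h := by
  cases h with
  | zero => exact hw.2.2.1
  | succ h => exact hw.2.2.1

theorem WF.le_length {m : ℕ → ℕ} {N : Table f} {h v : ℕ} (hw : WF m N false h v) :
    m h ≤ (N v).length := by
  cases h with
  | zero => exact hw.2.2.2 rfl
  | succ h => exact hw.2.2.2 rfl

theorem WF.isLeafEntry {m : ℕ → ℕ} {N : Table f} {h : ℕ} : ∀ {t : Bool} {v : ℕ},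
    WF m N t h v → ∀ e ∈ flat N h v, IsLeafEntry e := by
  induction h with
  | zero => exact fun hw => hw.2.1
  | succ h ih =>
    intro t v hw e he
    obtain ⟨d, hd, he⟩ := List.mem_flatMap.1 he
    exact ih (hw.2.1 d hd).2.2 e he

theorem WF.keySorted_flat {m : ℕ → ℕ} {N : Table f} {h : ℕ} : ∀ {t : Bool} {v : ℕ},
    WF m N t h v → KeySorted (flat N h v) := by
  induction h with
  | zero => exact fun hw => hw.1
  | succ h ih =>
    intro t v hw
    rw [KeySorted, flat, List.pairwise_flatMap]
    refine ⟨fun e he => ih (hw.2.1 e he).2.2, ?_⟩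
    refine hw.1.imp_of_mem fun {a b} _ hb hab y hy y' hy' => ?_
    exact (hab.2 y hy).trans_le ((hw.2.1 b hb).1 y' hy')

theorem total_flatMap (L : List (Entry f)) (F : Entry f → List (Entry f))
    (h : ∀ e ∈ L, e.cnt = total (F e)) : total (L.flatMap F) = total L := by
  induction L with
  | nil => rfl
  | cons e L ih =>
    rw [List.flatMap_cons, total_append, total_cons, h e (by simp),
      ih fun d hd => h d (List.mem_cons_of_mem _ hd)]

theorem WF.total_node {m : ℕ → ℕ} {N : Table f} {t : Bool} {h v : ℕ} (hw : WF m N t h v) :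
    total (N v) = total (flat N h v) := by
  cases h with
  | zero => rfl
  | succ h => exact (total_flatMap _ _ fun e he => (hw.2.1 e he).2.1).symm

/-- After a split, a value from the first half separates the keys of the two halves strictly; for
this the halves must not be empty. -/
theorem WF.flat_ne_nil {m : ℕ → ℕ} (hm : ∀ h, 0 < m h) {N : Table f} {h : ℕ} : ∀ {v : ℕ},
    WF m N false h v → flat N h v ≠ [] := by
  induction h with
  | zero =>
    intro v hw h0
    have := hw.2.2.2 rfl
    have := hm 0
    simp only [flat] at h0
    simp [h0] at *
    omega
  | succ h ih =>
    intro v hw h0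
    have h1 := hw.2.2.2 rfl
    have h2 := hm (h + 1)
    obtain ⟨e, he⟩ := List.exists_mem_of_length_pos (h2.trans_le h1)
    exact ih (by simpa using (hw.2.1 e he).2.2) (List.flatMap_eq_nil_iff.1 h0 e he)

/-! ### Putting an entry into a tree -/

/-- The addresses `al + 1, …, al'`. -/
def fresh (al al' : ℕ) : List ℕ := List.range' (al + 1) (al' - al)

theorem mem_fresh {al al' a : ℕ} : a ∈ fresh al al' ↔ al < a ∧ a ≤ al' := by
  simp only [fresh, List.mem_range'_1]
  omega

theorem fresh_self (al : ℕ) : fresh al al = [] := by simp [fresh]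

theorem fresh_succ (al : ℕ) : fresh al (al + 1) = [al + 1] := by
  simp [fresh]

theorem nodup_fresh (al al' : ℕ) : (fresh al al').Nodup := List.nodup_range' 

theorem length_fresh (al al' : ℕ) : (fresh al al').length = al' - al := by simp [fresh]

theorem fresh_append {a b c : ℕ} (h : a ≤ b) (h' : b ≤ c) :
    fresh a b ++ fresh b c = fresh a c := by
  obtain ⟨i, rfl⟩ := Nat.exists_eq_add_of_le h
  obtain ⟨j, rfl⟩ := Nat.exists_eq_add_of_le h'
  simp only [fresh, Nat.add_sub_cancel_left]
  rw [show a + i + j - a = i + j by omega, show a + i + 1 = a + 1 + 1 * i by omega,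
    List.range'_append]

/-- Make sure that the child in which `x` belongs exists and is not full. -/
noncomputable def prep (m : ℕ → ℕ) (x : ℝ) (h v : ℕ) (p : Table f × ℕ) : Table f × ℕ :=
  match (p.1 v)[routeIdx x (p.1 v)]? with
  | none => (Function.update (Function.update p.1 (p.2 + 1) []) v [⟨x, p.2 + 1, 0⟩], p.2 + 1)
  | some e =>
    if (p.1 e.ptr).length < 2 * m h then p
    else (Function.update (Function.update (Function.update p.1
      (p.2 + 1) ((p.1 e.ptr).drop (m h))) e.ptr ((p.1 e.ptr).take (m h)))
      v (splitChild x (p.2 + 1) (m h) (p.1 v) (p.1 e.ptr)), p.2 + 1)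

/-- Put the entry `y` in the tree of height `h` with root `v`, when the counts of the entries with
its key are `o`; the addresses in use are at most the second component of `p`. -/
noncomputable def put (m : ℕ → ℕ) (y : Entry f) (o : Fin f → ℕ) : ℕ → ℕ → Table f × ℕ → Table f × ℕ
  | 0, v, p => (Function.update p.1 v (upsert y (p.1 v)), p.2)
  | h + 1, v, p =>
    let p' := prep m y.key h v p
    match (p'.1 v)[routeIdx y.key (p'.1 v)]? with
    | none => p'
    | some e => put m y o h e.ptr (Function.update p'.1 v (bump y o (p'.1 v)), p'.2)

/-- The tree of height `h` with root `v` in `N` is well-formed, and its addresses are at most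
`al`. -/
structure IsTree (m : ℕ → ℕ) (N : Table f) (t : Bool) (h v al : ℕ) : Prop where
  wf : WF m N t h v
  nodup : (addrs N h v).Nodup
  le : ∀ a ∈ addrs N h v, a ≤ al

/-- `N'` arises from `N` by a change of the tree of height `h` with root `v`, which gets new nodes
at the addresses `al + 1, …, al'`. -/
structure Grows (m : ℕ → ℕ) (N N' : Table f) (t : Bool) (h v al al' : ℕ) : Prop where
  wf : WF m N' t h v
  le : al ≤ al'
  perm : (addrs N' h v).Perm (fresh al al' ++ addrs N h v)
  frame : ∀ a, a ∉ addrs N h v → ¬ (al < a ∧ a ≤ al') → N' a = N a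

theorem Grows.isTree {m : ℕ → ℕ} {N N' : Table f} {t t' : Bool} {h v al al' : ℕ}
    (hg : Grows m N N' t h v al al') (ht : IsTree m N t' h v al) : IsTree m N' t h v al' where
  wf := hg.wf
  nodup := by
    rw [hg.perm.nodup_iff, List.nodup_append']
    refine ⟨nodup_fresh _ _, ht.nodup, ?_⟩
    intro a ha ha'
    have := (mem_fresh.1 ha).1
    have := ht.le a ha'
    omega
  le a ha := by
    rcases List.mem_append.1 (hg.perm.subset ha) with ha | ha
    · exact (mem_fresh.1 ha).2
    · exact (ht.le a ha).trans hg.le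

theorem Grows.trans {m : ℕ → ℕ} {N N' N'' : Table f} {t t' : Bool} {h v al al' al'' : ℕ}
    (h₁ : Grows m N N' t h v al al') (h₂ : Grows m N' N'' t' h v al' al'') :
    Grows m N N'' t' h v al al'' where
  wf := h₂.wf
  le := h₁.le.trans h₂.le
  perm := by
    refine h₂.perm.trans ((h₁.perm.append_left _).trans ?_)
    rw [← List.append_assoc, ← fresh_append h₁.le h₂.le]
    exact List.Perm.append_right _ List.perm_append_comm
  frame a ha ha' := by
    have := h₁.le
    have := h₂.le
    rw [h₂.frame a ?_ (by omega), h₁.frame a ha (by omega)]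
    intro h
    rcases List.mem_append.1 (h₁.perm.subset h) with h | h
    · have := mem_fresh.1 h
      omega
    · exact ha h

theorem Grows.refl {m : ℕ → ℕ} {N : Table f} {t : Bool} {h v al : ℕ} (hw : WF m N t h v) :
    Grows m N N t h v al al where
  wf := hw
  le := le_rfl
  perm := by simp [fresh_self]
  frame _ _ _ := rfl

theorem update_eqOn {N : Table f} {v : ℕ} {L : List (Entry f)} {X : List ℕ} (h : v ∉ X) :
    ∀ a ∈ X, Function.update N v L a = N a := fun a ha =>
  Function.update_of_ne (fun hav : a = v => h (hav ▸ ha)) _ _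

/-- A tree without entries at the root. -/
theorem wf_of_nil (m : ℕ → ℕ) {N : Table f} {h v : ℕ} (hv : N v = []) : WF m N true h v := by
  cases h <;> simp [WF, hv, KeySorted]

theorem flat_of_nil {N : Table f} {h v : ℕ} (hv : N v = []) : flat N h v = [] := by
  cases h <;> simp [flat, hv]

theorem addrs_of_nil {N : Table f} {h v : ℕ} (hv : N v = []) : addrs N h v = [v] := by
  cases h <;> simp [addrs, hv]

/-- Only a thin node can be empty, and then its new child is a single child, which may be thin and
empty as well. In this way the path to the first leaf is created on demand. -/
theorem prep_none {m : ℕ → ℕ} {N : Table f} {t : Bool} {h v al : ℕ}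
    (ht : IsTree m N t (h + 1) v al) (hm : ∀ h, 0 < m h) (hv : N v = []) (x : ℝ) {N₁ : Table f}
    (hN₁ : N₁ = Function.update (Function.update N (al + 1) []) v [⟨x, al + 1, 0⟩]) :
    Grows m N N₁ t (h + 1) v al (al + 1) ∧ flat N₁ (h + 1) v = flat N (h + 1) v ∧
      N₁ v = [⟨x, al + 1, 0⟩] ∧ N₁ (al + 1) = [] := by
  have hva : v ≤ al := ht.le v (addrs_self N _ v)
  have h1 : N₁ v = [⟨x, al + 1, 0⟩] := by simp [hN₁]
  have h2 : N₁ (al + 1) = [] := by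
    rw [hN₁, Function.update_of_ne (by omega)]; simp
  have htt : t = true := by
    cases t with
    | true => rfl
    | false =>
      have := ht.wf.le_length
      have := hm (h + 1)
      simp [hv] at *
      omega
  subst htt
  refine ⟨⟨?_, by omega, ?_, ?_⟩, ?_, h1, h2⟩
  · simp only [WF, h1]
    refine ⟨by simp, ?_, ?_, by simp⟩
    · intro e he
      simp only [List.mem_singleton] at he
      subst he
      simp only [flat_of_nil h2]
      exact ⟨by simp, rfl, by simpa using wf_of_nil m h2⟩
    · have := hm (h + 1)
      simp
      omega
  · simp [addrs, h1, hv, addrs_of_nil h2, fresh_succ]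
    exact List.Perm.swap _ _ _
  · intro a ha ha'
    have hav : a ≠ v := fun h => ha (by rw [h]; exact addrs_self N _ v)
    rw [hN₁, Function.update_of_ne hav, Function.update_of_ne (by omega)]
  · simp [flat, h1, hv, flat_of_nil h2]

/-- Splitting a full node. -/
theorem split_node {m : ℕ → ℕ} (hm : ∀ h, 1 < m h) {N N₁ : Table f} {t : Bool} {h c a : ℕ}
    (hw : WF m N t h c) (hnd : (addrs N h c).Nodup) (hlen : 2 * m h ≤ (N c).length)
    (hc : N₁ c = (N c).take (m h)) (ha : N₁ a = (N c).drop (m h))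
    (hN : ∀ b ∈ addrs N h c, b ≠ c → N₁ b = N b) :
    WF m N₁ false h c ∧ WF m N₁ false h a ∧ flat N h c = flat N₁ h c ++ flat N₁ h a ∧
      (addrs N₁ h c ++ addrs N₁ h a).Perm (a :: addrs N h c) ∧
      ∀ d ∈ (N₁ a).head?, (∀ y ∈ flat N₁ h c, y.key < d.key) ∧ ∀ y ∈ flat N₁ h a, d.key ≤ y.key := by
  have hle := hw.length_le
  have hsplit : N c = N₁ c ++ N₁ a := by rw [hc, ha, List.take_append_drop]
  have hlc : (N₁ c).length = m h := by rw [hc, List.length_take]; omega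
  have hla : (N₁ a).length = m h := by rw [ha, List.length_drop]; omega
  cases h with
  | zero =>
    have hs : KeySorted (N₁ c ++ N₁ a) := hsplit ▸ hw.1
    have hs' := List.pairwise_append.1 hs
    have hleaf : ∀ e ∈ N₁ c ++ N₁ a, IsLeafEntry e := hsplit ▸ hw.2.1
    refine ⟨⟨hs'.1, fun e he => hleaf e (by simp [he]), by omega, fun _ => by omega⟩,
      ⟨hs'.2.1, fun e he => hleaf e (by simp [he]), by omega, fun _ => by omega⟩, hsplit,
      by simpa [addrs] using List.Perm.swap _ _ _, ?_⟩
    intro d hd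
    have hd' : d ∈ N₁ a := List.mem_of_mem_head? hd
    refine ⟨fun y hy => hs'.2.2 y hy d hd', fun y hy => ?_⟩
    simp only [flat] at hy
    cases hL : N₁ a with
    | nil => simp [hL] at hd
    | cons d' L =>
      rw [hL] at hd hs' hy
      simp only [List.head?_cons, Option.mem_def, Option.some.injEq] at hd
      subst hd
      rcases List.mem_cons.1 hy with rfl | hy
      · exact le_rfl
      · exact ((List.pairwise_cons.1 hs'.2.1).1 y hy).le
  | succ h =>
    have hnd' := List.nodup_cons.1 hnd
    have hcong : ∀ e ∈ N₁ c ++ N₁ a, flat N₁ h e.ptr = flat N h e.ptr ∧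
        addrs N₁ h e.ptr = addrs N h e.ptr ∧ ∀ m t, WF m N t h e.ptr → WF m N₁ t h e.ptr := by
      intro e he
      rw [← hsplit] at he
      refine congr_of_eqOn fun b hb => ?_
      have hb' : b ∈ (N c).flatMap fun e => addrs N h e.ptr := List.mem_flatMap.2 ⟨e, he, hb⟩
      exact hN b (List.mem_cons_of_mem _ hb') fun hbc => hnd'.1 (hbc ▸ hb')
    have hf₁ : flat N₁ (h + 1) c = (N₁ c).flatMap fun e => flat N h e.ptr :=
      List.flatMap_congr fun e he => (hcong e (by simp [he])).1
    have hf₂ : flat N₁ (h + 1) a = (N₁ a).flatMap fun e => flat N h e.ptr :=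
      List.flatMap_congr fun e he => (hcong e (by simp [he])).1
    have ha₁ : addrs N₁ (h + 1) c = c :: (N₁ c).flatMap fun e => addrs N h e.ptr :=
      congrArg _ (List.flatMap_congr fun e he => (hcong e (by simp [he])).2.1)
    have ha₂ : addrs N₁ (h + 1) a = a :: (N₁ a).flatMap fun e => addrs N h e.ptr :=
      congrArg _ (List.flatMap_congr fun e he => (hcong e (by simp [he])).2.1)
    have hpw := hw.1
    rw [hsplit] at hpw
    have hpw' := List.pairwise_append.1 hpw
    have hent : ∀ e ∈ N₁ c ++ N₁ a, (∀ y ∈ flat N₁ h e.ptr, e.key ≤ y.key) ∧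
        e.cnt = total (flat N₁ h e.ptr) ∧ WF m N₁ false h e.ptr := by
      intro e he
      obtain ⟨h1, h2, h3⟩ := hw.2.1 e (hsplit ▸ he)
      rw [(hcong e he).1]
      refine ⟨h1, h2, (hcong e he).2.2 m _ ?_⟩
      -- The full node has at least `2 * m (h + 1) > 1` children, so all of them are thick, even if
      -- the node itself need not be. The halves can therefore keep them.
      have : ¬ (N c).length ≤ 1 := by have := hm (h + 1); omega
      simpa [this] using h3
    have hpair : ∀ L : List (Entry f), (∀ e ∈ L, e ∈ N₁ c ++ N₁ a) →
        L.Pairwise (fun e e' => e.key < e'.key ∧ ∀ y ∈ flat N h e.ptr, y.key < e'.key) →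
        L.Pairwise (fun e e' => e.key < e'.key ∧ ∀ y ∈ flat N₁ h e.ptr, y.key < e'.key) :=
      fun L hL hp => hp.imp_of_mem fun {e e'} he _ hee' => by
        rw [(hcong e (hL e he)).1]; exact hee'
    refine ⟨⟨hpair _ (fun e he => by simp [he]) hpw'.1, fun e he => ?_, by omega, fun _ => by omega⟩,
      ⟨hpair _ (fun e he => by simp [he]) hpw'.2.1, fun e he => ?_, by omega, fun _ => by omega⟩,
      ?_, ?_, ?_⟩
    · simpa using hent e (by simp [he])
    · simpa using hent e (by simp [he])
    · rw [hf₁, hf₂, flat, hsplit, List.flatMap_append]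
    · rw [ha₁, ha₂, addrs, hsplit, List.flatMap_append]
      exact List.perm_middle.trans (List.Perm.refl _)
    · intro d hd
      have hd' : d ∈ N₁ a := List.mem_of_mem_head? hd
      rw [hf₁]
      refine ⟨fun y hy => ?_, fun y hy => ?_⟩
      · obtain ⟨e, he, hy⟩ := List.mem_flatMap.1 hy
        exact (hpw'.2.2 e he d hd').2 y hy
      · rw [flat] at hy
        obtain ⟨e, he, hy⟩ := List.mem_flatMap.1 hy
        have h1 := (hent e (by simp [he])).1 y hy
        refine le_trans ?_ h1
        cases hL : N₁ a with
        | nil => simp [hL] at hd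
        | cons d' L =>
          rw [hL] at hd hpw' he
          simp only [List.head?_cons, Option.mem_def, Option.some.injEq] at hd
          subst hd
          rcases List.mem_cons.1 he with rfl | he
          · exact le_rfl
          · exact ((List.pairwise_cons.1 hpw'.2.1).1 e he).1.le

/-- Both halves have `m h` entries, enough to be thick and too few to be full. The node `v` now has
at least two children, all of which must be thick; its other children were so before, because they
already had a sibling. -/
theorem prep_split {m : ℕ → ℕ} (hm : ∀ h, 1 < m h) {N N₁ : Table f} {t : Bool} {h v al : ℕ}
    (ht : IsTree m N t (h + 1) v al) (hfull : (N v).length < 2 * m (h + 1)) {x : ℝ}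
    {pre post : List (Entry f)} {e : Entry f} (hv : N v = pre ++ e :: post)
    (hidx : routeIdx x (N v) = pre.length) (hpost : ∀ d ∈ post, x < d.key)
    (hpre : pre ≠ [] → e.key ≤ x) (hC : 2 * m h ≤ (N e.ptr).length)
    (hN₁ : N₁ = Function.update (Function.update (Function.update N
      (al + 1) ((N e.ptr).drop (m h))) e.ptr ((N e.ptr).take (m h)))
      v (splitChild x (al + 1) (m h) (N v) (N e.ptr))) :
    Grows m N N₁ t (h + 1) v al (al + 1) ∧ flat N₁ (h + 1) v = flat N (h + 1) v ∧
      ∃ e', (N₁ v)[routeIdx x (N₁ v)]? = some e' ∧ (N₁ e'.ptr).length < 2 * m h := by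
  have hva : v ≤ al := ht.le v (addrs_self N _ v)
  have hev : e ∈ N v := by simp [hv]
  have haddr : addrs N (h + 1) v = v :: ((pre.flatMap fun e => addrs N h e.ptr) ++
      (addrs N h e.ptr ++ post.flatMap fun e => addrs N h e.ptr)) := by
    rw [addrs, hv, List.flatMap_append, List.flatMap_cons]
  have hnd := ht.nodup
  rw [haddr, List.nodup_cons, List.nodup_append', List.nodup_append'] at hnd
  obtain ⟨hvn, hndpre, ⟨hndc, hndpost, hdcpost⟩, hdpre⟩ := hnd
  have hca : e.ptr ≤ al := ht.le _ (by rw [haddr]; simp [addrs_self])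
  have hcv : e.ptr ≠ v := fun h' => hvn (by rw [← h']; simp [addrs_self])
  have hall : ∀ a ∈ addrs N (h + 1) v, a ≤ al := ht.le
  have hNc : N₁ e.ptr = (N e.ptr).take (m h) := by
    rw [hN₁, Function.update_of_ne hcv, Function.update_self]
  have hNa : N₁ (al + 1) = (N e.ptr).drop (m h) := by
    rw [hN₁, Function.update_of_ne (by omega), Function.update_of_ne (by omega),
      Function.update_self]
  have hNo : ∀ b, b ≠ v → b ≠ e.ptr → b ≠ al + 1 → N₁ b = N b := fun b h1 h2 h3 => by
    rw [hN₁, Function.update_of_ne h1, Function.update_of_ne h2, Function.update_of_ne h3]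
  obtain ⟨hl, hcnt, hwf⟩ := ht.wf.2.1 e hev
  obtain ⟨hw₁, hw₂, hflat, hperm, hkeys⟩ := split_node (N₁ := N₁) (a := al + 1) hm hwf hndc hC hNc
    hNa (fun b hb hbc => hNo b (fun hbv => hvn (by rw [← hbv]; simp [hb])) hbc (by
      have := hall b (by rw [haddr]; simp [hb]); omega))
  have hmh := hm h
  obtain ⟨c₂, R, hc₂⟩ : ∃ c R, N₁ (al + 1) = c :: R :=
    List.exists_cons_of_ne_nil (by
      intro h'
      have := hw₂.le_length
      simp [h'] at this
      omega)
  have hdrop : (N e.ptr).drop (m h) = c₂ :: R := by rw [← hNa, hc₂]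
  obtain ⟨hk₁, hk₂⟩ := hkeys c₂ (by simp [hc₂])
  have htot₁ : total ((N e.ptr).take (m h)) = total (flat N₁ h e.ptr) := by
    rw [← hNc]; exact hw₁.total_node
  have htot₂ : total ((N e.ptr).drop (m h)) = total (flat N₁ h (al + 1)) := by
    rw [← hNa]; exact hw₂.total_node
  set e₁ : Entry f := ⟨e.key, e.ptr, total (flat N₁ h e.ptr)⟩ with he₁
  set e₂ : Entry f := ⟨c₂.key, al + 1, total (flat N₁ h (al + 1))⟩ with he₂
  have hNv : N₁ v = pre ++ e₁ :: e₂ :: post := by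
    rw [hN₁, Function.update_self, splitChild, hidx, hv, replaceAt_append]
    simp [splitEntry, hdrop, htot₁, he₁, he₂, ← htot₂]
  have hcong : ∀ d ∈ pre ++ post, flat N₁ h d.ptr = flat N h d.ptr ∧
      addrs N₁ h d.ptr = addrs N h d.ptr ∧ ∀ m t, WF m N t h d.ptr → WF m N₁ t h d.ptr := by
    intro d hd
    refine congr_of_eqOn fun b hb => ?_
    have hb' : b ∈ (pre.flatMap fun e => addrs N h e.ptr) ∨
        b ∈ post.flatMap fun e => addrs N h e.ptr := by
      rcases List.mem_append.1 hd with hd | hd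
      · exact .inl (List.mem_flatMap.2 ⟨d, hd, hb⟩)
      · exact .inr (List.mem_flatMap.2 ⟨d, hd, hb⟩)
    refine hNo b (fun hbv => hvn ?_) (fun hbc => ?_) ?_
    · rw [← hbv, List.mem_append, List.mem_append]; tauto
    · have hself : b ∈ addrs N h e.ptr := by rw [hbc]; exact addrs_self N h e.ptr
      rcases hb' with hb' | hb'
      · exact hdpre hb' (List.mem_append_left _ hself)
      · exact hdcpost hself hb'
    · have := hall b (by
        rw [haddr, List.mem_cons, List.mem_append, List.mem_append]; tauto)
      omega
  have hfpre : (pre.flatMap fun e => flat N₁ h e.ptr) = pre.flatMap fun e => flat N h e.ptr :=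
    List.flatMap_congr fun d hd => (hcong d (by simp [hd])).1
  have hfpost : (post.flatMap fun e => flat N₁ h e.ptr) = post.flatMap fun e => flat N h e.ptr :=
    List.flatMap_congr fun d hd => (hcong d (by simp [hd])).1
  have hapre : (pre.flatMap fun e => addrs N₁ h e.ptr) = pre.flatMap fun e => addrs N h e.ptr :=
    List.flatMap_congr fun d hd => (hcong d (by simp [hd])).2.1
  have hapost : (post.flatMap fun e => addrs N₁ h e.ptr) = post.flatMap fun e => addrs N h e.ptr :=
    List.flatMap_congr fun d hd => (hcong d (by simp [hd])).2.1
  have hflat' : flat N₁ (h + 1) v = flat N (h + 1) v := by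
    simp only [flat, hNv, hv, List.flatMap_append, List.flatMap_cons, hfpre, hfpost, hflat, he₁,
      he₂, List.append_assoc]
  have hne₁ := hw₁.flat_ne_nil fun h => (Nat.zero_lt_one.trans (hm h))
  have hne₂ := hw₂.flat_ne_nil fun h => (Nat.zero_lt_one.trans (hm h))
  obtain ⟨y₁, hy₁⟩ := List.exists_mem_of_ne_nil _ hne₁
  obtain ⟨y₂, hy₂⟩ := List.exists_mem_of_ne_nil _ hne₂
  have hsub₁ : ∀ y ∈ flat N₁ h e.ptr, y ∈ flat N h e.ptr := fun y hy => by rw [hflat]; simp [hy]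
  have hsub₂ : ∀ y ∈ flat N₁ h (al + 1), y ∈ flat N h e.ptr := fun y hy => by
    rw [hflat]; simp [hy]
  -- Any value `y₁` of the first half lies between the two keys, strictly below the second.
  have he₁₂ : e.key < c₂.key := (hl y₁ (hsub₁ y₁ hy₁)).trans_lt (hk₁ y₁ hy₁)
  have hpw := ht.wf.1
  rw [hv, List.pairwise_append, List.pairwise_cons] at hpw
  obtain ⟨hpw₁, ⟨hpw₂, hpw₃⟩, hpw₄⟩ := hpw
  have hbool : (t && decide ((pre ++ e₁ :: e₂ :: post).length ≤ 1)) = false := by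
    have : ¬ (pre ++ e₁ :: e₂ :: post).length ≤ 1 := by
      simp only [List.length_append, List.length_cons]; omega
    simp only [this, decide_false, Bool.and_false]
  have hchild : ∀ d ∈ pre ++ post, WF m N false h d.ptr := by
    intro d hd
    have hd' : d ∈ N v := by
      rw [hv]
      rcases List.mem_append.1 hd with hd | hd <;> simp [hd]
    have := (ht.wf.2.1 d hd').2.2
    have hlen : ¬ (N v).length ≤ 1 := by
      rw [hv]
      have : 0 < (pre ++ post).length := List.length_pos_of_mem hd
      simp only [List.length_append, List.length_cons] at this ⊢
      omega
    simpa [hlen] using this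
  have hwf' : WF m N₁ t (h + 1) v := by
    simp only [WF, hNv, hbool]
    refine ⟨?_, ?_, ?_, ?_⟩
    · rw [List.pairwise_append, List.pairwise_cons, List.pairwise_cons]
      refine ⟨?_, ⟨?_, ?_, ?_⟩, ?_⟩
      · exact hpw₁.imp_of_mem fun {a b} ha _ hab => by
          rw [(hcong a (by simp [ha])).1]; exact hab
      · intro d hd
        rcases List.mem_cons.1 hd with rfl | hd
        · exact ⟨he₁₂, hk₁⟩
        · exact ⟨(hpw₂ d hd).1, fun y hy => (hpw₂ d hd).2 y (hsub₁ y hy)⟩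
      · intro d hd
        exact ⟨(hk₂ y₂ hy₂).trans_lt ((hpw₂ d hd).2 y₂ (hsub₂ y₂ hy₂)),
          fun y hy => (hpw₂ d hd).2 y (hsub₂ y hy)⟩
      · exact hpw₃.imp_of_mem fun {a b} ha _ hab => by
          rw [(hcong a (by simp [ha])).1]; exact hab
      · intro a ha d hd
        rw [(hcong a (by simp [ha])).1]
        have hae := hpw₄ a ha e (by simp)
        rcases List.mem_cons.1 hd with rfl | hd
        · exact hae
        · rcases List.mem_cons.1 hd with rfl | hd
          · exact ⟨hae.1.trans he₁₂, fun y hy => (hae.2 y hy).trans he₁₂⟩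
          · exact hpw₄ a ha d (by simp [hd])
    · intro d hd
      simp only [List.mem_append, List.mem_cons] at hd
      have hold : d ∈ pre ++ post → (∀ y ∈ flat N₁ h d.ptr, d.key ≤ y.key) ∧
          d.cnt = total (flat N₁ h d.ptr) ∧ WF m N₁ false h d.ptr := by
        intro hd
        have hd' : d ∈ N v := by
          rw [hv]
          rcases List.mem_append.1 hd with hd | hd <;> simp [hd]
        rw [(hcong d hd).1]
        exact ⟨(ht.wf.2.1 d hd').1, (ht.wf.2.1 d hd').2.1, (hcong d hd).2.2 _ _ (hchild d hd)⟩
      rcases hd with hd | rfl | rfl | hd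
      · exact hold (by simp [hd])
      · exact ⟨fun y hy => hl y (hsub₁ y hy), rfl, hw₁⟩
      · exact ⟨hk₂, rfl, hw₂⟩
      · exact hold (by simp [hd])
    · rw [hv] at hfull
      simp only [List.length_append, List.length_cons] at hfull ⊢
      omega
    · intro h'
      have := ht.wf.2.2.2 h'
      rw [hv] at this
      simp only [List.length_append, List.length_cons] at this ⊢
      omega
  refine ⟨⟨hwf', by omega, ?_, ?_⟩, hflat', ?_⟩
  · rw [haddr, fresh_succ]
    have : addrs N₁ (h + 1) v = v :: ((pre.flatMap fun e => addrs N h e.ptr) ++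
        ((addrs N₁ h e.ptr ++ addrs N₁ h (al + 1)) ++
          post.flatMap fun e => addrs N h e.ptr)) := by
      rw [addrs, hNv, List.flatMap_append, List.flatMap_cons, List.flatMap_cons, hapre, hapost,
        List.append_assoc]
    rw [this]
    refine ((((hperm.append_right _).append_left _).cons v).trans ?_)
    rw [List.cons_append]
    refine (List.perm_middle.cons v).trans ?_
    exact List.Perm.swap _ _ _
  · intro a ha ha'
    refine hNo a (fun h' => ha ?_) (fun h' => ha ?_) (by omega)
    · rw [h']; exact addrs_self N _ v
    · rw [h', haddr]; simp [addrs_self]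
  · obtain ⟨pre', e', post', h1, h2, h3, h4⟩ := route_spec x hwf'.keySorted_node
      (by rw [hNv]; simp)
    refine ⟨e', by rw [h2, h1]; simp, ?_⟩
    have hlc : (N₁ e.ptr).length < 2 * m h := by rw [hNc, List.length_take]; omega
    have hla : (N₁ (al + 1)).length < 2 * m h := by
      have := hwf.length_le
      rw [hNa, List.length_drop]; omega
    -- Routing in the new node must lead to one of the halves. Comparing the two decompositions of
    -- the list, a later entry would have a key above `x`, and an earlier one would leave `e₁`,
    -- whose key is at most `x`, among the entries above `x`.
    rw [hNv, List.append_eq_append_iff] at h1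
    rcases h1 with ⟨a, ha₁, ha₂⟩ | ⟨a, ha₁, ha₂⟩
    · cases a with
      | nil =>
        simp only [List.nil_append, List.cons.injEq] at ha₂
        rw [← ha₂.1]; exact hlc
      | cons b a =>
        simp only [List.cons_append, List.cons.injEq] at ha₂
        have hp : pre' ≠ [] := by rw [ha₁]; simp
        cases a with
        | nil =>
          simp only [List.nil_append, List.cons.injEq] at ha₂
          rw [← ha₂.2.1]; exact hla
        | cons b a =>
          exfalso
          simp only [List.cons_append, List.cons.injEq] at ha₂
          exact absurd (h4 hp) (not_le.2 (hpost e' (by rw [ha₂.2.2]; simp)))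
    · cases a with
      | nil =>
        simp only [List.nil_append, List.cons.injEq] at ha₂
        rw [ha₂.1]; exact hlc
      | cons b a =>
        exfalso
        simp only [List.cons_append, List.cons.injEq] at ha₂
        have hp : pre ≠ [] := by rw [ha₁]; simp
        have := h3 e₁ (by rw [ha₂.2]; simp)
        exact absurd (hpre hp) (not_le.2 this)

theorem prep_spec {m : ℕ → ℕ} (hm : ∀ h, 1 < m h) {N : Table f} {t : Bool} {h v al : ℕ}
    (ht : IsTree m N t (h + 1) v al) (hfull : (N v).length < 2 * m (h + 1)) (x : ℝ)
    {N₁ : Table f} {al₁ : ℕ} (hp : prep m x h v (N, al) = (N₁, al₁)) :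
    Grows m N N₁ t (h + 1) v al al₁ ∧ al₁ ≤ al + 1 ∧ flat N₁ (h + 1) v = flat N (h + 1) v ∧
      ∃ e', (N₁ v)[routeIdx x (N₁ v)]? = some e' ∧ (N₁ e'.ptr).length < 2 * m h := by
  by_cases hv : N v = []
  · have hnone : (N v)[routeIdx x (N v)]? = none := by simp [hv]
    simp only [prep, hnone, Prod.mk.injEq] at hp
    obtain ⟨hp, rfl⟩ := hp
    obtain ⟨h1, h2, h3, h4⟩ := prep_none ht (fun h => Nat.zero_lt_one.trans (hm h)) hv x hp.symm
    have := hm h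
    exact ⟨h1, le_rfl, h2, ⟨x, al + 1, 0⟩, by simp [h3, routeIdx], by simp [h4]; omega⟩
  · obtain ⟨pre, e, post, h1, h2, h3, h4⟩ := route_spec x ht.wf.keySorted_node hv
    have hsome : (N v)[routeIdx x (N v)]? = some e := by rw [h2, h1]; simp
    simp only [prep, hsome] at hp
    split at hp
    · rename_i hlt
      cases hp
      exact ⟨.refl ht.wf, by omega, rfl, e, hsome, hlt⟩
    · rename_i hlt
      simp only [Prod.mk.injEq] at hp
      obtain ⟨hp, rfl⟩ := hp
      obtain ⟨h5, h6, h7⟩ := prep_split hm ht hfull h1 h2 h3 h4 (not_lt.1 hlt) hp.symm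
      exact ⟨h5, le_rfl, h6, h7⟩

/-- The hypothesis on `countsAt` fixes in advance what the new entry replaces, so the counts along
the path can be corrected before the leaf is seen. A node is entered only when it is not full; it
has room for one more child, and splits never propagate upwards. At most one node is created for
each level below the root. -/
theorem put_spec {m : ℕ → ℕ} (hm : ∀ h, 1 < m h) {y : Entry f} (hy : IsLeafEntry y)
    {o : Fin f → ℕ} {h : ℕ} : ∀ {N : Table f} {t : Bool} {v al : ℕ} {N' : Table f} {al' : ℕ},
    IsTree m N t h v al → (N v).length < 2 * m h → countsAt y.key (flat N h v) = o →
    put m y o h v (N, al) = (N', al') →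
    Grows m N N' t h v al al' ∧ al' ≤ al + h ∧ flat N' h v = upsert y (flat N h v) := by
  induction h with
  | zero =>
    intro N t v al N' al' ht hfull ho hp
    simp only [put, Prod.mk.injEq] at hp
    obtain ⟨rfl, rfl⟩ := hp
    have hlen := length_upsert_le y (N v)
    have hlen' := le_length_upsert y (N v)
    refine ⟨⟨?_, le_rfl, by simp [fresh_self, addrs], ?_⟩, le_rfl, by simp [flat]⟩
    · simp only [WF, Function.update_self]
      refine ⟨ht.wf.1.upsert, fun e he => ?_, by omega, fun h' => ?_⟩
      · rcases mem_of_mem_upsert he with rfl | he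
        · exact hy
        · exact ht.wf.2.1 e he
      · have := ht.wf.2.2.2 h'
        omega
    · intro a ha _
      exact Function.update_of_ne (by simpa [addrs] using ha) _ _
  | succ h ih =>
    intro N t v al N' al' ht hfull ho hp
    obtain ⟨⟨N₁, al₁⟩, hprep⟩ : ∃ p, prep m y.key h v (N, al) = p := ⟨_, rfl⟩
    obtain ⟨hg₁, hal, hfl, e', he', hlt⟩ := prep_spec hm ht hfull y.key hprep
    simp only [put, hprep, he'] at hp
    have ht₁ := hg₁.isTree ht
    rw [← hfl] at ho ⊢
    have hne : N₁ v ≠ [] := by intro h'; simp [h'] at he'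
    obtain ⟨pre, e, post, hv, hidx, hpost, hpre⟩ :=
      route_spec y.key ht₁.wf.keySorted_node hne
    have hee : e' = e := by
      have : (N₁ v)[routeIdx y.key (N₁ v)]? = some e := by rw [hidx, hv]; simp
      rw [this] at he'
      exact (Option.some.inj he').symm
    subst hee
    have hbump : bump y o (N₁ v) = pre ++ bumpEntry y o e' :: post := by
      rw [bump, he', hidx, hv, replaceAt_append]
      simp
    rw [hbump] at hp
    clear he' hprep hfl ht hfull hbump
    have haddr : addrs N₁ (h + 1) v = v :: ((pre.flatMap fun e => addrs N₁ h e.ptr) ++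
        (addrs N₁ h e'.ptr ++ post.flatMap fun e => addrs N₁ h e.ptr)) := by
      rw [addrs, hv, List.flatMap_append, List.flatMap_cons]
    have hflat : flat N₁ (h + 1) v = (pre.flatMap fun e => flat N₁ h e.ptr) ++
        (flat N₁ h e'.ptr ++ post.flatMap fun e => flat N₁ h e.ptr) := by
      rw [flat, hv, List.flatMap_append, List.flatMap_cons]
    have hnd := ht₁.nodup
    rw [haddr, List.nodup_cons, List.nodup_append', List.nodup_append'] at hnd
    obtain ⟨hvn, hndpre, ⟨hndc, hndpost, hdcpost⟩, hdpre⟩ := hnd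
    have hall : ∀ a ∈ addrs N₁ (h + 1) v, a ≤ al₁ := ht₁.le
    have hva : v ≤ al₁ := hall v (addrs_self _ _ _)
    have hvc : v ∉ addrs N₁ h e'.ptr := fun h' => hvn (by simp [h'])
    have hw := ht₁.wf
    have hcv : e'.ptr ≠ v := fun h' => hvc (by rw [← h']; exact addrs_self _ _ _)
    have hpw := hw.1
    rw [hv, List.pairwise_append, List.pairwise_cons] at hpw
    obtain ⟨hpw₁, ⟨hpw₂, hpw₃⟩, hpw₄⟩ := hpw
    have hfpre : ∀ z ∈ pre.flatMap fun e => flat N₁ h e.ptr, z.key < y.key := by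
      intro z hz
      obtain ⟨d, hd, hz⟩ := List.mem_flatMap.1 hz
      exact ((hpw₄ d hd e' (by simp)).2 z hz).trans_le (hpre (List.ne_nil_of_mem hd))
    have hfpost : ∀ z ∈ post.flatMap fun e => flat N₁ h e.ptr, y.key < z.key := by
      intro z hz
      obtain ⟨d, hd, hz⟩ := List.mem_flatMap.1 hz
      exact (hpost d hd).trans_le ((hw.2.1 d (by rw [hv]; simp [hd])).1 z hz)
    -- Values in the other children have keys different from that of `y`, so the replaced counts all
    -- belong to this child.
    have hoc : countsAt y.key (flat N₁ h e'.ptr) = o := by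
      rw [hflat, countsAt_append, countsAt_append, countsAt_eq_zero fun z hz => (hfpre z hz).ne,
        countsAt_eq_zero fun z hz => (hfpost z hz).ne', zero_add, add_zero] at ho
      exact ho
    obtain ⟨hlow, hcnt, hwc⟩ := hw.2.1 e' (by rw [hv]; simp)
    set N₂ := Function.update N₁ v (pre ++ bumpEntry y o e' :: post) with hN₂
    have hcong₂ := congr_of_eqOn (N := N₁) (N' := N₂) (update_eqOn hvc)
    have ht₂ : IsTree m N₂ (t && decide ((N₁ v).length ≤ 1)) h e'.ptr al₁ := by
      refine ⟨hcong₂.2.2 m _ hwc, by rw [hcong₂.2.1]; exact hndc, fun a ha => hall a ?_⟩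
      rw [hcong₂.2.1] at ha
      rw [haddr]; simp [ha]
    obtain ⟨hg, hal', hfl⟩ := ih ht₂ (by rw [hN₂, Function.update_of_ne hcv]; exact hlt)
      (by rw [hcong₂.1]; exact hoc) hp
    rw [hcong₂.1] at hfl
    have hle := hg.le
    have hframe : ∀ a, a ∉ addrs N₁ h e'.ptr → a ≠ v → ¬ (al₁ < a ∧ a ≤ al') → N' a = N₁ a := by
      intro a h1 h2 h3
      rw [hg.frame a (by rwa [hcong₂.2.1]) h3, hN₂, Function.update_of_ne h2]
    have hN'v : N' v = pre ++ bumpEntry y o e' :: post := by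
      rw [hg.frame v (by rwa [hcong₂.2.1]) (by omega), hN₂, Function.update_self]
    have hcong : ∀ d ∈ pre ++ post, flat N' h d.ptr = flat N₁ h d.ptr ∧
        addrs N' h d.ptr = addrs N₁ h d.ptr ∧ ∀ m t, WF m N₁ t h d.ptr → WF m N' t h d.ptr := by
      intro d hd
      refine congr_of_eqOn fun b hb => ?_
      have hb' : b ∈ (pre.flatMap fun e => addrs N₁ h e.ptr) ∨
          b ∈ post.flatMap fun e => addrs N₁ h e.ptr := by
        rcases List.mem_append.1 hd with hd | hd
        · exact .inl (List.mem_flatMap.2 ⟨d, hd, hb⟩)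
        · exact .inr (List.mem_flatMap.2 ⟨d, hd, hb⟩)
      refine hframe b (fun hbc => ?_) (fun hbv => hvn ?_) ?_
      · rcases hb' with hb' | hb'
        · exact hdpre hb' (List.mem_append_left _ hbc)
        · exact hdcpost hbc hb'
      · rw [← hbv, List.mem_append, List.mem_append]; tauto
      · have := hall b (by
          rw [haddr, List.mem_cons, List.mem_append, List.mem_append]; tauto)
        omega
    have h₁ : (pre.flatMap fun e => flat N' h e.ptr) = pre.flatMap fun e => flat N₁ h e.ptr :=
      List.flatMap_congr fun d hd => (hcong d (by simp [hd])).1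
    have h₂ : (post.flatMap fun e => flat N' h e.ptr) = post.flatMap fun e => flat N₁ h e.ptr :=
      List.flatMap_congr fun d hd => (hcong d (by simp [hd])).1
    have h₃ : (pre.flatMap fun e => addrs N' h e.ptr) = pre.flatMap fun e => addrs N₁ h e.ptr :=
      List.flatMap_congr fun d hd => (hcong d (by simp [hd])).2.1
    have h₄ : (post.flatMap fun e => addrs N' h e.ptr) = post.flatMap fun e => addrs N₁ h e.ptr :=
      List.flatMap_congr fun d hd => (hcong d (by simp [hd])).2.1
    have hptr : (bumpEntry y o e').ptr = e'.ptr := rfl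
    have hkey : (bumpEntry y o e').key = min e'.key y.key := rfl
    -- Only the first key of a node can be lowered, so the order relative to the preceding children
    -- is unaffected.
    have hkey_pre : pre ≠ [] → (bumpEntry y o e').key = e'.key := fun h' => by
      rw [hkey, min_eq_left (hpre h')]
    have hlen : (pre ++ bumpEntry y o e' :: post).length = (N₁ v).length := by
      rw [hv]; simp
    refine ⟨hg₁.trans ⟨?_, hle, ?_, ?_⟩, by omega, ?_⟩
    · simp only [WF, hN'v, hlen]
      refine ⟨?_, fun d hd => ?_, ht₁.wf.2.2⟩
      · rw [List.pairwise_append, List.pairwise_cons]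
        refine ⟨?_, ⟨?_, ?_⟩, ?_⟩
        · exact hpw₁.imp_of_mem fun {a b} ha _ hab => by
            rw [(hcong a (by simp [ha])).1]; exact hab
        · intro d hd
          rw [hptr, hfl, hkey]
          refine ⟨(min_le_left _ _).trans_lt (hpw₂ d hd).1, fun z hz => ?_⟩
          rcases mem_of_mem_upsert hz with rfl | hz
          · exact hpost d hd
          · exact (hpw₂ d hd).2 z hz
        · exact hpw₃.imp_of_mem fun {a b} ha _ hab => by
            rw [(hcong a (by simp [ha])).1]; exact hab
        · intro a ha d hd
          rw [(hcong a (by simp [ha])).1]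
          rcases List.mem_cons.1 hd with rfl | hd
          · rw [hkey_pre (List.ne_nil_of_mem ha)]
            exact hpw₄ a ha e' (by simp)
          · exact hpw₄ a ha d (by simp [hd])
      · have hold : d ∈ pre ++ post → (∀ y ∈ flat N' h d.ptr, d.key ≤ y.key) ∧
            d.cnt = total (flat N' h d.ptr) ∧
            WF m N' (t && decide ((N₁ v).length ≤ 1)) h d.ptr := by
          intro hd
          have hd' : d ∈ N₁ v := by
            rw [hv]
            rcases List.mem_append.1 hd with hd | hd <;> simp [hd]
          rw [(hcong d hd).1]
          exact ⟨(hw.2.1 d hd').1, (hw.2.1 d hd').2.1, (hcong d hd).2.2 _ _ (hw.2.1 d hd').2.2⟩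
        simp only [List.mem_append, List.mem_cons] at hd
        rcases hd with hd | rfl | hd
        · exact hold (by simp [hd])
        · rw [hptr, hfl, hkey]
          refine ⟨fun z hz => ?_, ?_, hg.wf⟩
          · rcases mem_of_mem_upsert hz with rfl | hz
            · exact min_le_right _ _
            · exact (min_le_left _ _).trans (hlow z hz)
          · have := total_upsert (y := y) hwc.keySorted_flat
            rw [hoc] at this
            simp only [bumpEntry, hcnt, ← this, add_tsub_cancel_right]
        · exact hold (by simp [hd])
    · rw [haddr]
      have : addrs N' (h + 1) v = v :: ((pre.flatMap fun e => addrs N₁ h e.ptr) ++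
          (addrs N' h e'.ptr ++ post.flatMap fun e => addrs N₁ h e.ptr)) := by
        rw [addrs, hN'v, List.flatMap_append, List.flatMap_cons, h₃, h₄, hptr]
      rw [this]
      have hperm := hg.perm
      rw [hcong₂.2.1] at hperm
      refine (((hperm.append_right _).append_left _).cons v).trans ?_
      rw [List.append_assoc]
      refine (List.Perm.cons v (List.perm_append_comm_assoc _ _ _)).trans ?_
      exact List.perm_middle.symm
    · intro a ha ha'
      refine hframe a (fun h' => ha ?_) (fun h' => ha ?_) ha'
      · rw [haddr]; simp [h']
      · rw [h']; exact addrs_self _ _ _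
    · have : flat N' (h + 1) v = (pre.flatMap fun e => flat N₁ h e.ptr) ++
          (upsert y (flat N₁ h e'.ptr) ++ post.flatMap fun e => flat N₁ h e.ptr) := by
        rw [flat, hN'v, List.flatMap_append, List.flatMap_cons, h₁, h₂, hptr, hfl]
      rw [this, hflat, upsert_append_right hfpre, upsert_append_left hfpost]

/-! ### The size of a tree -/

theorem length_flatMap_ge {α β : Type} (L : List α) (F : α → List β) (k : ℕ)
    (h : ∀ a ∈ L, k ≤ (F a).length) : L.length * k ≤ (L.flatMap F).length := by
  induction L with
  | nil => simp
  | cons a L ih =>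
    have h1 := h a (by simp)
    have h2 := ih fun b hb => h b (List.mem_cons_of_mem _ hb)
    rw [List.flatMap_cons, List.length_append, List.length_cons, Nat.add_mul]
    omega

/-- The minimal numbers of entries of the nodes: `B` in leaves, `q` elsewhere. -/
def minSize (B q h : ℕ) : ℕ := if h = 0 then B else q

theorem WF.le_length_flat {B q : ℕ} {N : Table f} {h : ℕ} : ∀ {v : ℕ},
    WF (minSize B q) N false h v → B * q ^ h ≤ (flat N h v).length := by
  induction h with
  | zero => intro v hw; simpa [minSize, flat] using hw.2.2.2 rfl
  | succ h ih =>
    intro v hw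
    have h1 : q ≤ (N v).length := by simpa [minSize] using hw.2.2.2 rfl
    have h2 := length_flatMap_ge (N v) (fun e => flat N h e.ptr) (B * q ^ h)
      fun e he => ih (by simpa using (hw.2.1 e he).2.2)
    calc B * q ^ (h + 1) = q * (B * q ^ h) := by ring
      _ ≤ (N v).length * (B * q ^ h) := Nat.mul_le_mul_right _ h1
      _ ≤ _ := h2

/-- The root is not full if there are few entries. -/
theorem WF.length_root_lt {B q : ℕ} (hq : 1 < q) {N : Table f} {h v : ℕ}
    (hw : WF (minSize B q) N true h v) (hlen : (flat N h v).length < 2 * (B * q ^ h)) :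
    (N v).length < 2 * minSize B q h := by
  cases h with
  | zero => simpa [minSize, flat] using hlen
  | succ h =>
    by_contra hcon
    have h1 : 2 * q ≤ (N v).length := by simpa [minSize] using hcon
    -- A full root has several children, hence thick ones, each with at least `B * q ^ h` values.
    have hnot : ¬ (N v).length ≤ 1 := by omega
    have h2 := length_flatMap_ge (N v) (fun e => flat N h e.ptr) (B * q ^ h)
      fun e he => WF.le_length_flat (by simpa [hnot] using (hw.2.1 e he).2.2)
    have : 2 * (B * q ^ (h + 1)) ≤ (flat N (h + 1) v).length :=
      calc 2 * (B * q ^ (h + 1)) = 2 * q * (B * q ^ h) := by ring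
        _ ≤ (N v).length * (B * q ^ h) := Nat.mul_le_mul_right _ h1
        _ ≤ _ := h2
    omega

/-- Each child leaves a slack of one node; the slacks of the children add up to `L.length` nodes,
which can pay for their parent. -/
theorem length_flatMap_addrs {α β γ : Type} (B : ℕ) (L : List α) (F : α → List β)
    (G : α → List γ) (h : ∀ a ∈ L, ((F a).length + 1) * B ≤ 2 * (G a).length) :
    ((L.flatMap F).length + L.length) * B ≤ 2 * (L.flatMap G).length := by
  induction L with
  | nil => simp
  | cons a L ih =>
    have h1 := h a (by simp)
    have h2 := ih fun b hb => h b (List.mem_cons_of_mem _ hb)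
    simp only [List.flatMap_cons, List.length_append, List.length_cons]
    nlinarith

/-- The additional node in the bound makes the induction work: there are at least two children,
whose slacks pay for the parent and for its own slack. -/
theorem WF.length_addrs_thick {B q : ℕ} (hq : 1 < q) {N : Table f} {h : ℕ} : ∀ {v : ℕ},
    WF (minSize B q) N false h v →
      ((addrs N h v).length + 1) * B ≤ 2 * (flat N h v).length := by
  induction h with
  | zero =>
    intro v hw
    have : B ≤ (N v).length := by simpa [minSize] using hw.2.2.2 rfl
    simp only [addrs, flat, List.length_singleton]
    omega
  | succ h ih =>
    intro v hw
    have h1 : q ≤ (N v).length := by simpa [minSize] using hw.2.2.2 rfl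
    have h2 := length_flatMap_addrs B (N v) (fun e => addrs N h e.ptr) (fun e => flat N h e.ptr)
      fun e he => ih (by simpa using (hw.2.1 e he).2.2)
    rw [addrs, flat, List.length_cons]
    refine le_trans (Nat.mul_le_mul_right _ ?_) h2
    omega

/-- Thin nodes form a path from the root, at most one on each of the `h + 1` levels; all other nodes
are charged to values as in the thick case. -/
theorem WF.length_addrs {B q : ℕ} (hq : 1 < q) {N : Table f} {h : ℕ} : ∀ {v : ℕ},
    WF (minSize B q) N true h v →
      (addrs N h v).length * B ≤ 2 * (flat N h v).length + (h + 1) * B := by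
  induction h with
  | zero => intro v hw; simp [addrs]
  | succ h ih =>
    intro v hw
    rw [addrs, flat, List.length_cons]
    by_cases hlen : (N v).length ≤ 1
    · match hv : N v with
      | [] => simp; nlinarith
      | [e] =>
        have := ih (v := e.ptr) (by simpa [hlen] using (hw.2.1 e (by simp [hv])).2.2)
        simp only [List.flatMap_cons, List.flatMap_nil, List.append_nil]
        nlinarith
      | _ :: _ :: _ => simp [hv] at hlen
    · have h2 := length_flatMap_addrs B (N v) (fun e => addrs N h e.ptr) (fun e => flat N h e.ptr)
        fun e he => WF.length_addrs_thick hq (by simpa [hlen] using (hw.2.1 e he).2.2)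
      nlinarith

/-! ### The machine -/

instance : Relabel (Entry f) := ⟨fun σ e => ⟨σ e.key, e.ptr, e.cnt⟩⟩

instance {T : Type} [Relabel T] : Relabel (List T) := ⟨fun σ L => L.map (relabel σ)⟩

theorem relabel_list (σ : ℝ ≃o ℝ) (L : List (Entry f)) : relabel σ L = L.map (relabel σ) := rfl

@[simp] theorem relabel_key (σ : ℝ ≃o ℝ) (e : Entry f) : (relabel σ e).key = σ e.key := rfl
@[simp] theorem relabel_cnt (σ : ℝ ≃o ℝ) (e : Entry f) : (relabel σ e).cnt = e.cnt := rfl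

theorem total_relabel (σ : ℝ ≃o ℝ) (L : List (Entry f)) : total (relabel σ L) = total L := by
  simp [total, relabel_list, Function.comp_def]

theorem upsert_relabel (σ : ℝ ≃o ℝ) (y : Entry f) (L : List (Entry f)) :
    upsert (relabel σ y) (relabel σ L) = relabel σ (upsert y L) := by
  induction L with
  | nil => rfl
  | cons e L ih =>
    simp only [relabel_list, List.map_cons, upsert, relabel_key, σ.lt_iff_lt,
      σ.injective.eq_iff] at ih ⊢
    split
    · rfl
    · split
      · rfl
      · rw [ih]; rfl

theorem routeIdx_relabel (σ : ℝ ≃o ℝ) (x : ℝ) (L : List (Entry f)) :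
    routeIdx (σ x) (relabel σ L) = routeIdx x L := by
  simp [routeIdx, relabel_list, List.takeWhile_map, Function.comp_def]

theorem replaceAt_relabel (σ : ℝ ≃o ℝ) (L : List (Entry f)) (i : ℕ) (R : List (Entry f)) :
    replaceAt (relabel σ L) i (relabel σ R) = relabel σ (replaceAt L i R) := by
  simp [replaceAt, relabel_list, List.map_take, List.map_drop]

theorem getElem?_relabel (σ : ℝ ≃o ℝ) (L : List (Entry f)) (i : ℕ) :
    (relabel σ L)[i]? = L[i]?.map (relabel σ) := by
  simp [relabel_list]

theorem bump_relabel (σ : ℝ ≃o ℝ) (y : Entry f) (o : Fin f → ℕ) (L : List (Entry f)) :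
    bump (relabel σ y) o (relabel σ L) = relabel σ (bump y o L) := by
  have h : ∀ e : Entry f, bumpEntry (relabel σ y) o (relabel σ e) =
      relabel σ (bumpEntry y o e) := fun e =>
    Entry.ext (σ.monotone.map_min).symm rfl rfl
  rw [bump, relabel_key, routeIdx_relabel, getElem?_relabel, bump, ← replaceAt_relabel]
  congr 1
  cases L[routeIdx y.key L]? <;> simp [relabel_list, h]

theorem splitChild_relabel (σ : ℝ ≃o ℝ) (x : ℝ) (a k : ℕ) (L C : List (Entry f)) :
    splitChild (σ x) a k (relabel σ L) (relabel σ C) = relabel σ (splitChild x a k L C) := by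
  have h : ∀ e : Entry f, splitEntry (relabel σ e) a k (relabel σ C) =
      relabel σ (splitEntry e a k C) := by
    intro e
    have h1 : (relabel σ C).take k = relabel σ (C.take k) := by simp [relabel_list, List.map_take]
    have h2 : (relabel σ C).drop k = relabel σ (C.drop k) := by simp [relabel_list, List.map_drop]
    rw [splitEntry, h1, h2, total_relabel, total_relabel, splitEntry]
    cases C.drop k <;> rfl
  rw [splitChild, routeIdx_relabel, getElem?_relabel, splitChild, ← replaceAt_relabel]
  congr 1
  cases L[routeIdx x L]? with
  | none => rfl
  | some e => simpa using h e

theorem pick_relabel {wt : Entry f → ℕ} (σ : ℝ ≃o ℝ) (hwt : ∀ e, wt (relabel σ e) = wt e)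
    (L : List (Entry f)) : ∀ r, pick wt (relabel σ L) r =
      (pick wt L r).map fun p => (relabel σ p.1, p.2) := by
  induction L with
  | nil => intro r; rfl
  | cons e L ih =>
    intro r
    simp only [relabel_list, List.map_cons, pick, hwt] at ih ⊢
    split
    · rfl
    · exact ih _

/-- A node of a tree, or the header: the number of the current tree, the last address in use, and
the number of updates since the current tree has been built. -/
@[ext]
structure Node (f : ℕ) where
  es : List (Entry f)
  flag : Bool
  al : ℕ
  ctr : ℕ

def Node.ofList (L : List (Entry f)) : Node f := ⟨L, false, 0, 0⟩

instance : Relabel (Node f) := ⟨fun σ n => ⟨relabel σ n.es, n.flag, n.al, n.ctr⟩⟩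

/-- The phases of an operation. -/
inductive Phase where
  | init | put | down | split | split2 | bump | done | count | sel | fin | out

-- The entry to be put, or the one that has been found, is `cur`; `nd` and `cn` are the contents of
-- the node at `adr` and of its child at `chd`. During a rebuild `reb` is set, `al` refers to the
-- new tree, and `rnk` is the rank of the element to be copied next.
@[ext]
structure State (f : ℕ) where
  pc : Phase
  flag : Bool
  reb : Bool
  al : ℕ
  ctr : ℕ
  lev : ℕ
  adr : ℕ
  chd : ℕ
  idx : ℕ
  rnk : ℕ
  cur : Option (Entry f)
  nd : List (Entry f)
  cn : List (Entry f)

instance : Relabel (State f) := ⟨fun σ s =>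
  { s with cur := s.cur.map (relabel σ), nd := relabel σ s.nd, cn := relabel σ s.cn }⟩

/-- The operations: to insert a value into the set `i` or to delete it from that set, and to select
the element of rank `k` in the union of the sets in `R`. -/
inductive Op (f : ℕ) where
  | upd (i : Fin f) (ins : Bool)
  | qry (R : Finset (Fin f)) (k : ℕ)

/-- The counts of the entry that an operation puts. -/
def Op.new : Op f → Fin f → ℕ
  | .upd i true => Pi.single i 1
  | _ => 0

/-- The counts of the entry that it replaces. -/
def Op.old : Op f → Fin f → ℕ
  | .upd i false => Pi.single i 1
  | _ => 0

def Op.range : Op f → Finset (Fin f)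
  | .upd _ _ => Finset.univ
  | .qry R _ => R

def Op.weight (op : Op f) (e : Entry f) : ℕ := ∑ i ∈ op.range, e.cnt i

/-- The address of node `v` of tree number `τ`. -/
def loc (τ : Bool) (v : ℕ) : ℕ := 2 * v + 1 + τ.toNat

/-- The tree that entries are put in. -/
def State.tree (s : State f) : Bool := xor s.flag s.reb

/-- In a rebuild the entry is new to the tree and replaces nothing, whatever the operation that
triggered the rebuild. -/
def State.old (op : Op f) (s : State f) : Fin f → ℕ := if s.reb then 0 else op.old

/-- Halting in the cases without `cur` is a default: an entry is present whenever the machine puts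
one. -/
noncomputable def machineAct (m : ℕ → ℕ) (n : ℕ) (op : Op f) (s : State f) : NodeAct (Node f) :=
  match s.pc with
  | .init => .read 0
  | .put => .read (loc s.tree s.adr)
  | .down => match s.cur with
    | none => .halt none
    | some y => if s.lev = 0 then .write (loc s.tree s.adr) (.ofList (upsert y s.nd))
      else match s.nd[routeIdx y.key s.nd]? with
        | none => .write (loc s.tree (s.al + 1)) (.ofList [])
        | some e => .read (loc s.tree e.ptr)
  | .split => .write (loc s.tree (s.al + 1)) (.ofList (s.cn.drop (m (s.lev - 1))))
  | .split2 => .write (loc s.tree s.chd) (.ofList (s.cn.take (m (s.lev - 1))))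
  | .bump => match s.cur with
    | none => .halt none
    | some y => .write (loc s.tree s.adr) (.ofList (bump y (s.old op) s.nd))
  | .done => if s.ctr + 1 < 2 * n then .write 0 ⟨[], s.flag, s.al, s.ctr + 1⟩
    else .write (loc (!s.flag) 0) (.ofList [])
  | .count => .read (loc s.flag 0)
  | .sel => .read (loc s.flag s.adr)
  -- The trees change their roles. When rank `rnk` is out of range, `rnk - 1` entries have been
  -- copied, and this is the initial counter of the new tree.
  | .fin => .write 0 ⟨[], !s.flag, s.al, s.rnk - 1⟩
  | .out => .halt (s.cur.map Entry.key)

/-- Fields that are no longer needed are reset, so that the state at the end of each stage is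
determined and the stages can be composed. -/
noncomputable def machineNext (m : ℕ → ℕ) (H n : ℕ) (op : Op f) (s : State f) (nd : Node f) :
    State f :=
  match s.pc with
  | .init => match op with
    | .upd _ _ => { s with pc := .put, flag := nd.flag, al := nd.al, ctr := nd.ctr, lev := H }
    | .qry _ k => { s with pc := .count, flag := nd.flag, al := nd.al, ctr := nd.ctr, rnk := k }
  | .put => { s with pc := .down, nd := nd.es }
  | .down => match s.cur with
    | none => s
    | some y => if s.lev = 0 then
        { s with pc := if s.reb then .count else .done, lev := 0, adr := 0, rnk := s.rnk + 1,
                 cur := none, nd := [] }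
      else match s.nd[routeIdx y.key s.nd]? with
        | none => { s with pc := .bump, al := s.al + 1, nd := [⟨y.key, s.al + 1, 0⟩] }
        | some e => if nd.es.length < 2 * m (s.lev - 1) then { s with pc := .bump }
          else { s with pc := .split, chd := e.ptr, cn := nd.es }
  | .split => { s with pc := .split2 }
  | .split2 => match s.cur with
    | none => s
    | some y => { s with pc := .bump, al := s.al + 1, chd := 0, cn := [],
                         nd := splitChild y.key (s.al + 1) (m (s.lev - 1)) s.nd s.cn }
  | .bump => match s.cur with
    | none => s
    | some y => { s with pc := .put, lev := s.lev - 1, nd := [],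
                         adr := (s.nd[routeIdx y.key s.nd]?.map Entry.ptr).getD 0 }
  | .done => if s.ctr + 1 < 2 * n then { s with pc := .out }
    else { s with pc := .count, reb := true, al := 0, rnk := 1 }
  | .count => if ∑ i ∈ op.range, total nd.es i < s.rnk then { s with pc := .fin }
    else { s with pc := .sel, lev := H, adr := 0,
                  idx := (∑ i ∈ op.range, total nd.es i) - s.rnk }
  | .sel => match pick op.weight nd.es s.idx with
    | none => s
    | some (e, r) => if s.lev = 0 then
        { s with pc := if s.reb then .put else .out, lev := H, adr := 0, idx := 0, cur := some e }
      else { s with lev := s.lev - 1, adr := e.ptr, idx := r }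
  | .fin => { s with pc := .out }
  | .out => s

def machineStart (op : Op f) (x : Option ℝ) : State f :=
  ⟨.init, false, false, 0, 0, 0, 0, 0, 0, 0, x.map fun x => ⟨x, 0, op.new⟩, [], []⟩

@[simp] theorem relabel_node_es (σ : ℝ ≃o ℝ) (n : Node f) :
    (relabel σ n).es = relabel σ n.es := rfl

theorem relabel_ofList (σ : ℝ ≃o ℝ) (L : List (Entry f)) :
    relabel σ (Node.ofList L) = Node.ofList (relabel σ L) := rfl

theorem machineAct_relabel (m : ℕ → ℕ) (n : ℕ) (op : Op f) (σ : ℝ ≃o ℝ) (s : State f) :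
    machineAct m n op (relabel σ s) = (machineAct m n op s).relabel σ := by
  obtain ⟨pc, flag, reb, al, ctr, lev, adr, chd, idx, rnk, cur, nd, cn⟩ := s
  have hs : relabel σ (State.mk pc flag reb al ctr lev adr chd idx rnk cur nd cn) =
    ⟨pc, flag, reb, al, ctr, lev, adr, chd, idx, rnk, cur.map (relabel σ), relabel σ nd,
      relabel σ cn⟩ := rfl
  rw [hs]
  cases pc with
  | init => rfl
  | put => rfl
  | down =>
    cases cur with
    | none => rfl
    | some y =>
      by_cases hl : lev = 0
      · simp [machineAct, hl, NodeAct.relabel, upsert_relabel, relabel_ofList, State.tree]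
      · simp only [machineAct, Option.map_some, hl, if_false, relabel_key, routeIdx_relabel,
          getElem?_relabel]
        cases nd[routeIdx y.key nd]? <;> rfl
  | split =>
    simp [machineAct, NodeAct.relabel, relabel_ofList, relabel_list, State.tree, List.map_drop]
  | split2 =>
    simp [machineAct, NodeAct.relabel, relabel_ofList, relabel_list, State.tree, List.map_take]
  | bump =>
    cases cur with
    | none => rfl
    | some y =>
      simp [machineAct, NodeAct.relabel, bump_relabel, relabel_ofList, State.tree, State.old]
  | done =>
    by_cases h : ctr + 1 < 2 * n <;> simp only [machineAct, h, if_true, if_false] <;> rfl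
  | count => rfl
  | sel => rfl
  | fin => rfl
  | out => cases cur <;> rfl

theorem machineNext_relabel (m : ℕ → ℕ) (H n : ℕ) (op : Op f) (σ : ℝ ≃o ℝ) (s : State f)
    (b : Node f) : machineNext m H n op (relabel σ s) (relabel σ b) =
      relabel σ (machineNext m H n op s b) := by
  obtain ⟨pc, flag, reb, al, ctr, lev, adr, chd, idx, rnk, cur, nd, cn⟩ := s
  have hs : ∀ pc flag reb al ctr lev adr chd idx rnk (cur : Option (Entry f)) nd cn,
    relabel σ (State.mk pc flag reb al ctr lev adr chd idx rnk cur nd cn) =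
    ⟨pc, flag, reb, al, ctr, lev, adr, chd, idx, rnk, cur.map (relabel σ), relabel σ nd,
      relabel σ cn⟩ := fun _ _ _ _ _ _ _ _ _ _ _ _ _ => rfl
  rw [hs]
  cases pc with
  | init => cases op <;> rfl
  | put => rfl
  | down =>
    cases cur with
    | none => rfl
    | some y =>
      by_cases hl : lev = 0
      · simp only [machineNext, hl, if_true, Option.map_some]; rfl
      · simp only [machineNext, Option.map_some, hl, if_false, relabel_key, routeIdx_relabel,
          getElem?_relabel]
        cases nd[routeIdx y.key nd]? with
        | none => rfl
        | some e =>
          have hlen : (relabel σ b).es.length = b.es.length := List.length_map _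
          simp only [Option.map_some, hlen]
          by_cases hb : b.es.length < 2 * m (lev - 1) <;> simp only [hb, if_true, if_false] <;> rfl
  | split => rfl
  | split2 =>
    cases cur with
    | none => rfl
    | some y => simp only [machineNext, Option.map_some, relabel_key, splitChild_relabel]; rfl
  | bump =>
    cases cur with
    | none => rfl
    | some y =>
      simp only [machineNext, Option.map_some, relabel_key, routeIdx_relabel, getElem?_relabel]
      cases nd[routeIdx y.key nd]? <;> rfl
  | done =>
    by_cases h : ctr + 1 < 2 * n <;> simp only [machineNext, h, if_true, if_false] <;> rfl
  | count =>
    simp only [machineNext, relabel_node_es, total_relabel]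
    split <;> rfl
  | sel =>
    simp only [machineNext, relabel_node_es]
    rw [pick_relabel σ (fun _ => rfl)]
    cases pick op.weight b.es idx with
    | none => rfl
    | some p =>
      by_cases hl : lev = 0 <;> simp only [hl, if_true, if_false, Option.map_some] <;> rfl
  | fin => rfl
  | out => rfl

/-- The machine for the operation `op`. -/
noncomputable def machine (m : ℕ → ℕ) (H n : ℕ) (op : Op f) : NodeMachine (Node f) (State f) where
  start := machineStart op
  act := machineAct m n op
  next := machineNext m H n op
  start_relabel σ o := by cases o <;> rfl
  act_relabel := machineAct_relabel m n op
  next_relabel := machineNext_relabel m H n op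

/-! ### Runs of the machine on a tree -/

/-- The quantities that govern a structure for at most `n` values: the block size, the fan-out, the
size of a group, the height of the trees, the largest address in a tree, and a bound for all other
numbers. -/
structure Dim where
  B : ℕ
  q : ℕ
  l : ℕ
  n : ℕ
  H : ℕ
  V : ℕ
  Z : ℕ
  two_le_B : 2 ≤ B
  two_le_q : 2 ≤ q
  one_le_n : 1 ≤ n
  n_le : n ≤ B * q ^ H
  V_eq : V = 4 * n / B + 2 * H + 1
  V_le : V ≤ Z
  n_le_Z : 2 * n + 2 ≤ Z

namespace Dim

variable (D : Dim)

def m : ℕ → ℕ := minSize D.B D.q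

theorem one_lt_m (h : ℕ) : 1 < D.m h := by
  have := D.two_le_B
  have := D.two_le_q
  unfold m minSize
  split <;> omega

/-- The lists of entries that fit into a node. -/
def EntriesOK (L : List (Entry f)) : Prop :=
  (L.length ≤ 2 * D.B ∧ ∀ e ∈ L, IsLeafEntry e) ∨
    (L.length ≤ 2 * D.q ∧ ∀ e ∈ L, e.ptr ≤ D.V ∧ ∀ i, e.cnt i ≤ D.l)

structure NodeOK (a : Node f) : Prop where
  es : D.EntriesOK a.es
  al : a.al ≤ D.V
  ctr : a.ctr ≤ 2 * D.n

structure StateOK (s : State f) : Prop where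
  al : s.al ≤ D.V
  ctr : s.ctr ≤ D.Z
  lev : s.lev ≤ D.H
  adr : s.adr ≤ D.V
  chd : s.chd ≤ D.V
  idx : s.idx ≤ D.Z
  rnk : s.rnk ≤ D.Z
  cur : ∀ e ∈ s.cur, IsLeafEntry e
  nd : D.EntriesOK s.nd
  cn : D.EntriesOK s.cn

theorem entriesOK_nil : D.EntriesOK ([] : List (Entry f)) := .inl (by simp)

theorem nodeOK_ofList {L : List (Entry f)} (h : D.EntriesOK L) : D.NodeOK (Node.ofList L) :=
  ⟨h, Nat.zero_le _, Nat.zero_le _⟩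

variable {D}

theorem EntriesOK.sublist {L L' : List (Entry f)} (h : D.EntriesOK L) (hs : L'.Sublist L) :
    D.EntriesOK L' := by
  have := hs.length_le
  rcases h with h | h
  · exact .inl ⟨by omega, fun e he => h.2 e (hs.subset he)⟩
  · exact .inr ⟨by omega, fun e he => h.2 e (hs.subset he)⟩

/-- A child contains at most as many values of a group as the whole tree, so a bound for the totals
bounds every stored count. -/
theorem entriesOK_of_wf {N : Table f} {t : Bool} {h v : ℕ} (hw : WF D.m N t h v)
    (hl : ∀ i, total (flat N h v) i ≤ D.l) (hV : ∀ a ∈ addrs N h v, a ≤ D.V) :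
    D.EntriesOK (N v) := by
  cases h with
  | zero => exact .inl ⟨by simpa [m, minSize] using hw.2.2.1, hw.2.1⟩
  | succ h =>
    refine .inr ⟨by simpa [m, minSize] using hw.2.2.1, fun e he => ⟨hV _ ?_, fun i => ?_⟩⟩
    · exact List.mem_cons_of_mem _ (List.mem_flatMap.2 ⟨e, he, addrs_self _ _ _⟩)
    · exact (cnt_le_total he i).trans (hw.total_node ▸ hl i)

variable (D)

/-- The runs of the machine for `op`, within the bounds. -/
def Steps (op : Op f) : State f → (ℕ → Node f) → ℕ → State f → (ℕ → Node f) → Prop :=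
  (machine D.m D.H D.n op).Steps D.StateOK D.NodeOK (2 * D.V + 3)

end Dim

/-- The store with header `hd` in which tree number `τ` is in the table `N`, and the other one in
the table `M`. -/
def store (hd : Node f) (τ : Bool) (N M : Table f) : ℕ → Node f := fun a =>
  if a = 0 then hd else .ofList ((if (a - 1) % 2 = τ.toNat then N else M) ((a - 1) / 2))

@[simp] theorem store_zero (hd : Node f) (τ : Bool) (N M : Table f) : store hd τ N M 0 = hd := rfl

theorem loc_ne_zero (τ : Bool) (v : ℕ) : loc τ v ≠ 0 := by simp [loc]

theorem loc_lt {τ : Bool} {v V : ℕ} (h : v ≤ V) : loc τ v < 2 * V + 3 := by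
  have := Bool.toNat_le τ
  unfold loc
  omega

@[simp] theorem store_loc (hd : Node f) (τ : Bool) (N M : Table f) (v : ℕ) :
    store hd τ N M (loc τ v) = .ofList (N v) := by
  have h1 : (loc τ v - 1) % 2 = τ.toNat := by cases τ <;> simp [loc]
  have h2 : (loc τ v - 1) / 2 = v := by
    have := Bool.toNat_le τ
    unfold loc
    omega
  simp [store, loc_ne_zero, h1, h2]

/-- The two trees are symmetric. A rebuild selects from one and puts into the other, and this
changes the point of view. -/
theorem store_swap (hd : Node f) (τ : Bool) (N M : Table f) :
    store hd (!τ) M N = store hd τ N M := by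
  funext a
  have : (a - 1) % 2 = 0 ∨ (a - 1) % 2 = 1 := by omega
  cases τ <;> rcases this with h | h <;> simp [store, h]

theorem update_store_loc (hd : Node f) (τ : Bool) (N M : Table f) (v : ℕ) (L : List (Entry f)) :
    Function.update (store hd τ N M) (loc τ v) (.ofList L) =
      store hd τ (Function.update N v L) M := by
  funext a
  by_cases ha : a = loc τ v
  · subst ha; simp
  · rw [Function.update_of_ne ha]
    unfold store
    by_cases h0 : a = 0
    · simp [h0]
    · simp only [h0, if_false]
      by_cases h1 : (a - 1) % 2 = τ.toNat
      · simp only [h1, if_true]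
        rw [Function.update_of_ne]
        intro h2
        apply ha
        unfold loc
        omega
      · simp only [h1, if_false]

theorem update_store_zero (hd hd' : Node f) (τ : Bool) (N M : Table f) :
    Function.update (store hd τ N M) 0 hd' = store hd' τ N M := by
  funext a
  by_cases ha : a = 0
  · subst ha; simp
  · rw [Function.update_of_ne ha]
    simp [store, ha]

namespace Dim

variable {D : Dim} {op : Op f}

theorem Steps.trans {s s' s'' : State f} {A A' A'' : ℕ → Node f} {t t' : ℕ}
    (h : D.Steps op s A t s' A') (h' : D.Steps op s' A' t' s'' A'') :
    D.Steps op s A (t + t') s'' A'' := NodeMachine.Steps.trans h h'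

theorem steps_read {s s' : State f} {A : ℕ → Node f} {a : ℕ} (hs : D.StateOK s)
    (h : machineAct D.m D.n op s = .read a) (ha : a < 2 * D.V + 3)
    (hn : machineNext D.m D.H D.n op s (A a) = s') : D.Steps op s A 1 s' A := by
  subst hn
  exact .read hs h ha (.refl _ _)

theorem steps_write {s s' : State f} {A A' : ℕ → Node f} {a : ℕ} {b : Node f} (hs : D.StateOK s)
    (h : machineAct D.m D.n op s = .write a b) (ha : a < 2 * D.V + 3) (hb : D.NodeOK b)
    (hn : machineNext D.m D.H D.n op s b = s') (hA : Function.update A a b = A') :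
    D.Steps op s A 1 s' A' := by
  subst hn hA
  exact .write hs h ha hb (.refl _ _)

/-- The state that starts to put `y` in the tree of height `h` with root `v`. -/
def putState (flag reb : Bool) (al ctr rnk : ℕ) (y : Entry f) (h v : ℕ) : State f :=
  ⟨.put, flag, reb, al, ctr, h, v, 0, 0, rnk, some y, [], []⟩

/-- The state after an entry has been put. -/
def afterState (flag reb : Bool) (al ctr rnk : ℕ) : State f :=
  ⟨if reb then .count else .done, flag, reb, al, ctr, 0, 0, 0, 0, rnk + 1, none, [], []⟩

/-- The machine carries out `put` with at most five steps on each internal level: one reads the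
node, at most three look at the child and split it, one writes the node back. The last two
hypotheses keep all counts, old and new, at most `l`. -/
theorem put_steps {flag reb : Bool} {ctr rnk : ℕ} {y : Entry f} (hy : IsLeafEntry y)
    {o : Fin f → ℕ} (ho : o = if reb then 0 else op.old) (hctr : ctr ≤ D.Z) (hrnk : rnk ≤ D.Z)
    {hd : Node f} {M : Table f} {h : ℕ} :
    ∀ {N : Table f} {t : Bool} {v al : ℕ} {N' : Table f} {al' : ℕ},
    IsTree D.m N t h v al → (N v).length < 2 * D.m h → countsAt y.key (flat N h v) = o →
    put D.m y o h v (N, al) = (N', al') → al + h ≤ D.V → h ≤ D.H →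
    (∀ i, total (flat N h v) i ≤ D.l) → (∀ i, total (flat N h v) i + y.cnt i - o i ≤ D.l) →
    ∃ k ≤ 6 * (h + 1), D.Steps op (putState flag reb al ctr rnk y h v)
      (store hd (xor flag reb) N M) k (afterState flag reb al' ctr rnk)
      (store hd (xor flag reb) N' M) := by
  induction h with
  | zero =>
    intro N t v al N' al' ht hfull hcnt hp hal hH hl hl'
    simp only [put, Prod.mk.injEq] at hp
    obtain ⟨rfl, rfl⟩ := hp
    have hvV : v ≤ D.V := (ht.le v (addrs_self _ _ _)).trans (by omega)
    have hcur : ∀ e ∈ some y, IsLeafEntry e := fun e he => Option.some.inj he ▸ hy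
    have hnv : D.EntriesOK (N v) :=
      entriesOK_of_wf ht.wf hl fun a ha => (ht.le a ha).trans (by omega)
    have h1 : D.Steps op (putState flag reb al ctr rnk y 0 v) (store hd (xor flag reb) N M) 1
        ⟨.down, flag, reb, al, ctr, 0, v, 0, 0, rnk, some y, N v, []⟩
        (store hd (xor flag reb) N M) :=
      steps_read (a := loc (xor flag reb) v)
        ⟨by simpa [putState] using hal, hctr, hH, hvV, Nat.zero_le _, Nat.zero_le _, hrnk, hcur,
          D.entriesOK_nil, D.entriesOK_nil⟩ rfl (loc_lt hvV) (by simp [machineNext, putState,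
            Node.ofList])
    have h2 : D.Steps op ⟨.down, flag, reb, al, ctr, 0, v, 0, 0, rnk, some y, N v, []⟩
        (store hd (xor flag reb) N M) 1 (afterState flag reb al ctr rnk)
        (store hd (xor flag reb) (Function.update N v (upsert y (N v))) M) := by
      refine steps_write (a := loc (xor flag reb) v)
        ⟨by simpa using hal, hctr, hH, hvV, Nat.zero_le _, Nat.zero_le _, hrnk, hcur,
          hnv, D.entriesOK_nil⟩ rfl (loc_lt hvV) (D.nodeOK_ofList (.inl ⟨?_, fun e he => ?_⟩))
          (by simp [machineNext, afterState]) (update_store_loc _ _ _ _ _ _)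
      · have := length_upsert_le y (N v)
        simp only [m, minSize, if_true] at hfull
        change (upsert y (N v)).length ≤ 2 * D.B
        omega
      · rcases mem_of_mem_upsert he with rfl | he
        · exact hy
        · exact ht.wf.2.1 e he
    exact ⟨2, by omega, h1.trans h2⟩
  | succ h ih =>
    intro N t v al N' al' ht hfull hcnt hp hal hH hl hl'
    obtain ⟨⟨N₁, al₁⟩, hprep⟩ : ∃ p, prep D.m y.key h v (N, al) = p := ⟨_, rfl⟩
    obtain ⟨hg₁, hal₁, hfl, e', he', hlt⟩ := prep_spec D.one_lt_m ht hfull y.key hprep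
    simp only [put, hprep, he'] at hp
    have ht₁ := hg₁.isTree ht
    have hvV : v ≤ D.V := (ht.le v (addrs_self _ _ _)).trans (by omega)
    have hcur : ∀ e ∈ some y, IsLeafEntry e := fun e he => Option.some.inj he ▸ hy
    have hnv : D.EntriesOK (N v) :=
      entriesOK_of_wf ht.wf hl fun a ha => (ht.le a ha).trans (by omega)
    have hn₁ : D.EntriesOK (N₁ v) :=
      entriesOK_of_wf ht₁.wf (by rwa [hfl]) fun a ha => (ht₁.le a ha).trans (by omega)
    have h1 : D.Steps op (putState flag reb al ctr rnk y (h + 1) v)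
        (store hd (xor flag reb) N M) 1
        ⟨.down, flag, reb, al, ctr, h + 1, v, 0, 0, rnk, some y, N v, []⟩
        (store hd (xor flag reb) N M) :=
      steps_read (a := loc (xor flag reb) v)
        ⟨by simp [putState]; omega, hctr, hH, hvV, Nat.zero_le _, Nat.zero_le _, hrnk, hcur,
          D.entriesOK_nil, D.entriesOK_nil⟩ rfl (loc_lt hvV) (by simp [machineNext, putState,
            Node.ofList])
    have hok : ∀ pc a L C, a ≤ D.V → D.EntriesOK L → D.EntriesOK C →
        D.StateOK ⟨pc, flag, reb, al, ctr, h + 1, v, a, 0, rnk, some y, L, C⟩ :=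
      fun pc a L C ha hL hC => ⟨by simp; omega, hctr, hH, hvV, ha, Nat.zero_le _, hrnk, hcur, hL, hC⟩
    -- the child exists and is not full
    have h2 : ∃ k ≤ 3, ∃ N₂ : Table f, Function.update N₂ v (bump y o (N₁ v)) =
        Function.update N₁ v (bump y o (N₁ v)) ∧
        D.Steps op ⟨.down, flag, reb, al, ctr, h + 1, v, 0, 0, rnk, some y, N v, []⟩
        (store hd (xor flag reb) N M) k
        ⟨.bump, flag, reb, al₁, ctr, h + 1, v, 0, 0, rnk, some y, N₁ v, []⟩
        (store hd (xor flag reb) N₂ M) := by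
      cases hidx : (N v)[routeIdx y.key (N v)]? with
      | none =>
        simp only [prep, hidx, Prod.mk.injEq] at hprep
        obtain ⟨rfl, rfl⟩ := hprep
        -- The node `v` has so far been changed only in the main memory. The table `N₂` on disk
        -- still has its old contents, but they are overwritten by the next step.
        refine ⟨1, by omega, Function.update N (al + 1) [], by simp, ?_⟩
        refine steps_write (a := loc (xor flag reb) (al + 1)) (hok _ _ _ _ (Nat.zero_le _) hnv
          D.entriesOK_nil) ?_ (loc_lt (by omega)) (D.nodeOK_ofList D.entriesOK_nil) ?_
          (update_store_loc _ _ _ _ _ _)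
        · simp [machineAct, hidx, State.tree]
        · simp [machineNext, hidx]
      | some e =>
        have hemem : e ∈ N v := List.mem_of_getElem? hidx
        have hea : ∀ a ∈ addrs N h e.ptr, a ∈ addrs N (h + 1) v := fun a ha =>
          List.mem_cons_of_mem _ (List.mem_flatMap.2 ⟨e, hemem, ha⟩)
        have heV : e.ptr ≤ D.V := (ht.le _ (hea _ (addrs_self _ _ _))).trans (by omega)
        have hread : machineAct D.m D.n op
            ⟨.down, flag, reb, al, ctr, h + 1, v, 0, 0, rnk, some y, N v, []⟩ =
            .read (loc (xor flag reb) e.ptr) := by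
          simp [machineAct, hidx, State.tree]
        simp only [prep, hidx] at hprep
        split at hprep
        · rename_i hlt'
          cases hprep
          refine ⟨1, by omega, N, rfl, steps_read (hok _ _ _ _ (Nat.zero_le _) hnv
            D.entriesOK_nil) hread (loc_lt heV) ?_⟩
          simp [machineNext, hidx, Node.ofList, hlt']
        · rename_i hlt'
          simp only [Prod.mk.injEq] at hprep
          obtain ⟨hprep, rfl⟩ := hprep
          have hN₁v : N₁ v = splitChild y.key (al + 1) (D.m h) (N v) (N e.ptr) := by
            rw [← hprep, Function.update_self]
          have hwc := (ht.wf.2.1 e hemem)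
          have hcn : D.EntriesOK (N e.ptr) := by
            refine entriesOK_of_wf hwc.2.2 (fun i => ?_) fun a ha =>
              (ht.le a (hea a ha)).trans (by omega)
            rw [← hwc.2.1]
            exact (cnt_le_total hemem i).trans (by rw [ht.wf.total_node]; exact hl i)
          refine ⟨3, le_rfl, Function.update (Function.update N (al + 1) ((N e.ptr).drop (D.m h)))
            e.ptr ((N e.ptr).take (D.m h)), by rw [← hprep, Function.update_idem], ?_⟩
          have h3 : D.Steps op ⟨.down, flag, reb, al, ctr, h + 1, v, 0, 0, rnk, some y, N v, []⟩
              (store hd (xor flag reb) N M) 1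
              ⟨.split, flag, reb, al, ctr, h + 1, v, e.ptr, 0, rnk, some y, N v, N e.ptr⟩
              (store hd (xor flag reb) N M) := by
            refine steps_read (hok _ _ _ _ (Nat.zero_le _) hnv D.entriesOK_nil) hread
              (loc_lt heV) ?_
            simp [machineNext, hidx, Node.ofList, hlt']
          have h4 : D.Steps op
              ⟨.split, flag, reb, al, ctr, h + 1, v, e.ptr, 0, rnk, some y, N v, N e.ptr⟩
              (store hd (xor flag reb) N M) 1
              ⟨.split2, flag, reb, al, ctr, h + 1, v, e.ptr, 0, rnk, some y, N v, N e.ptr⟩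
              (store hd (xor flag reb)
                (Function.update N (al + 1) ((N e.ptr).drop (D.m h))) M) :=
            steps_write (hok _ _ _ _ heV hnv hcn) rfl (loc_lt (by simp; omega))
              (D.nodeOK_ofList (hcn.sublist (List.drop_sublist _ _))) rfl
              (update_store_loc _ _ _ _ _ _)
          have h5 : D.Steps op
              ⟨.split2, flag, reb, al, ctr, h + 1, v, e.ptr, 0, rnk, some y, N v, N e.ptr⟩
              (store hd (xor flag reb)
                (Function.update N (al + 1) ((N e.ptr).drop (D.m h))) M) 1
              ⟨.bump, flag, reb, al + 1, ctr, h + 1, v, 0, 0, rnk, some y, N₁ v, []⟩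
              (store hd (xor flag reb) (Function.update (Function.update N (al + 1)
                ((N e.ptr).drop (D.m h))) e.ptr ((N e.ptr).take (D.m h))) M) :=
            steps_write (hok _ _ _ _ heV hnv hcn) rfl (loc_lt heV)
              (D.nodeOK_ofList (hcn.sublist (List.take_sublist _ _)))
              (by simp [machineNext, hN₁v]) (update_store_loc _ _ _ _ _ _)
          exact (h3.trans h4).trans h5
    obtain ⟨k₂, hk₂, N₂, hN₂, h2⟩ := h2
    -- the node itself
    have hne : N₁ v ≠ [] := by intro h'; simp [h'] at he'
    obtain ⟨pre, e, post, hv, hidx, hpost, hpre⟩ :=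
      route_spec y.key ht₁.wf.keySorted_node hne
    have hee : e' = e := by
      have : (N₁ v)[routeIdx y.key (N₁ v)]? = some e := by rw [hidx, hv]; simp
      rw [this] at he'
      exact (Option.some.inj he').symm
    subst hee
    have hbump : bump y o (N₁ v) = pre ++ bumpEntry y o e' :: post := by
      rw [bump, he', hidx, hv, replaceAt_append]
      simp
    have hemem : e' ∈ N₁ v := by rw [hv]; simp
    have hbumpOK : D.EntriesOK (bump y o (N₁ v)) := by
      refine .inr ⟨?_, ?_⟩
      · have := ht₁.wf.length_le
        rw [hv] at this
        simpa [hbump, m, minSize] using this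
      · have hold : ∀ d ∈ N₁ v, d.ptr ≤ D.V ∧ ∀ i, d.cnt i ≤ D.l := by
          intro d hd
          refine ⟨(ht₁.le d.ptr (List.mem_cons_of_mem _ (List.mem_flatMap.2
            ⟨d, hd, addrs_self _ _ _⟩))).trans (by omega), fun i => ?_⟩
          refine (cnt_le_total hd i).trans ?_
          rw [ht₁.wf.total_node, hfl]
          exact hl i
        intro d hd
        simp only [hbump, List.mem_append, List.mem_cons] at hd
        rcases hd with hd | rfl | hd
        · exact hold d (by rw [hv]; simp [hd])
        · refine ⟨(hold e' hemem).1, fun i => ?_⟩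
          -- Truncated subtraction is monotone, so the new count of the child is bounded by the new
          -- total of the tree.
          have h3 : e'.cnt i ≤ total (flat N (h + 1) v) i := by
            rw [← hfl, ← ht₁.wf.total_node]
            exact cnt_le_total hemem i
          have := hl' i
          simp only [bumpEntry, Pi.sub_apply, Pi.add_apply]
          omega
        · exact hold d (by rw [hv]; simp [hd])
    have h6 : D.Steps op ⟨.bump, flag, reb, al₁, ctr, h + 1, v, 0, 0, rnk, some y, N₁ v, []⟩
        (store hd (xor flag reb) N₂ M) 1 (putState flag reb al₁ ctr rnk y h e'.ptr)
        (store hd (xor flag reb) (Function.update N₁ v (bump y o (N₁ v))) M) := by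
      refine steps_write (a := loc (xor flag reb) v) (b := .ofList (bump y o (N₁ v)))
        ⟨by simp; omega, hctr, hH, hvV, Nat.zero_le _, Nat.zero_le _, hrnk, hcur, hn₁,
          D.entriesOK_nil⟩ ?_ (loc_lt hvV) (D.nodeOK_ofList hbumpOK) ?_ ?_
      · simp [machineAct, State.tree, State.old, ho]
      · simp [machineNext, he', putState]
      · rw [update_store_loc, hN₂]
    -- the child
    have hnd := ht₁.nodup
    have haddr : addrs N₁ (h + 1) v = v :: ((pre.flatMap fun e => addrs N₁ h e.ptr) ++
        (addrs N₁ h e'.ptr ++ post.flatMap fun e => addrs N₁ h e.ptr)) := by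
      rw [addrs, hv, List.flatMap_append, List.flatMap_cons]
    rw [haddr, List.nodup_cons, List.nodup_append', List.nodup_append'] at hnd
    obtain ⟨hvn, hndpre, ⟨hndc, hndpost, hdcpost⟩, hdpre⟩ := hnd
    have hvc : v ∉ addrs N₁ h e'.ptr := fun h' => hvn (by simp [h'])
    have hcv : e'.ptr ≠ v := fun h' => hvc (by rw [← h']; exact addrs_self _ _ _)
    have hcong := congr_of_eqOn (N := N₁)
      (N' := Function.update N₁ v (bump y o (N₁ v))) (update_eqOn hvc)
    obtain ⟨hlow, hcnt', hwc⟩ := ht₁.wf.2.1 e' hemem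
    have hle : ∀ i, total (flat N₁ h e'.ptr) i ≤ total (flat N (h + 1) v) i := fun i => by
      rw [← hcnt', ← hfl, ← ht₁.wf.total_node]
      exact cnt_le_total hemem i
    have htc : IsTree D.m (Function.update N₁ v (bump y o (N₁ v)))
        (t && decide ((N₁ v).length ≤ 1)) h e'.ptr al₁ := by
      refine ⟨hcong.2.2 _ _ hwc, by rw [hcong.2.1]; exact hndc, fun a ha => ht₁.le a ?_⟩
      rw [hcong.2.1] at ha
      rw [haddr]; simp [ha]
    have hcntc : countsAt y.key (flat N₁ h e'.ptr) = o := by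
      have hpw := ht₁.wf.1
      rw [hv, List.pairwise_append, List.pairwise_cons] at hpw
      obtain ⟨hpw₁, ⟨hpw₂, hpw₃⟩, hpw₄⟩ := hpw
      rw [← hfl, flat, hv, List.flatMap_append, List.flatMap_cons, countsAt_append,
        countsAt_append, countsAt_eq_zero, countsAt_eq_zero (L := post.flatMap _), zero_add,
        add_zero] at hcnt
      · exact hcnt
      · intro z hz
        obtain ⟨d, hd, hz⟩ := List.mem_flatMap.1 hz
        exact ((hpost d hd).trans_le ((ht₁.wf.2.1 d (by rw [hv]; simp [hd])).1 z hz)).ne'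
      · intro z hz
        obtain ⟨d, hd, hz⟩ := List.mem_flatMap.1 hz
        exact (((hpw₄ d hd e' (by simp)).2 z hz).trans_le (hpre (List.ne_nil_of_mem hd))).ne
    obtain ⟨k, hk, h7⟩ := ih htc (by rw [Function.update_of_ne hcv]; exact hlt)
      (by rw [hcong.1]; exact hcntc) hp (by omega) (by omega)
      (fun i => by rw [hcong.1]; exact (hle i).trans (hl i))
      (fun i => by
        rw [hcong.1]
        have := hle i
        have := hl' i
        omega)
    exact ⟨1 + k₂ + 1 + k, by omega, ((h1.trans h2).trans h6).trans h7⟩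

end Dim

/-! ### Selection -/

/-- The entries that count for the operation `op`. -/
def live (op : Op f) (L : List (Entry f)) : List (Entry f) := L.filter fun e => op.weight e ≠ 0

theorem live_append (op : Op f) (L L' : List (Entry f)) :
    live op (L ++ L') = live op L ++ live op L' := by simp [live]

theorem IsLeafEntry.weight_le {e : Entry f} (he : IsLeafEntry e) (op : Op f) :
    op.weight e ≤ 1 := by
  rcases he.2 with h | ⟨i, h⟩
  · simp [Op.weight, h]
  · simp only [Op.weight, h, Pi.single_apply, Finset.sum_ite_eq']
    split <;> simp

theorem length_live (op : Op f) {L : List (Entry f)} (hL : ∀ e ∈ L, IsLeafEntry e) :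
    (live op L).length = ∑ i ∈ op.range, total L i := by
  induction L with
  | nil => simp [live]
  | cons e L ih =>
    have he := (hL e (by simp)).weight_le op
    have := ih fun d hd => hL d (List.mem_cons_of_mem _ hd)
    have hsum : ∑ i ∈ op.range, total (e :: L) i =
        op.weight e + ∑ i ∈ op.range, total L i := by
      simp [Finset.sum_add_distrib, Op.weight]
    rw [hsum, ← this]
    by_cases h : op.weight e = 0
    · simp [live, h]
    · simp [live, h]
      omega

/-- The live entries of the children follow each other in the concatenation, and the weight of a
child is their number; skipping a child means subtracting its weight. -/
theorem pick_spec {op : Op f} {F : Entry f → List (Entry f)} {L : List (Entry f)}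
    (hF : ∀ e ∈ L, op.weight e = (live op (F e)).length) : ∀ {r : ℕ} {z : Entry f},
    (live op (L.flatMap F))[r]? = some z →
    ∃ e ∈ L, ∃ r' ≤ r, pick op.weight L r = some (e, r') ∧ (live op (F e))[r']? = some z := by
  induction L with
  | nil => intro r z h; simp [live] at h
  | cons e L ih =>
    intro r z h
    have he := hF e (by simp)
    rw [List.flatMap_cons, live_append] at h
    by_cases hr : r < op.weight e
    · refine ⟨e, by simp, r, le_rfl, by simp [pick, hr], ?_⟩
      rwa [List.getElem?_append_left (by omega)] at h
    · rw [List.getElem?_append_right (by omega), ← he] at h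
      obtain ⟨d, hd, r', hr', hp, hz⟩ := ih (fun d hd => hF d (List.mem_cons_of_mem _ hd)) h
      exact ⟨d, List.mem_cons_of_mem _ hd, r', by omega, by simp [pick, hr, hp], hz⟩

namespace Dim

variable {D : Dim} {op : Op f}

/-- The state that selects the element with index `r` in the tree of height `h` with root `v`. -/
def selState (flag reb : Bool) (al ctr rnk h v r : ℕ) : State f :=
  ⟨.sel, flag, reb, al, ctr, h, v, 0, r, rnk, none, [], []⟩

/-- The state after the entry `e` has been selected. -/
def foundState (H : ℕ) (flag reb : Bool) (al ctr rnk : ℕ) (e : Entry f) : State f :=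
  ⟨if reb then .put else .out, flag, reb, al, ctr, H, 0, 0, 0, rnk, some e, [], []⟩

theorem sel_steps {flag reb : Bool} {al ctr rnk : ℕ} (hal : al ≤ D.V) (hctr : ctr ≤ D.Z)
    (hrnk : rnk ≤ D.Z) {hd : Node f} {N M : Table f} {z : Entry f} {h : ℕ} :
    ∀ {t : Bool} {v r : ℕ}, WF D.m N t h v → (∀ a ∈ addrs N h v, a ≤ D.V) → h ≤ D.H → r ≤ D.Z →
    (live op (flat N h v))[r]? = some z →
    D.Steps op (selState flag reb al ctr rnk h v r) (store hd flag N M) (h + 1)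
      (foundState D.H flag reb al ctr rnk z) (store hd flag N M) := by
  induction h with
  | zero =>
    intro t v r hw hV hH hr hz
    obtain ⟨e, he, r', _, hp, hz'⟩ := pick_spec (op := op) (F := fun e => [e]) (L := N v) (r := r)
      (z := z) (fun e he => by
        have := (hw.2.1 e he).weight_le op
        by_cases h : op.weight e = 0
        · simp [live, h]
        · simp [live, h]; omega) (by simpa [flat] using hz)
    have hez : e = z := by
      have := List.mem_of_getElem? hz'
      simp only [live, List.mem_filter, List.mem_singleton] at this
      exact this.1.symm
    subst hez
    have hvV := hV v (addrs_self _ _ _)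
    refine steps_read (a := loc flag v) ⟨hal, hctr, hH, hvV, Nat.zero_le _, hr, hrnk,
      by simp [selState], D.entriesOK_nil, D.entriesOK_nil⟩ rfl (loc_lt hvV) ?_
    simp only [machineNext, selState, foundState, store_loc, Node.ofList, hp, if_true]
    rfl
  | succ h ih =>
    intro t v r hw hV hH hr hz
    obtain ⟨e, he, r', hr', hp, hz'⟩ := pick_spec (op := op) (F := fun e => flat N h e.ptr)
      (L := N v) (r := r) (z := z) (fun e he => by
        rw [length_live op (hw.2.1 e he).2.2.isLeafEntry, ← (hw.2.1 e he).2.1]; rfl) hz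
    have hvV := hV v (addrs_self _ _ _)
    have h1 : D.Steps op (selState flag reb al ctr rnk (h + 1) v r) (store hd flag N M) 1
        (selState flag reb al ctr rnk h e.ptr r') (store hd flag N M) := by
      refine steps_read (a := loc flag v) ⟨hal, hctr, hH, hvV, Nat.zero_le _, hr, hrnk,
        by simp [selState], D.entriesOK_nil, D.entriesOK_nil⟩ rfl (loc_lt hvV) ?_
      simp [machineNext, selState, Node.ofList, hp]
    have h2 := ih (hw.2.1 e he).2.2 (fun a ha => hV a (List.mem_cons_of_mem _
      (List.mem_flatMap.2 ⟨e, he, ha⟩))) (by omega) (by omega) hz'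
    rw [add_comm (h + 1) 1]
    exact h1.trans h2

/-! ### Trees that represent groups -/

/-- The tree at the root of the table `N`, with addresses `0, …, al`. -/
structure Root (D : Dim) (N : Table f) (al : ℕ) : Prop where
  tree : IsTree D.m N true D.H 0 al
  card : (addrs N D.H 0).length = al + 1

/-- The slack `D.H` leaves room for the nodes created by one more `put`, at most one on each level
below the root. -/
theorem Root.al_le {N : Table f} {al : ℕ} (hR : Root D N al)
    (hlen : (flat N D.H 0).length ≤ 2 * D.n) : al + D.H ≤ D.V := by
  have h1 := WF.length_addrs D.two_le_q hR.tree.wf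
  rw [hR.card] at h1
  have hB : 0 < D.B := by have := D.two_le_B; omega
  have h2 : (al - D.H) * D.B ≤ 4 * D.n := by
    by_cases h : al ≤ D.H
    · rw [Nat.sub_eq_zero_of_le h]; simp
    · obtain ⟨k, rfl⟩ := Nat.exists_eq_add_of_lt (not_le.1 h)
      rw [show D.H + k + 1 - D.H = k + 1 by omega]
      nlinarith
  have h3 := (Nat.le_div_iff_mul_le hB).2 h2
  have := D.V_eq
  omega

/-- There are fewer than `2 * n ≤ 2 * (B * q ^ H)` entries, so the root is never full and the height
never has to grow. -/
theorem Root.put {N N' : Table f} {al al' : ℕ} (hR : Root D N al) {y : Entry f}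
    (hy : IsLeafEntry y) {o : Fin f → ℕ} (hlen : (flat N D.H 0).length < 2 * D.n)
    (hcnt : countsAt y.key (flat N D.H 0) = o) (hp : EM.put D.m y o D.H 0 (N, al) = (N', al')) :
    (N 0).length < 2 * D.m D.H ∧ Root D N' al' ∧ flat N' D.H 0 = upsert y (flat N D.H 0) := by
  have hfull : (N 0).length < 2 * D.m D.H := by
    refine WF.length_root_lt D.two_le_q hR.tree.wf (hlen.trans_le ?_)
    have := D.n_le
    omega
  obtain ⟨hg, _, hfl⟩ := put_spec D.one_lt_m hy hR.tree hfull hcnt hp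
  refine ⟨hfull, ⟨hg.isTree hR.tree, ?_⟩, hfl⟩
  rw [hg.perm.length_eq, List.length_append, length_fresh, hR.card]
  have := hg.le
  omega

/-- Whatever an abandoned tree has left elsewhere in the table is unreachable, and addresses are
overwritten when they are allocated. Emptying one node is enough to start a new tree. -/
theorem root_nil {N : Table f} (hN : N 0 = []) : Root D N 0 where
  tree := ⟨wf_of_nil _ hN, by rw [addrs_of_nil hN]; simp, by rw [addrs_of_nil hN]; simp⟩
  card := by rw [addrs_of_nil hN]; rfl

end Dim

/-- The entries in `F` represent the group `G`. -/
def Represents (F : List (Entry f)) (G : Fin f → Finset ℝ) : Prop :=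
  ∀ i x, x ∈ G i ↔ ∃ e ∈ F, e.key = x ∧ e.cnt = Pi.single i 1

theorem IsLeafEntry.weight_ne_zero {e : Entry f} (he : IsLeafEntry e) (op : Op f) :
    op.weight e ≠ 0 ↔ ∃ i ∈ op.range, e.cnt = Pi.single i 1 := by
  rcases he.2 with h | ⟨i, h⟩
  · have hne : ∀ i : Fin f, ¬ (0 : Fin f → ℕ) = Pi.single i 1 := fun i hi => by
      have := congrFun hi i
      simp at this
    simp [Op.weight, h, hne]
  · simp only [Op.weight, h, Pi.single_apply, Finset.sum_ite_eq']
    constructor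
    · intro h'
      refine ⟨i, ?_, rfl⟩
      by_contra hi
      simp [hi] at h'
    · rintro ⟨j, hj, hij⟩
      have : i = j := by
        by_contra hne
        have := congrFun hij i
        simp [hne] at this
      simp [this, hj]

theorem KeySorted.nodup_keys {L : List (Entry f)} (h : KeySorted L) :
    (L.map Entry.key).Nodup :=
  List.pairwise_map.2 (h.imp fun hab => hab.ne)

theorem biUnion_eq {F : List (Entry f)} {G : Fin f → Finset ℝ} (hG : Represents F G)
    (hF : ∀ e ∈ F, IsLeafEntry e) (op : Op f) :
    op.range.biUnion G = ((live op F).map Entry.key).toFinset := by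
  ext x
  simp only [Finset.mem_biUnion, List.mem_toFinset, List.mem_map, live, List.mem_filter,
    decide_eq_true_eq]
  constructor
  · rintro ⟨i, hi, hx⟩
    obtain ⟨e, he, rfl, hc⟩ := (hG i x).1 hx
    exact ⟨e, ⟨he, ((hF e he).weight_ne_zero op).2 ⟨i, hi, hc⟩⟩, rfl⟩
  · rintro ⟨e, ⟨he, hw⟩, rfl⟩
    obtain ⟨i, hi, hc⟩ := ((hF e he).weight_ne_zero op).1 hw
    exact ⟨i, hi, (hG i _).2 ⟨e, he, rfl, hc⟩⟩

theorem card_biUnion_eq {F : List (Entry f)} {G : Fin f → Finset ℝ} (hG : Represents F G)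
    (hF : ∀ e ∈ F, IsLeafEntry e) (hs : KeySorted F) (op : Op f) :
    (op.range.biUnion G).card = (live op F).length := by
  rw [biUnion_eq hG hF, List.toFinset_card_of_nodup, List.length_map]
  exact KeySorted.nodup_keys (List.Pairwise.sublist List.filter_sublist hs)

theorem total_eq_card {F : List (Entry f)} {G : Fin f → Finset ℝ} (hG : Represents F G)
    (hF : ∀ e ∈ F, IsLeafEntry e) (hs : KeySorted F) (i : Fin f) :
    total F i = (G i).card := by
  have h := card_biUnion_eq hG hF hs (.qry {i} 0)
  rw [length_live _ hF] at h
  simpa [Op.range] using h.symm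

open Classical in
-- In `rank` the coercion to `WithBot ℝ` is applied to the finset as a whole, through its monad
-- structure. It is the image under the injective coercion of elements, so cardinalities do not
-- change.
theorem lift_eq_map (L : Finset ℝ) :
    (do let a ← L; pure (a : WithBot ℝ) : Finset (WithBot ℝ)) =
      L.map ⟨WithBot.some, WithBot.coe_injective⟩ := by
  rw [bind_pure_comp, Finset.fmap_def, Finset.map_eq_image]
  congr!

theorem rank_eq (L : Finset ℝ) (x : ℝ) : rank L x = (L.filter fun e : ℝ => x ≤ e).card := by
  unfold rank
  rw [lift_eq_map, Finset.filter_map, Finset.card_map]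
  congr 1
  ext a
  simp

/-- The live entries are listed by strictly increasing key, so those at or above the entry with
index `r` are exactly the rest of the list from `r` on. -/
theorem rank_biUnion {F : List (Entry f)} {G : Fin f → Finset ℝ} (hG : Represents F G)
    (hF : ∀ e ∈ F, IsLeafEntry e) (hs : KeySorted F) (op : Op f) {r : ℕ} {z : Entry f}
    (hz : (live op F)[r]? = some z) :
    rank (op.range.biUnion G) (z.key : WithBot ℝ) = (live op F).length - r := by
  classical
  obtain ⟨hr, hz⟩ := List.getElem?_eq_some_iff.1 hz
  have hsl : KeySorted (live op F) := List.Pairwise.sublist List.filter_sublist hs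
  have hdrop : (live op F).drop r = z :: (live op F).drop (r + 1) := by
    rw [List.drop_eq_getElem_cons hr, hz]
  have hsplit := List.take_append_drop r (live op F)
  rw [hdrop] at hsplit
  have hsl' := hsl
  rw [← hsplit] at hsl'
  have hp := List.pairwise_append.1 hsl'
  have : (op.range.biUnion G).filter (fun e : ℝ => z.key ≤ e) =
      (((live op F).drop r).map Entry.key).toFinset := by
    rw [biUnion_eq hG hF op]
    ext x
    simp only [Finset.mem_filter, List.mem_toFinset, List.mem_map]
    constructor
    · rintro ⟨⟨e, he, rfl⟩, hle⟩
      refine ⟨e, ?_, rfl⟩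
      rw [← hsplit] at he
      rw [hdrop]
      rcases List.mem_append.1 he with he | he
      · exact absurd (hp.2.2 e he z (by simp)) (not_lt.2 hle)
      · exact he
    · rintro ⟨e, he, rfl⟩
      refine ⟨⟨e, List.mem_of_mem_drop he, rfl⟩, ?_⟩
      rw [hdrop] at he
      rcases List.mem_cons.1 he with rfl | he
      · exact le_rfl
      · exact ((List.pairwise_cons.1 hp.2.1).1 e he).le
  have hcard : (((live op F).drop r).map Entry.key).toFinset.card = (live op F).length - r := by
    rw [List.toFinset_card_of_nodup, List.length_map, List.length_drop]
    exact KeySorted.nodup_keys (List.Pairwise.sublist (List.drop_sublist _ _) hsl)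
  rw [← hcard, ← this, rank_eq]

namespace Dim

variable {D : Dim} {op : Op f}

/-! ### Whole operations -/

theorem Root.put_steps {flag reb : Bool} {al ctr rnk : ℕ} {N : Table f} (hR : Root D N al)
    {y : Entry f} (hy : IsLeafEntry y) (hlen : (flat N D.H 0).length < 2 * D.n)
    (hcnt : countsAt y.key (flat N D.H 0) = if reb then 0 else op.old)
    (hctr : ctr ≤ D.Z) (hrnk : rnk ≤ D.Z) (hl : ∀ i, total (flat N D.H 0) i ≤ D.l)
    (hl' : ∀ i, total (upsert y (flat N D.H 0)) i ≤ D.l) (hd : Node f) (M : Table f) :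
    ∃ k ≤ 6 * (D.H + 1), ∃ N' al', Root D N' al' ∧ flat N' D.H 0 = upsert y (flat N D.H 0) ∧
      D.Steps op (putState flag reb al ctr rnk y D.H 0) (store hd (xor flag reb) N M) k
        (afterState flag reb al' ctr rnk) (store hd (xor flag reb) N' M) := by
  obtain ⟨⟨N', al'⟩, hp⟩ : ∃ p, EM.put D.m y (if reb then 0 else op.old) D.H 0 (N, al) = p :=
    ⟨_, rfl⟩
  obtain ⟨hfull, hR', hfl⟩ := hR.put hy hlen hcnt hp
  obtain ⟨k, hk, hst⟩ := D.put_steps (op := op) (flag := flag) (reb := reb) hy rfl hctr hrnk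
    (hd := hd) (M := M) hR.tree hfull hcnt hp (hR.al_le hlen.le) le_rfl hl fun i => by
      have h1 := congrFun (total_upsert (y := y) hR.tree.wf.keySorted_flat) i
      have h2 := hl' i
      rw [← hcnt]
      simp only [Pi.add_apply] at h1
      omega
  exact ⟨k, hk, N', al', hR', hfl, hst⟩

/-- The state that determines the number of elements that the operation is about. -/
def countState (flag reb : Bool) (al ctr rnk : ℕ) : State f :=
  ⟨.count, flag, reb, al, ctr, 0, 0, 0, 0, rnk, none, [], []⟩

theorem sum_total_root {N : Table f} {al : ℕ} (hR : Root D N al) (op : Op f) :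
    ∑ i ∈ op.range, total (N 0) i = (live op (flat N D.H 0)).length := by
  rw [hR.tree.wf.total_node, length_live op hR.tree.wf.isLeafEntry]

theorem select_steps {flag reb : Bool} {al ctr rnk al' : ℕ} (hal : al ≤ D.V) (hctr : ctr ≤ D.Z)
    {hd : Node f} {N M : Table f} (hR : Root D N al')
    (hlen : (flat N D.H 0).length ≤ 2 * D.n) {z : Entry f} (hrnk : rnk ≤ (live op (flat N D.H 0)).length)
    (hz : (live op (flat N D.H 0))[(live op (flat N D.H 0)).length - rnk]? = some z) :
    D.Steps op (countState flag reb al ctr rnk) (store hd flag N M) (D.H + 2)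
      (foundState D.H flag reb al ctr rnk z) (store hd flag N M) := by
  have hle : (live op (flat N D.H 0)).length ≤ 2 * D.n :=
    (List.length_filter_le _ _).trans hlen
  have hZ := D.n_le_Z
  have h1 : D.Steps op (countState flag reb al ctr rnk) (store hd flag N M) 1
      (selState flag reb al ctr rnk D.H 0 ((live op (flat N D.H 0)).length - rnk))
      (store hd flag N M) := by
    refine steps_read (a := loc flag 0) ⟨hal, hctr, Nat.zero_le _, Nat.zero_le _, Nat.zero_le _,
      Nat.zero_le _, by simp only [countState]; omega, by simp [countState], D.entriesOK_nil,
      D.entriesOK_nil⟩ rfl (loc_lt (Nat.zero_le _)) ?_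
    simp only [machineNext, countState, store_loc, Node.ofList, sum_total_root hR op]
    rw [if_neg (by omega)]
    rfl
  have h2 := sel_steps (reb := reb) (flag := flag) (rnk := rnk) (hd := hd) (M := M) (op := op) hal
    hctr (by omega) hR.tree.wf (fun a ha => (hR.tree.le a ha).trans (by
      have := hR.al_le hlen; omega)) le_rfl (by omega) hz
  rw [show D.H + 2 = 1 + (D.H + 1) by ring]
  exact h1.trans h2

/-- Here `j` elements, the largest ones, have been copied and `d` remain. Rank `j + 1` is index `d -
1` from below, and the entry found is smaller than everything in the new tree, so putting it there
extends the copied suffix by one. An element costs `H + 2` steps for the selection and at most `6 *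
(H + 1)` for the insertion. -/
theorem rebuild_loop {flag : Bool} {ctr al₀ : ℕ} (hctr : ctr ≤ D.Z) {hd : Node f} {N : Table f}
    (hR : Root D N al₀) (hlen : (flat N D.H 0).length ≤ 2 * D.n)
    (hn : (live op (flat N D.H 0)).length ≤ D.n)
    (hl : ∀ i, total (live op (flat N D.H 0)) i ≤ D.l) (d : ℕ) :
    ∀ {j : ℕ} {M : Table f} {al : ℕ}, j + d = (live op (flat N D.H 0)).length → Root D M al →
    flat M D.H 0 = (live op (flat N D.H 0)).drop d →
    ∃ k ≤ d * (7 * (D.H + 1) + 1), ∃ M' al', Root D M' al' ∧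
      flat M' D.H 0 = live op (flat N D.H 0) ∧
      D.Steps op (countState flag true al ctr (j + 1)) (store hd flag N M) k
        (countState flag true al' ctr (j + d + 1)) (store hd flag N M') := by
  induction d with
  | zero =>
    intro j M al hj hM hfl
    exact ⟨0, by simp, M, al, hM, by simpa using hfl, .refl _ _⟩
  | succ d ih =>
    intro j M al hj hM hfl
    set L := live op (flat N D.H 0) with hL
    have hZ := D.n_le_Z
    have hnn := D.one_le_n
    have hdL : d < L.length := by omega
    have hdrop : L.drop d = L[d] :: L.drop (d + 1) := List.drop_eq_getElem_cons hdL
    have hmem : L[d] ∈ flat N D.H 0 := List.mem_of_mem_filter (List.getElem_mem hdL)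
    have hlenM : (flat M D.H 0).length < 2 * D.n := by rw [hfl, List.length_drop]; omega
    have h1 := select_steps (op := op) (flag := flag) (reb := true) (al := al) (ctr := ctr)
      (rnk := j + 1) (hd := hd) (M := M) (z := L[d])
      (by have := hM.al_le hlenM.le; omega) hctr hR hlen (by rw [← hL]; omega)
      (by rw [← hL, show L.length - (j + 1) = d by omega]; simp)
    have hs : KeySorted (L.drop d) := List.Pairwise.sublist (List.drop_sublist _ _)
      (List.Pairwise.sublist List.filter_sublist hR.tree.wf.keySorted_flat)
    rw [hdrop] at hs
    have hlt := (List.pairwise_cons.1 hs).1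
    have hup : upsert L[d] (flat M D.H 0) = L.drop d := by rw [hfl, upsert_of_lt hlt, hdrop]
    have htot : ∀ e i, total (L.drop e) i ≤ D.l := fun e i => by
      refine le_trans ?_ (hl i)
      calc total (L.drop e) i ≤ (total (L.take e) + total (L.drop e)) i := Nat.le_add_left _ _
        _ = total L i := by rw [← total_append, List.take_append_drop]
    obtain ⟨k, hk, M₁, al₁, hM₁, hfl₁, h2⟩ := hM.put_steps (op := op) (flag := flag) (reb := true)
      (ctr := ctr) (rnk := j + 1) (hR.tree.wf.isLeafEntry _ hmem) hlenM
      (by rw [hfl]; simpa using countsAt_eq_zero fun e he => (hlt e he).ne') hctr (by omega)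
      (fun i => by rw [hfl]; exact htot _ i) (fun i => by rw [hup]; exact htot _ i) hd N
    obtain ⟨k', hk', M', al', hM', hfl', h3⟩ := ih (j := j + 1) (by omega) hM₁ (hfl₁.trans hup)
    rw [Bool.xor_true, store_swap, store_swap] at h2
    refine ⟨D.H + 2 + k + k', by nlinarith, M', al', hM', hfl', ?_⟩
    rw [show j + (d + 1) + 1 = j + 1 + d + 1 by ring]
    exact (h1.trans h2).trans h3

/-- `A` represents the group `G`, and the current tree results from `c` updates. -/
def Inv (D : Dim) (A : ℕ → Node f) (G : Fin f → Finset ℝ) (c : ℕ) : Prop :=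
  ∃ flag al N M, A = store ⟨[], flag, al, c⟩ flag N M ∧ Root D N al ∧
    (flat N D.H 0).length ≤ c ∧ c < 2 * D.n ∧ Represents (flat N D.H 0) G ∧ ∀ a, D.NodeOK (A a)

/-- From the store `A`, the operation with argument `x` leads to the store `A'` in `k` steps, with
output `o`. -/
def Performs (D : Dim) (op : Op f) (x : Option ℝ) (A : ℕ → Node f) (k : ℕ) (A' : ℕ → Node f)
    (o : Option ℝ) : Prop :=
  ∃ s, D.Steps op (machineStart op x) A k s A' ∧ D.StateOK s ∧ machineAct D.m D.n op s = .halt o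

theorem stateOK_start (x : Option ℝ) : D.StateOK (machineStart op x) := by
  refine ⟨Nat.zero_le _, Nat.zero_le _, Nat.zero_le _, Nat.zero_le _, Nat.zero_le _, Nat.zero_le _,
    Nat.zero_le _, ?_, D.entriesOK_nil, D.entriesOK_nil⟩
  intro e he
  simp only [machineStart, Option.mem_def, Option.map_eq_some_iff] at he
  obtain ⟨x, _, rfl⟩ := he
  refine ⟨rfl, ?_⟩
  match op with
  | .upd i true => exact .inr ⟨i, rfl⟩
  | .upd i false => exact .inl rfl
  | .qry R k => exact .inl rfl

theorem Inv.query {A : ℕ → Node f} {G : Fin f → Finset ℝ} {c : ℕ} (h : D.Inv A G c)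
    {R : Finset (Fin f)} {k : ℕ} (hk : 1 ≤ k) (hk' : k ≤ (R.biUnion G).card) :
    ∃ x ∈ R.biUnion G, rank (R.biUnion G) (x : WithBot ℝ) = k ∧
      D.Performs (.qry R k) none A (D.H + 3) A (some x) := by
  obtain ⟨flag, al, N, M, rfl, hR, hlen, hc, hG, hA⟩ := h
  have hF := hR.tree.wf.isLeafEntry
  have hs := hR.tree.wf.keySorted_flat
  have hcard := card_biUnion_eq hG hF hs (.qry R k)
  change (R.biUnion G).card = _ at hcard
  have hlen' : (flat N D.H 0).length ≤ 2 * D.n := hlen.trans hc.le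
  have hZ := D.n_le_Z
  rw [hcard] at hk'
  set L := live (.qry R k) (flat N D.H 0) with hL
  have hr : L.length - k < L.length := by omega
  have hz : L[L.length - k]? = some L[L.length - k] := List.getElem?_eq_getElem hr
  have hal : al ≤ D.V := by have := hR.al_le hlen'; omega
  refine ⟨L[L.length - k].key, ?_, ?_, foundState D.H flag false al c k L[L.length - k], ?_, ?_,
    rfl⟩
  · have := biUnion_eq hG hF (.qry R k)
    change R.biUnion G = _ at this
    rw [this, List.mem_toFinset]
    exact List.mem_map_of_mem (List.getElem_mem hr)
  · have := rank_biUnion hG hF hs (.qry R k) hz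
    change rank (R.biUnion G) _ = _ at this
    rw [this, ← hL]
    omega
  · have h1 : D.Steps (.qry R k) (machineStart (.qry R k) none)
        (store ⟨[], flag, al, c⟩ flag N M) 1 (countState flag false al c k)
        (store ⟨[], flag, al, c⟩ flag N M) :=
      steps_read (a := 0) (stateOK_start _) rfl (by omega) rfl
    have h2 := select_steps (op := .qry R k) (flag := flag) (reb := false) (ctr := c) (rnk := k)
      (hd := ⟨[], flag, al, c⟩) (M := M) hal (by omega) hR hlen' (by rw [← hL]; exact hk') hz
    rw [show D.H + 3 = 1 + (D.H + 2) by ring]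
    exact h1.trans h2
  · have := List.length_filter_le (fun e => (Op.qry R k).weight e ≠ 0) (flat N D.H 0)
    change L.length ≤ _ at this
    refine ⟨hal, by simp only [foundState]; omega, le_rfl, Nat.zero_le _, Nat.zero_le _,
      Nat.zero_le _, by simp only [foundState]; omega, ?_, D.entriesOK_nil, D.entriesOK_nil⟩
    intro e he
    cases he
    exact hF _ (List.mem_of_mem_filter (List.getElem_mem hr))

end Dim

/-! ### Updates -/

theorem total_eq_zero {L : List (Entry f)} (h : ∀ e ∈ L, e.cnt = 0) : total L = 0 := by
  refine List.sum_eq_zero fun c hc => ?_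
  obtain ⟨e, he, rfl⟩ := List.mem_map.1 hc
  exact h e he

theorem total_filter_le (p : Entry f → Bool) (L : List (Entry f)) (i : Fin f) :
    total (L.filter p) i ≤ total L i := by
  induction L with
  | nil => simp
  | cons e L ih =>
    by_cases h : p e
    · simpa [h] using ih
    · simpa [h] using ih.trans (Nat.le_add_left _ _)

/-- The key may still occur in the tree, as a deleted value; such an entry has zero counts. -/
theorem countsAt_of_forall_notMem {F : List (Entry f)} {G : Fin f → Finset ℝ}
    (hG : Represents F G) (hF : ∀ e ∈ F, IsLeafEntry e) {x : ℝ} (hx : ∀ j, x ∉ G j) :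
    countsAt x F = 0 := by
  refine total_eq_zero fun e he => ?_
  simp only [List.mem_filter, decide_eq_true_eq] at he
  rcases (hF e he.1).2 with h | ⟨i, h⟩
  · exact h
  · exact absurd ((hG i x).2 ⟨e, he.1, he.2, h⟩) (hx i)

theorem countsAt_of_mem {F : List (Entry f)} {G : Fin f → Finset ℝ} (hG : Represents F G)
    (hs : KeySorted F) {x : ℝ} {i : Fin f} (hx : x ∈ G i) : countsAt x F = Pi.single i 1 := by
  obtain ⟨e, he, rfl, hc⟩ := (hG i x).1 hx
  obtain ⟨s, t, rfl⟩ := List.append_of_mem he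
  obtain ⟨_, h2, h3⟩ := List.pairwise_append.1 hs
  rw [countsAt_append, countsAt_eq_zero fun d hd => (h3 d hd e (by simp)).ne, zero_add,
    ← List.singleton_append, countsAt_append,
    countsAt_eq_zero (L := t) fun d hd => ((List.pairwise_cons.1 h2).1 d hd).ne', add_zero]
  simp [countsAt, hc]

theorem Represents.upsert {F : List (Entry f)} {G G' : Fin f → Finset ℝ} (hG : Represents F G)
    (hs : KeySorted F) {y : Entry f}
    (h : ∀ j z, z ∈ G' j ↔ (z = y.key ∧ y.cnt = Pi.single j 1) ∨ (z ≠ y.key ∧ z ∈ G j)) :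
    Represents (upsert y F) G' := by
  intro j z
  rw [h, hG j z]
  constructor
  · rintro (⟨rfl, hc⟩ | ⟨hz, e, he, rfl, hc⟩)
    · exact ⟨y, mem_upsert_self _ _, rfl, hc⟩
    · exact ⟨e, (mem_upsert_iff hs e).2 (.inr ⟨he, hz⟩), rfl, hc⟩
  · rintro ⟨e, he, rfl, hc⟩
    rcases (mem_upsert_iff hs e).1 he with rfl | ⟨he, hne⟩
    · exact .inl ⟨rfl, hc⟩
    · exact .inr ⟨hne, e, he, rfl, hc⟩

theorem Represents.live {F : List (Entry f)} {G : Fin f → Finset ℝ} (hG : Represents F G)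
    (hF : ∀ e ∈ F, IsLeafEntry e) {op : Op f} (hop : op.range = Finset.univ) :
    Represents (live op F) G := by
  intro j z
  rw [hG j z]
  constructor
  · rintro ⟨e, he, hk, hc⟩
    refine ⟨e, List.mem_filter.2 ⟨he, ?_⟩, hk, hc⟩
    simpa using ((hF e he).weight_ne_zero op).2 ⟨j, by simp [hop], hc⟩
  · rintro ⟨e, he, hk, hc⟩
    exact ⟨e, List.mem_of_mem_filter he, hk, hc⟩

theorem eraseAt_subset (G : Fin f → Finset ℝ) (i : Fin f) (x : ℝ) (j : Fin f) :
    eraseAt G i x j ⊆ G j := by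
  unfold eraseAt
  by_cases h1 : j = i
  · subst h1
    rw [Function.update_self]
    exact Finset.erase_subset _ _
  · rw [Function.update_of_ne h1]

theorem IsGroup.eraseAt {l : ℕ} {G : Fin f → Finset ℝ} (hG : IsGroup l G) (i : Fin f)
    (x : ℝ) : IsGroup l (eraseAt G i x) :=
  ⟨fun j j' hj => Disjoint.mono (eraseAt_subset G i x j) (eraseAt_subset G i x j') (hG.1 j j' hj),
    fun j => (Finset.card_le_card (eraseAt_subset G i x j)).trans (hG.2 j)⟩

theorem mem_eraseAt {l : ℕ} {G : Fin f → Finset ℝ} (hG : IsGroup l G) {i : Fin f} {x : ℝ}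
    (hx : x ∈ G i) (j : Fin f) (z : ℝ) : z ∈ eraseAt G i x j ↔ z ≠ x ∧ z ∈ G j := by
  unfold eraseAt
  by_cases hj : j = i
  · subst hj
    rw [Function.update_self, Finset.mem_erase]
  · rw [Function.update_of_ne hj]
    have : z ∈ G j → z ≠ x := fun h h' =>
      Finset.disjoint_left.1 (hG.1 i j (Ne.symm hj)) hx (h' ▸ h)
    tauto

namespace Dim

variable {D : Dim}

/-- A bound for the number of steps in a root-to-leaf traversal. -/
def W (D : Dim) : ℕ := 8 * (D.H + 1)

/-- Amortization with the potential `(c - n) * W`, truncated at 0. An ordinary update raises it by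
at most `W`. A rebuild happens when `c = 2 * n - 1`, costs at most `n * W` for the copying, and
leaves a counter of at most `n`, so the potential drops from `(n - 1) * W` to 0. -/
theorem Inv.update {A : ℕ → Node f} {G G' : Fin f → Finset ℝ} {c : ℕ} (h : D.Inv A G c)
    (hn : f * D.l ≤ D.n) (hG₀ : IsGroup D.l G) (hG₀' : IsGroup D.l G') {i : Fin f} {ins : Bool}
    {x : ℝ} (hmem : ∀ j z, z ∈ G' j ↔
      (z = x ∧ (Op.upd i ins).new = Pi.single j 1) ∨ (z ≠ x ∧ z ∈ G j))
    (hold : ∀ F, Represents F G → (∀ e ∈ F, IsLeafEntry e) → KeySorted F →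
      countsAt x F = (Op.upd i ins).old) :
    ∃ k A' c', D.Performs (.upd i ins) (some x) A k A' none ∧ D.Inv A' G' c' ∧ c' ≤ c + 1 ∧
      k + (c' - D.n) * D.W ≤ (c - D.n) * D.W + 3 * D.W := by
  obtain ⟨flag, al, N, M, rfl, hR, hlen, hc, hG, hA⟩ := h
  set op : Op f := .upd i ins with hop
  have hF := hR.tree.wf.isLeafEntry
  have hs := hR.tree.wf.keySorted_flat
  have hlen' : (flat N D.H 0).length < 2 * D.n := hlen.trans_lt hc
  have hZ := D.n_le_Z
  have hal : al ≤ D.V := by have := hR.al_le hlen'.le; omega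
  set y : Entry f := ⟨x, 0, op.new⟩ with hy
  have hyl : IsLeafEntry y := by
    refine ⟨rfl, ?_⟩
    cases ins
    · exact .inl rfl
    · exact .inr ⟨i, rfl⟩
  have hG' : Represents (upsert y (flat N D.H 0)) G' := hG.upsert hs hmem
  have hs' : KeySorted (upsert y (flat N D.H 0)) := hs.upsert
  have hF' : ∀ e ∈ upsert y (flat N D.H 0), IsLeafEntry e := fun e he => by
    rcases mem_of_mem_upsert he with rfl | he
    · exact hyl
    · exact hF e he
  have hl' : ∀ i, total (upsert y (flat N D.H 0)) i ≤ D.l := fun i => by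
    rw [total_eq_card hG' hF' hs']; exact hG₀'.2 i
  have h1 : D.Steps op (machineStart op (some x)) (store ⟨[], flag, al, c⟩ flag N M) 1
      (putState flag false al c 0 y D.H 0) (store ⟨[], flag, al, c⟩ flag N M) :=
    steps_read (a := 0) (stateOK_start _) rfl (by omega) rfl
  obtain ⟨k, hk, N', al', hR', hfl', h2⟩ := hR.put_steps (op := op) (flag := flag) (reb := false)
    (ctr := c) (rnk := 0) hyl hlen' (by simpa using hold _ hG hF hs) (by omega) (Nat.zero_le _)
    (fun i => by rw [total_eq_card hG hF hs]; exact hG₀.2 i) hl' ⟨[], flag, al, c⟩ M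
  rw [Bool.xor_false] at h2
  rw [← hfl'] at hG' hs' hF' hl'
  have hlen₁ : (flat N' D.H 0).length ≤ c + 1 := by
    rw [hfl']; exact (length_upsert_le _ _).trans (by omega)
  have hal' : al' ≤ D.V := by have := hR'.al_le (by omega); omega
  have hdone : D.StateOK (afterState flag false al' c 0 : State f) :=
    ⟨hal', by simp only [afterState]; omega, Nat.zero_le _, Nat.zero_le _, Nat.zero_le _,
      Nat.zero_le _, by simp only [afterState]; omega, by simp [afterState], D.entriesOK_nil,
      D.entriesOK_nil⟩
  have hW : D.W = 8 * (D.H + 1) := rfl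
  by_cases hfull : c + 1 < 2 * D.n
  · have hnode : D.NodeOK (⟨[], flag, al', c + 1⟩ : Node f) := ⟨D.entriesOK_nil, hal', hfull.le⟩
    have h3 : D.Steps op (afterState flag false al' c 0) (store ⟨[], flag, al, c⟩ flag N' M) 1
        ⟨.out, flag, false, al', c, 0, 0, 0, 0, 1, none, [], []⟩
        (store ⟨[], flag, al', c + 1⟩ flag N' M) :=
      steps_write (a := 0) (b := ⟨[], flag, al', c + 1⟩) hdone
        (by simp [machineAct, afterState, hfull]) (by omega) hnode
        (by simp [machineNext, afterState, hfull]) (update_store_zero _ _ _ _ _)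
    have h4 := (h1.trans h2).trans h3
    refine ⟨1 + k + 1, _, c + 1, ⟨_, h4, ?_, rfl⟩, ⟨flag, al', N', M, rfl, hR', hlen₁, hfull, hG',
      h4.valid hA⟩, le_rfl, ?_⟩
    · exact ⟨hal', by simp only; omega, Nat.zero_le _, Nat.zero_le _, Nat.zero_le _,
        Nat.zero_le _, by simp only; omega, by simp, D.entriesOK_nil, D.entriesOK_nil⟩
    · have : (c + 1 - D.n) * D.W ≤ (c - D.n + 1) * D.W := Nat.mul_le_mul_right _ (by omega)
      nlinarith
  · have h3 : D.Steps op (afterState flag false al' c 0) (store ⟨[], flag, al, c⟩ flag N' M) 1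
        (countState flag true 0 c 1)
        (store ⟨[], flag, al, c⟩ flag N' (Function.update M 0 [])) := by
      refine steps_write (a := loc (!flag) 0) (b := .ofList []) hdone
        (by simp [machineAct, afterState, hfull]) (loc_lt (Nat.zero_le _))
        (D.nodeOK_ofList D.entriesOK_nil) (by simp [machineNext, afterState, hfull, countState]) ?_
      rw [← store_swap, update_store_loc, store_swap]
    set L := EM.live op (flat N' D.H 0) with hL
    -- Live entries are the elements of the group after the update, of which there are at most `f *
    -- l`; deleted values do not survive the rebuild.
    have hLn : L.length ≤ D.n := by
      rw [hL, length_live op hF']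
      calc ∑ i ∈ op.range, total (flat N' D.H 0) i ≤ ∑ i ∈ op.range, D.l :=
            Finset.sum_le_sum fun i _ => hl' i
        _ = f * D.l := by simp [hop, Op.range]
        _ ≤ D.n := hn
    obtain ⟨k', hk', M', al₂, hM', hflM, h4⟩ := rebuild_loop (op := op) (flag := flag) (ctr := c)
      (hd := ⟨[], flag, al, c⟩) (by omega) hR' (by omega) hLn
      (fun i => (total_filter_le _ _ i).trans (hl' i)) L.length (j := 0)
      (M := Function.update M 0 []) (al := 0) (by rw [hL, zero_add]) (root_nil (by simp))
      (by rw [flat_of_nil (by simp), hL, List.drop_length])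
    rw [zero_add, zero_add] at h4
    have hal₂ : al₂ ≤ D.V := by
      have := hM'.al_le (by rw [hflM, ← hL]; omega)
      omega
    have hnn := D.one_le_n
    have h5 : D.Steps op (countState flag true al₂ c (L.length + 1))
        (store ⟨[], flag, al, c⟩ flag N' M') 1
        ⟨.fin, flag, true, al₂, c, 0, 0, 0, 0, L.length + 1, none, [], []⟩
        (store ⟨[], flag, al, c⟩ flag N' M') := by
      refine steps_read (a := loc flag 0) ⟨hal₂, by simp only [countState]; omega, Nat.zero_le _,
        Nat.zero_le _, Nat.zero_le _, Nat.zero_le _, by simp only [countState]; omega,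
        by simp [countState], D.entriesOK_nil, D.entriesOK_nil⟩ rfl (loc_lt (Nat.zero_le _)) ?_
      simp only [machineNext, countState, store_loc, Node.ofList, sum_total_root hR' op]
      rw [if_pos (by rw [← hL]; omega)]
    have h6 : D.Steps op
        ⟨.fin, flag, true, al₂, c, 0, 0, 0, 0, L.length + 1, none, [], []⟩
        (store ⟨[], flag, al, c⟩ flag N' M') 1
        ⟨.out, flag, true, al₂, c, 0, 0, 0, 0, L.length + 1, none, [], []⟩
        (store ⟨[], !flag, al₂, L.length⟩ (!flag) M' N') := by
      refine steps_write (a := 0) (b := ⟨[], !flag, al₂, L.length⟩) ⟨hal₂, by simp only; omega,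
        Nat.zero_le _, Nat.zero_le _, Nat.zero_le _, Nat.zero_le _, by simp only; omega, by simp,
        D.entriesOK_nil, D.entriesOK_nil⟩ rfl (by omega)
        ⟨D.entriesOK_nil, hal₂, by simp only; omega⟩ rfl ?_
      rw [update_store_zero, store_swap]
    have h7 := ((((h1.trans h2).trans h3).trans h4).trans h5).trans h6
    refine ⟨_, _, L.length, ⟨_, h7, ?_, rfl⟩, ⟨!flag, al₂, M', N', rfl, hM', by rw [hflM],
      by omega, ?_, h7.valid hA⟩, by omega, ?_⟩
    · exact ⟨hal₂, by simp only; omega, Nat.zero_le _, Nat.zero_le _, Nat.zero_le _,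
        Nat.zero_le _, by simp only; omega, by simp, D.entriesOK_nil, D.entriesOK_nil⟩
    · rw [hflM]
      exact hG'.live hF' rfl
    · have hcc : c = 2 * D.n - 1 := by omega
      have h8 : k' ≤ D.n * (7 * (D.H + 1) + 1) := hk'.trans (Nat.mul_le_mul_right _ hLn)
      have h9 : D.n * (7 * (D.H + 1) + 1) ≤ D.n * D.W := Nat.mul_le_mul_left _ (by omega)
      rw [Nat.sub_eq_zero_of_le hLn, zero_mul, add_zero, show c - D.n = D.n - 1 by omega]
      have h10 : (D.n - 1) * D.W + 3 * D.W = D.n * D.W + 2 * D.W := by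
        obtain ⟨p, hp⟩ := Nat.exists_eq_add_of_le' hnn
        rw [hp]; simp; ring
      omega

theorem Inv.insert {A : ℕ → Node f} {G : Fin f → Finset ℝ} {c : ℕ} (h : D.Inv A G c)
    (hn : f * D.l ≤ D.n) (hG : IsGroup D.l G) {i : Fin f} {x : ℝ} (hx : CanInsert D.l G i x) :
    IsGroup D.l (insertAt G i x) ∧
    ∃ k A' c', D.Performs (.upd i true) (some x) A k A' none ∧ D.Inv A' (insertAt G i x) c' ∧
      c' ≤ c + 1 ∧ k + (c' - D.n) * D.W ≤ (c - D.n) * D.W + 3 * D.W := by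
  have hG' : IsGroup D.l (insertAt G i x) := by
    refine ⟨fun j j' hj => ?_, fun j => ?_⟩
    · have := hG.1 j j' hj
      unfold insertAt
      by_cases h1 : j = i
      · subst h1
        rw [Function.update_self, Function.update_of_ne hj.symm]
        exact Finset.disjoint_insert_left.2 ⟨hx.1 _, this⟩
      · rw [Function.update_of_ne h1]
        by_cases h2 : j' = i
        · subst h2
          rw [Function.update_self]
          exact Finset.disjoint_insert_right.2 ⟨hx.1 _, this⟩
        · rwa [Function.update_of_ne h2]
    · unfold insertAt
      by_cases h1 : j = i
      · subst h1
        rw [Function.update_self]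
        exact (Finset.card_insert_le _ _).trans hx.2
      · rw [Function.update_of_ne h1]
        exact hG.2 j
  refine ⟨hG', h.update hn hG hG' (fun j z => ?_) fun F hF hl hs =>
    countsAt_of_forall_notMem hF hl hx.1⟩
  have hsingle : (Op.upd i true).new = Pi.single j 1 ↔ j = i := by
    constructor
    · intro h
      by_contra hne
      have := congrFun h j
      simp [Op.new, hne] at this
    · rintro rfl; rfl
  rw [hsingle]
  unfold insertAt
  by_cases hj : j = i
  · subst hj
    rw [Function.update_self, Finset.mem_insert]
    by_cases hz : z = x <;> simp [hz]
  · rw [Function.update_of_ne hj]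
    have : z ∈ G j → z ≠ x := fun h h' => hx.1 j (h' ▸ h)
    tauto

theorem Inv.erase {A : ℕ → Node f} {G : Fin f → Finset ℝ} {c : ℕ} (h : D.Inv A G c)
    (hn : f * D.l ≤ D.n) (hG : IsGroup D.l G) {i : Fin f} {x : ℝ} (hx : x ∈ G i) :
    IsGroup D.l (eraseAt G i x) ∧
    ∃ k A' c', D.Performs (.upd i false) (some x) A k A' none ∧ D.Inv A' (eraseAt G i x) c' ∧
      c' ≤ c + 1 ∧ k + (c' - D.n) * D.W ≤ (c - D.n) * D.W + 3 * D.W := by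
  have hG' := hG.eraseAt i x
  refine ⟨hG', h.update hn hG hG' (fun j z => ?_) fun F hF hl hs => countsAt_of_mem hF hs hx⟩
  have hne : ¬ (Op.upd i false).new = Pi.single j 1 := by
    intro h
    have := congrFun h j
    simp [Op.new] at this
  rw [mem_eraseAt hG hx]
  tauto

end Dim

/-! ### Execution of programs -/

open Classical in
/-- The disk after a run of the program, if it stops. -/
noncomputable def Program.exec {P : Params} {S : ℕ} (Q : Program P S) (m : Mem P) (d : Disk P S) :
    Disk P S :=
  if h : ∃ d' t m', Q.Runs m d t m' d' then h.choose else d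

theorem Program.Runs.exec_eq {P : Params} {S : ℕ} {Q : Program P S} {m m' : Mem P}
    {d d' : Disk P S} {t : ℕ} (h : Q.Runs m d t m' d') : Q.exec m d = d' := by
  have hex : ∃ d' t m', Q.Runs m d t m' d' := ⟨d', t, m', h⟩
  rw [Program.exec, dif_pos hex]
  obtain ⟨t, m₁, h₁⟩ := hex.choose_spec
  exact (h₁.det h).2.2

theorem Mem.map_symm_map {P : Params} (σ : ℝ ≃o ℝ) (m : Mem P) : (m.map σ).map σ.symm = m :=
  funext fun _ => Word.map_symm_map σ _

theorem Disk.map_symm_map {P : Params} {S : ℕ} (σ : ℝ ≃o ℝ) (d : Disk P S) :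
    (d.map σ).map σ.symm = d :=
  funext fun _ => funext fun _ => Word.map_symm_map σ _

/-- Non-terminating programs are covered too: a run on the relabelled data could be transported back
by `σ.symm`. -/
theorem Program.exec_map {P : Params} {S : ℕ} (Q : Program P S) (σ : ℝ ≃o ℝ) (m : Mem P)
    (d : Disk P S) : Q.exec (m.map σ) (d.map σ) = (Q.exec m d).map σ := by
  by_cases h : ∃ d' t m', Q.Runs m d t m' d'
  · obtain ⟨d', t, m', h⟩ := h
    rw [h.exec_eq, (h.map σ).exec_eq]
  · have h' : ¬ ∃ d' t m', Q.Runs (m.map σ) (d.map σ) t m' d' := by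
      rintro ⟨d', t, m', h'⟩
      have := h'.map σ.symm
      rw [Mem.map_symm_map, Disk.map_symm_map] at this
      exact h ⟨_, _, _, this⟩
    rw [Program.exec, Program.exec, dif_neg h, dif_neg h']

theorem Mem.map_arg {P : Params} (σ : ℝ → ℝ) (x : ℝ) :
    (Mem.arg P x).map σ = Mem.arg P (σ x) := by
  funext j
  by_cases hj : j = P.first
  · subst hj; simp [Mem.map, Mem.arg, Word.map]
  · simp [Mem.map, Mem.arg, hj, Mem.blank, Word.map_blank]

/-! ### The elements of a group -/

/-- The elements of a group, with the indices of their sets. -/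
noncomputable def elements (G : Fin f → Finset ℝ) : List (Fin f × ℝ) :=
  (List.finRange f).flatMap fun i => ((G i).sort (· ≤ ·)).map (Prod.mk i)

theorem mem_elements {G : Fin f → Finset ℝ} {i : Fin f} {x : ℝ} :
    (i, x) ∈ elements G ↔ x ∈ G i := by
  simp [elements]

theorem nodup_elements (G : Fin f → Finset ℝ) : (elements G).Nodup := by
  refine List.nodup_flatMap.2 ⟨fun i _ => (Finset.sort_nodup _ _).map (Prod.mk_right_injective i),
    (List.nodup_finRange f).imp fun {i j} hij => ?_⟩
  rw [Function.onFun, List.disjoint_left]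
  rintro ⟨k, x⟩ hi hj
  simp only [List.mem_map, Prod.mk.injEq] at hi hj
  obtain ⟨_, _, rfl, _⟩ := hi
  obtain ⟨_, _, rfl, _⟩ := hj
  exact hij rfl

theorem sort_map (σ : ℝ ≃o ℝ) (s : Finset ℝ) :
    (s.map σ.toEquiv.toEmbedding).sort (· ≤ ·) = (s.sort (· ≤ ·)).map σ := by
  refine List.Perm.eq_of_pairwise' (r := (· ≤ ·)) (Finset.pairwise_sort _ _) ?_ ?_
  · exact List.pairwise_map.2 ((Finset.pairwise_sort s _).imp fun h => σ.monotone h)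
  · rw [← Multiset.coe_eq_coe, Finset.sort_eq, ← Multiset.map_coe, Finset.sort_eq]
    rfl

theorem elements_map (σ : ℝ ≃o ℝ) (G : Fin f → Finset ℝ) :
    elements (fun i => (G i).map σ.toEquiv.toEmbedding) =
      (elements G).map fun p => (p.1, σ p.2) := by
  simp only [elements, sort_map, List.map_flatMap, List.map_map]
  rfl

theorem length_elements (G : Fin f → Finset ℝ) : (elements G).length = ∑ i, (G i).card := by
  simp only [elements, List.length_flatMap, List.length_map, Finset.length_sort]
  rw [← List.sum_ofFn, List.ofFn_eq_map]

theorem elements_empty : elements (fun _ : Fin f => ∅) = [] := by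
  simp [elements]

/-! ### From the machine to a structure for groups -/

theorem NodeMachine.Steps.mono {Nd St : Type} [Relabel Nd] [Relabel St] {Q : NodeMachine Nd St}
    {vs vs' : St → Prop} {vn vn' : Nd → Prop} {S : ℕ} (hs : ∀ s, vs s → vs' s)
    (hn : ∀ n, vn n → vn' n) {s s' : St} {A A' : ℕ → Nd} {t : ℕ}
    (h : Q.Steps vs vn S s A t s' A') : Q.Steps vs' vn' S s A t s' A' := by
  induction h with
  | refl s A => exact .refl s A
  | read h1 h2 h3 _ ih => exact .read (hs _ h1) h2 h3 ih
  | write h1 h2 h3 h4 _ ih => exact .write (hs _ h1) h2 h3 (hn _ h4) ih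

theorem relabel_symm_entry (σ : ℝ ≃o ℝ) (e : Entry f) : relabel σ.symm (relabel σ e) = e :=
  Entry.ext (σ.symm_apply_apply _) rfl rfl

theorem relabel_symm_list (σ : ℝ ≃o ℝ) (L : List (Entry f)) :
    relabel σ.symm (relabel σ L) = L := by
  rw [relabel_list, relabel_list, List.map_map]
  exact (List.map_congr_left fun e _ => relabel_symm_entry σ e).trans (List.map_id _)

theorem relabel_symm_node (σ : ℝ ≃o ℝ) (n : Node f) : relabel σ.symm (relabel σ n) = n :=
  Node.ext (relabel_symm_list σ n.es) rfl rfl rfl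

theorem relabel_symm_state (σ : ℝ ≃o ℝ) (s : State f) : relabel σ.symm (relabel σ s) = s := by
  refine State.ext rfl rfl rfl rfl rfl rfl rfl rfl rfl rfl ?_ (relabel_symm_list σ s.nd)
    (relabel_symm_list σ s.cn)
  change (s.cur.map (relabel σ)).map (relabel σ.symm) = s.cur
  cases s.cur with
  | none => rfl
  | some e => exact congrArg some (relabel_symm_entry σ e)

/-- A layout that can represent all nodes and states within the bounds, and represents an empty
node by blank blocks. -/
structure Fits (D : Dim) {P : Params} {K : ℕ} (E : Layout P K (Node f) (State f)) : Prop where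
  pos : 0 < K
  st : ∀ s, D.StateOK s → ∀ j ≤ K, E.st.valid (s, j)
  node : ∀ n, D.NodeOK n → E.node.valid n
  empty : E.node.code (Node.ofList []) = fun _ => Word.blank P.w

namespace Fits

variable {D : Dim} {P : Params} {K : ℕ} {E : Layout P K (Node f) (State f)}

variable (D E) in
/-- The program for the operation `op`. -/
noncomputable def prog (op : Op f) : Program P ((2 * D.V + 3) * K) :=
  E.program (machine D.m D.H D.n op) relabel_symm_state relabel_symm_node (2 * D.V + 3)

variable (D E) in
/-- The disk that represents the store `A`. -/
def disk (A : ℕ → Node f) : Disk P ((2 * D.V + 3) * K) := E.disk (2 * D.V + 3) A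

/-- The memory in which an operation starts. -/
noncomputable def startMem (P : Params) : Option ℝ → Mem P
  | none => Mem.blank P
  | some x => Mem.arg P x

theorem runs (hE : Fits D E) {op : Op f} {x o : Option ℝ} {A A' : ℕ → Node f} {k : ℕ}
    (h : D.Performs op x A k A' o) (hA : ∀ a, D.NodeOK (A a)) :
    ∃ m', (prog D E op).Runs (startMem P x) (disk D E A) (k * K) m' (disk D E A') ∧
      m' P.first = Word.ofOption P.w o := by
  obtain ⟨s, h1, h2, h3⟩ := h
  refine E.run_steps _ hE.pos (h1.mono hE.st hE.node) (hE.st s h2) h3 (fun a => hE.node _ (hA a))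
    (startMem P x) (fun _ => Word.blank P.w) ?_
  have hB : 0 < P.B := Nat.zero_lt_two.trans_le P.two_le_B
  have hblank : ∀ k, startMem P x (E.pos k) = Word.blank P.w := by
    intro k
    cases x with
    | none => rfl
    | some x =>
      have hne : E.pos k ≠ P.first := fun h => by
        have := E.le_pos k
        rw [h] at this
        exact absurd this (by simpa [Params.first] using hB.ne')
      simp [startMem, Mem.arg, hne, Mem.blank]
  have hreal : (startMem P x P.first).real = x := by
    cases x with
    | none => rfl
    | some x => simp [startMem, Mem.arg, Word.real]
  unfold Layout.Ready Layout.load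
  rw [if_pos hblank, hreal]
  rfl

variable (D E) in
/-- The disk after the insertion of the elements of `L`, the last one first. -/
noncomputable def buildList : List (Fin f × ℝ) → Disk P ((2 * D.V + 3) * K)
  | [] => Disk.blank P _
  | p :: L => (prog D E (.upd p.1 true)).exec (Mem.arg P p.2) (buildList L)

theorem buildList_map (σ : ℝ ≃o ℝ) (L : List (Fin f × ℝ)) :
    buildList D E (L.map fun p => (p.1, σ p.2)) = (buildList D E L).map σ := by
  induction L with
  | nil => rfl
  | cons p L ih =>
    rw [List.map_cons, buildList, buildList, ih, ← Program.exec_map, Mem.map_arg]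

variable (D E) in
/-- The structure with the operations of the machine. -/
noncomputable def groupStructure : GroupStructure P ((2 * D.V + 3) * K) f where
  build G := buildList D E (elements G)
  build_equivariant σ G := by rw [elements_map, buildList_map]
  build_empty := by rw [elements_empty]; rfl
  insertProg i := prog D E (.upd i true)
  deleteProg i := prog D E (.upd i false)
  queryProg α₁ α₂ k := prog D E (.qry (Finset.Icc α₁ α₂) ⌈k⌉₊)

/-- The store of empty nodes, read as a header with current tree `false`, counter 0 and an empty
root, is a correct structure for the empty group; on disk it is blank. -/
theorem _root_.EM.Dim.inv_empty : D.Inv (fun _ => Node.ofList []) (fun _ : Fin f => ∅) 0 := by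
  have hn := D.one_le_n
  refine ⟨false, 0, fun _ => [], fun _ => [], ?_, Dim.root_nil rfl, ?_, by omega, ?_,
    fun _ => D.nodeOK_ofList D.entriesOK_nil⟩
  · funext a
    unfold store
    split
    · rfl
    · split <;> rfl
  · rw [flat_of_nil rfl]; rfl
  · intro i x
    rw [flat_of_nil rfl]
    simp

theorem insertAt_eraseAt {G : Fin f → Finset ℝ} {i : Fin f} {x : ℝ} (hx : x ∈ G i) :
    insertAt (eraseAt G i x) i x = G := by
  unfold insertAt eraseAt
  rw [Function.update_self, Function.update_idem, Finset.insert_erase hx, Function.update_eq_self]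

/-- Each insertion raises the counter by at most one. In the initial layout the counter is thus at
most `f * l ≤ n`, and the potential is zero, as is needed to start the amortized analysis from an
arbitrary group. -/
theorem buildList_eq (hE : Fits D E) (hn : f * D.l ≤ D.n) (L : List (Fin f × ℝ)) :
    ∀ {G : Fin f → Finset ℝ}, IsGroup D.l G → (∀ i x, (i, x) ∈ L ↔ x ∈ G i) → L.Nodup →
    ∃ A c, buildList D E L = disk D E A ∧ D.Inv A G c ∧ c ≤ L.length := by
  induction L with
  | nil =>
    intro G _ hL _
    have : G = fun _ => ∅ := by
      funext i
      exact Finset.eq_empty_of_forall_notMem fun x hx => by simpa using (hL i x).2 hx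
    subst this
    refine ⟨_, 0, ?_, Dim.inv_empty, le_rfl⟩
    funext a j
    exact (congrFun hE.empty _).symm
  | cons p L ih =>
    intro G hG hL hnd
    obtain ⟨i, x⟩ := p
    rw [List.nodup_cons] at hnd
    have hx : x ∈ G i := (hL i x).1 (by simp)
    have hG' := hG.eraseAt i x
    obtain ⟨A, c, hA, hinv, hc⟩ := ih hG' (fun j z => by
      rw [mem_eraseAt hG hx, ← hL j z, List.mem_cons, Prod.mk.injEq]
      constructor
      · intro h
        refine ⟨?_, .inr h⟩
        rintro rfl
        have hzj := (hL j z).1 (List.mem_cons_of_mem _ h)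
        by_cases hij : i = j
        · subst hij; exact hnd.1 h
        · exact Finset.disjoint_left.1 (hG.1 i j hij) hx hzj
      · tauto) hnd.2
    have hins : CanInsert D.l (EM.eraseAt G i x) i x := by
      refine ⟨fun j hj => ((mem_eraseAt hG hx j x).1 hj).1 rfl, ?_⟩
      unfold EM.eraseAt
      rw [Function.update_self, Finset.card_erase_add_one hx]
      exact hG.2 i
    obtain ⟨-, k, A', c', hp, hinv', hc', -⟩ := hinv.insert hn hG' hins
    rw [insertAt_eraseAt hx] at hinv'
    have hAok : ∀ a, D.NodeOK (A a) := by
      obtain ⟨_, _, _, _, _, _, _, _, _, h⟩ := hinv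
      exact h
    obtain ⟨m', hr, -⟩ := hE.runs hp hAok
    refine ⟨A', c', ?_, hinv', by rw [List.length_cons]; omega⟩
    rw [buildList, hA]
    exact hr.exec_eq

theorem _root_.EM.Dim.Inv.nodeOK {A : ℕ → Node f} {G : Fin f → Finset ℝ} {c : ℕ}
    (h : D.Inv A G c) : ∀ a, D.NodeOK (A a) := by
  obtain ⟨_, _, _, _, _, _, _, _, _, h⟩ := h
  exact h

/-- Summing the amortized bound over the history, with `K` I/Os for each step. Queries leave the
disk unchanged and affect neither the counter nor the potential. -/
theorem reach (hE : Fits D E) (hn : f * D.l ≤ D.n) {G : Fin f → Finset ℝ}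
    {d : Disk P ((2 * D.V + 3) * K)} {u t : ℕ} (h : (groupStructure D E).Reach D.l G d u t) :
    IsGroup D.l G ∧ ∃ A c, d = disk D E A ∧ D.Inv A G c ∧
      t + (c - D.n) * D.W * K ≤ u * (3 * D.W * K) := by
  induction h with
  | @init G hG =>
    obtain ⟨A, c, hA, hinv, hc⟩ := hE.buildList_eq hn (elements G) hG (fun i x => mem_elements)
      (nodup_elements G)
    refine ⟨hG, A, c, hA, hinv, ?_⟩
    have : c ≤ D.n := by
      refine hc.trans ?_
      rw [length_elements]
      calc ∑ i, (G i).card ≤ ∑ _i : Fin f, D.l := Finset.sum_le_sum fun i _ => hG.2 i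
        _ = f * D.l := by simp
        _ ≤ D.n := hn
    rw [Nat.sub_eq_zero_of_le this]
    simp
  | @insert G d d' u t s m' i x _ hx hr ih =>
    obtain ⟨hG, A, c, rfl, hinv, ht⟩ := ih
    obtain ⟨hG', k, A', c', hp, hinv', -, hk⟩ := hinv.insert hn hG hx
    obtain ⟨m₁, hr₁, -⟩ := hE.runs hp hinv.nodeOK
    obtain ⟨rfl, -, rfl⟩ := hr₁.det hr
    refine ⟨hG', A', c', rfl, hinv', ?_⟩
    have := Nat.mul_le_mul_right K hk
    rw [Nat.add_mul, Nat.add_mul] at this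
    rw [Nat.add_mul, one_mul]
    omega
  | @delete G d d' u t s m' i x _ hx hr ih =>
    obtain ⟨hG, A, c, rfl, hinv, ht⟩ := ih
    obtain ⟨hG', k, A', c', hp, hinv', -, hk⟩ := hinv.erase hn hG hx
    obtain ⟨m₁, hr₁, -⟩ := hE.runs hp hinv.nodeOK
    obtain ⟨rfl, -, rfl⟩ := hr₁.det hr
    refine ⟨hG', A', c', rfl, hinv', ?_⟩
    have := Nat.mul_le_mul_right K hk
    rw [Nat.add_mul, Nat.add_mul] at this
    rw [Nat.add_mul, one_mul]
    omega
  | @query G d d' u t s m' α₁ α₂ k _ hk hr ih =>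
    obtain ⟨hG, A, c, rfl, hinv, ht⟩ := ih
    obtain ⟨x, -, -, hp⟩ := hinv.query (R := Finset.Icc α₁ α₂) (k := ⌈k⌉₊)
      (Nat.one_le_ceil_iff.2 (by linarith [hk.2.1])) (Nat.ceil_le.2 hk.2.2)
    obtain ⟨m₁, hr₁, -⟩ := hE.runs hp hinv.nodeOK
    obtain ⟨-, -, rfl⟩ := hr₁.det hr
    exact ⟨hG, A, c, rfl, hinv, ht⟩

theorem solves (hE : Fits D E) (hn : f * D.l ≤ D.n) {T : ℝ} (hT : ((3 * D.W * K : ℕ) : ℝ) ≤ T) :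
    (groupStructure D E).Solves D.l 2 T := by
  intro G d u t h
  obtain ⟨hG, A, c, rfl, hinv, ht⟩ := hE.reach hn h
  refine ⟨?_, fun i x hx => ?_, fun i x hx => ?_, fun α₁ α₂ k hk => ?_⟩
  · calc (t : ℝ) ≤ ((u * (3 * D.W * K) : ℕ) : ℝ) := by
          exact_mod_cast (Nat.le_add_right _ _).trans ht
      _ = u * ((3 * D.W * K : ℕ) : ℝ) := by push_cast; ring
      _ ≤ u * T := by gcongr
  · obtain ⟨-, k, A', c', hp, -, -, -⟩ := hinv.insert hn hG hx
    obtain ⟨m₁, hr₁, -⟩ := hE.runs hp hinv.nodeOK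
    exact ⟨_, _, _, hr₁⟩
  · obtain ⟨-, k, A', c', hp, -, -, -⟩ := hinv.erase hn hG hx
    obtain ⟨m₁, hr₁, -⟩ := hE.runs hp hinv.nodeOK
    exact ⟨_, _, _, hr₁⟩
  · obtain ⟨x, hx, hrank, hp⟩ := hinv.query (R := Finset.Icc α₁ α₂) (k := ⌈k⌉₊)
      (Nat.one_le_ceil_iff.2 (by linarith [hk.2.1])) (Nat.ceil_le.2 hk.2.2)
    obtain ⟨m₁, hr₁, hm₁⟩ := hE.runs hp hinv.nodeOK
    refine ⟨_, _, _, hr₁, ?_, ?_⟩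
    · refine le_trans ?_ hT
      exact_mod_cast Nat.mul_le_mul_right _ (show D.H + 3 ≤ 3 * (8 * (D.H + 1)) by omega)
    · rw [hm₁]
      change IsAnswer 2 G α₁ α₂ k (x : WithBot ℝ)
      have hrank' : rank (unionOn G α₁ α₂) (x : WithBot ℝ) = ⌈k⌉₊ := hrank
      refine ⟨.inr ⟨x, hx, rfl⟩, ?_, ?_⟩
      · rw [hrank']; exact Nat.le_ceil k
      · rw [hrank']
        -- Here `⌈k⌉ < k + 1 ≤ 2 * k`, since `k ≥ 1`.
        have := Nat.ceil_lt_add_one (a := k) (by linarith [hk.2.1])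
        linarith [hk.2.1]

end Fits

/-! ### Counting bits -/

/-- The elements of `s` can be told apart by `b` bits. -/
def Bits {α : Type} (s : Set α) (b : ℕ) : Prop := ∃ c : α → Fin b → Bool, Set.InjOn c s

namespace Bits

variable {α β : Type} {s : Set α} {t : Set β} {b b' : ℕ}

theorem of_fintype {ι : Type} [Fintype ι] (c : α → ι → Bool) (h : Set.InjOn c s) :
    Bits s (Fintype.card ι) := by
  refine ⟨fun x i => c x ((Fintype.equivFin ι).symm i), fun x hx y hy hxy => h hx hy ?_⟩
  funext i
  simpa using congrFun hxy (Fintype.equivFin ι i)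

theorem mono (h : Bits s b) (hb : b ≤ b') : Bits s b' := by
  obtain ⟨c, hc⟩ := h
  refine ⟨fun x i => if hi : i.1 < b then c x ⟨i.1, hi⟩ else false, fun x hx y hy hxy => ?_⟩
  refine hc hx hy (funext fun i => ?_)
  simpa using congrFun hxy (Fin.castLE hb i)

theorem comap (h : Bits t b) {g : α → β} (hg : Set.InjOn g s) (hm : Set.MapsTo g s t) :
    Bits s b := by
  obtain ⟨c, hc⟩ := h
  exact ⟨fun x => c (g x), hc.comp hg hm⟩

theorem prod (h : Bits s b) (h' : Bits t b') : Bits (s ×ˢ t) (b + b') := by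
  obtain ⟨c, hc⟩ := h
  obtain ⟨c', hc'⟩ := h'
  have := of_fintype (s := s ×ˢ t) (ι := Fin b ⊕ Fin b') (fun p => Sum.elim (c p.1) (c' p.2))
    fun p hp p' hp' hpp => Prod.ext
      (hc hp.1 hp'.1 (funext fun i => congrFun hpp (.inl i)))
      (hc' hp.2 hp'.2 (funext fun i => congrFun hpp (.inr i)))
  simpa using this

/-- One additional bit tells in which of the two sets the element lies. -/
theorem union {s' : Set α} (h : Bits s b) (h' : Bits s' b') : Bits (s ∪ s') (b + b' + 1) := by
  classical
  obtain ⟨c, hc⟩ := h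
  obtain ⟨c', hc'⟩ := h'
  have := of_fintype (s := s ∪ s') (ι := (Fin b ⊕ Fin b') ⊕ Fin 1)
    (fun x => Sum.elim (Sum.elim (c x) (c' x)) fun _ => decide (x ∈ s)) fun x hx y hy hxy => by
      have h1 : c x = c y := funext fun i => congrFun hxy (.inl (.inl i))
      have h2 : c' x = c' y := funext fun i => congrFun hxy (.inl (.inr i))
      have h3 : (x ∈ s) ↔ (y ∈ s) := by simpa using congrFun hxy (.inr 0)
      by_cases hxs : x ∈ s
      · exact hc hxs (h3.1 hxs) h1
      · exact hc' (hx.resolve_left hxs) (hy.resolve_left fun h => hxs (h3.2 h)) h2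
  simpa using this

theorem pi (h : Bits s b) (k : ℕ) : Bits {g : Fin k → α | ∀ i, g i ∈ s} (k * b) := by
  obtain ⟨c, hc⟩ := h
  have := of_fintype (s := {g : Fin k → α | ∀ i, g i ∈ s}) (ι := Fin k × Fin b)
    (fun g p => c (g p.1) p.2) fun g hg g' hg' hgg => funext fun i =>
      hc (hg i) (hg' i) (funext fun j => congrFun hgg (i, j))
  simpa using this

theorem option (h : Bits s b) : Bits {o : Option α | ∀ x ∈ o, x ∈ s} (b + 1) := by
  obtain ⟨c, hc⟩ := h
  have := of_fintype (s := {o : Option α | ∀ x ∈ o, x ∈ s}) (ι := Fin b ⊕ Fin 1)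
    (fun o => Sum.elim (fun i => o.elim false fun x => c x i) fun _ => o.isSome)
    fun o ho o' ho' hoo => by
      have h1 : o.isSome = o'.isSome := congrFun hoo (.inr 0)
      cases o with
      | none => cases o' with
        | none => rfl
        | some y => simp at h1
      | some x => cases o' with
        | none => simp at h1
        | some y =>
          exact congrArg some (hc (ho x rfl) (ho' y rfl)
            (funext fun i => congrFun hoo (.inl i)))
  simpa using this

/-- The list becomes `k` optional elements; the additional bit of each one also records where the
list ends. -/
theorem list (h : Bits s b) (k : ℕ) :
    Bits {L : List α | L.length ≤ k ∧ ∀ x ∈ L, x ∈ s} (k * (b + 1)) := by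
  refine (h.option.pi k).comap (g := fun L i => L[i.1]?) ?_ ?_
  · intro L hL L' hL' hLL
    refine List.ext_getElem? fun i => ?_
    by_cases hi : i < k
    · exact congrFun hLL ⟨i, hi⟩
    · rw [List.getElem?_eq_none (by have := hL.1; omega),
        List.getElem?_eq_none (by have := hL'.1; omega)]
  · intro L hL i x hx
    exact hL.2 x (List.mem_of_getElem? hx)

theorem le (k : ℕ) : Bits {x : ℕ | x ≤ k} k.size := by
  refine ⟨fun x i => x.testBit i, fun x hx y hy hxy => Nat.eq_of_testBit_eq fun i => ?_⟩
  by_cases hi : i < k.size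
  · exact congrFun hxy ⟨i, hi⟩
  · have h1 : k < 2 ^ i := Nat.size_le.1 (not_lt.1 hi)
    rw [Nat.testBit_lt_two_pow (lt_of_le_of_lt hx h1),
      Nat.testBit_lt_two_pow (lt_of_le_of_lt hy h1)]

theorem bool : Bits (Set.univ : Set Bool) 1 :=
  ⟨fun x _ => x, fun _ _ _ _ h => congrFun h 0⟩

/-- Bits are stored in words, where a given element is represented by zeros. -/
theorem words (h : Bits s b) {τ : Type} [Fintype τ] {w : ℕ} (hb : b ≤ Fintype.card τ * w) (x₀ : α) :
    ∃ c : α → τ → Fin (2 ^ w), Set.InjOn c s ∧ ∀ k, (c x₀ k).1 = 0 := by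
  obtain ⟨c, hc⟩ := h.mono hb
  have e₁ : τ × Fin w ≃ Fin (Fintype.card τ * w) :=
    Fintype.equivOfCardEq (by simp)
  have e₂ : (Fin w → Bool) ≃ Fin (2 ^ w) := Fintype.equivOfCardEq (by simp)
  -- Taking the exclusive or with the bits of `x₀` turns `x₀` into zero bits, and the swap makes
  -- zero bits the number 0.
  let e : (Fin w → Bool) ≃ Fin (2 ^ w) :=
    e₂.trans (Equiv.swap (e₂ fun _ => false) ⟨0, Nat.two_pow_pos w⟩)
  refine ⟨fun x k => e fun i => xor (c x (e₁ (k, i))) (c x₀ (e₁ (k, i))),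
    fun x hx y hy hxy => hc hx hy ?_, fun k => ?_⟩
  · funext j
    obtain ⟨⟨k, i⟩, rfl⟩ := e₁.surjective j
    have := congrFun (e.injective (congrFun hxy k)) i
    simpa using this
  · simp [e]

end Bits

/-! ### Codes from shapes -/

theorem Word.ofOption_injective (w : ℕ) : Function.Injective (Word.ofOption w) := by
  intro x y h
  cases x <;> cases y <;> simp_all [Word.ofOption, Word.blank]

/-- The code that stores the real values in an element, and its shape. -/
def Code.ofShape {w : ℕ} {T ρ τ σ : Type} [Relabel T] (valid : T → Prop) (keys : T → ρ → Option ℝ)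
    (shape : T → σ) (c : σ → τ → Fin (2 ^ w)) {s : Set σ} (hc : Set.InjOn c s)
    (hs : ∀ t, valid t → shape t ∈ s)
    (hv : ∀ (g : ℝ ≃o ℝ) (t : T), valid t → valid (relabel g t))
    (hk : ∀ (g : ℝ ≃o ℝ) (t : T) (r : ρ), keys (relabel g t) r = (keys t r).map g)
    (hg : ∀ (g : ℝ ≃o ℝ) (t : T), shape (relabel g t) = shape t)
    (hinj : ∀ t t', valid t → valid t' → keys t = keys t' → shape t = shape t' → t = t') :
    Code w T (ρ ⊕ τ) where
  valid := valid
  code t := Sum.elim (fun r => Word.ofOption w (keys t r)) fun k => .num (c (shape t) k)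
  valid_relabel := hv
  code_inj t t' ht ht' h := by
    refine hinj t t' ht ht' (funext fun r => ?_) (hc (hs t ht) (hs t' ht') (funext fun k => ?_))
    · exact Word.ofOption_injective w (congrFun h (.inl r))
    · exact Word.num.inj (congrFun h (.inr k))
  code_relabel g t _ := by
    funext k
    cases k with
    | inl r => simp only [Sum.elim_inl, hk, Word.ofOption_map]
    | inr k => simp only [Sum.elim_inr, hg]; rfl

def Code.reindex {w : ℕ} {T ι ι' : Type} [Relabel T] (E : Code w T ι) (e : ι' ≃ ι) :
    Code w T ι' where
  valid := E.valid
  code t k := E.code t (e k)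
  valid_relabel := E.valid_relabel
  code_inj t t' ht ht' h := E.code_inj t t' ht ht' (funext fun k => by
    simpa using congrFun h (e.symm k))
  code_relabel g t ht := funext fun k => congrFun (E.code_relabel g t ht) (e k)

/-- The code with an additional word that is not blank. -/
def Code.mark {w : ℕ} {T ι : Type} [Relabel T] (E : Code w T ι) (hw : 0 < w) :
    Code w T (Unit ⊕ ι) where
  valid := E.valid
  code t := Sum.elim (fun _ => .num ⟨1, Nat.one_lt_two_pow hw.ne'⟩) (E.code t)
  valid_relabel := E.valid_relabel
  code_inj t t' ht ht' h := E.code_inj t t' ht ht' (funext fun k => congrFun h (.inr k))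
  code_relabel g t ht := funext fun k => by
    cases k with
    | inl _ => rfl
    | inr k => exact congrFun (E.code_relabel g t ht) k

theorem Code.mark_ne_blank {w : ℕ} {T ι : Type} [Relabel T] (E : Code w T ι) (hw : 0 < w) (t : T) :
    (E.mark hw).code t ≠ fun _ => Word.blank w := fun h => by
  have h1 := Fin.val_eq_of_eq (Word.num.inj (congrFun h (.inl ())))
  exact one_ne_zero h1

/-! ### The layout of nodes and states -/

/-- What an entry contains apart from its key. -/
def Entry.shape (e : Entry f) : ℕ × (Fin f → ℕ) := (e.ptr, e.cnt)

/-- The shapes of the entries of leaves. -/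
def leafShapes (f : ℕ) : Set (ℕ × (Fin f → ℕ)) :=
  {p | p.1 = 0 ∧ (p.2 = 0 ∨ ∃ i, p.2 = Pi.single i 1)}

/-- The sum of `c i * (i + 1)` is 0 for a deleted value and `i + 1` for one in group `i`, so a
number up to `f` suffices in place of a vector of counts. -/
theorem bits_leafShapes (f : ℕ) : Bits (leafShapes f) f.size := by
  have hsum : ∀ i : Fin f, ∑ j, (Pi.single i 1 : Fin f → ℕ) j * (j.1 + 1) = i.1 + 1 := fun i => by
    simp [Pi.single_apply]
  refine (Bits.le f).comap (g := fun p => ∑ i, p.2 i * (i.1 + 1)) ?_ ?_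
  · rintro ⟨p, c⟩ ⟨hp, hc⟩ ⟨p', c'⟩ ⟨hp', hc'⟩ h
    simp only at hp hp' hc hc' h
    rw [hp, hp']
    rcases hc with rfl | ⟨i, rfl⟩ <;> rcases hc' with rfl | ⟨i', rfl⟩
    · rfl
    · rw [hsum] at h; simp at h
    · rw [hsum] at h; simp at h
    · rw [hsum, hsum] at h
      rw [Fin.ext (Nat.succ.inj h)]
  · rintro ⟨p, c⟩ ⟨hp, hc⟩
    simp only at hp hc
    rcases hc with rfl | ⟨i, rfl⟩
    · simp
    · exact (hsum i).trans_le i.2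

theorem bits_phase : Bits (Set.univ : Set Phase) 4 := by
  refine (Bits.le 15).comap (g := Phase.ctorIdx) ?_ ?_
  · intro a _ b _ h
    cases a <;> cases b <;> first | rfl | exact absurd h (by decide)
  · intro a _
    cases a <;> decide

theorem IsLeafEntry.relabel {e : Entry f} (he : IsLeafEntry e) (σ : ℝ ≃o ℝ) :
    IsLeafEntry (relabel σ e) := he

theorem list_ext {k : ℕ} {L L' : List (Entry f)} (hL : L.length ≤ k) (hL' : L'.length ≤ k)
    (hkey : ∀ r : Fin k, L[r.1]?.map Entry.key = L'[r.1]?.map Entry.key)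
    (hshape : L.map Entry.shape = L'.map Entry.shape) : L = L' := by
  refine List.ext_getElem? fun i => ?_
  by_cases hi : i < k
  · have h1 := hkey ⟨i, hi⟩
    have h2 : (L.map Entry.shape)[i]? = (L'.map Entry.shape)[i]? := by rw [hshape]
    rw [List.getElem?_map, List.getElem?_map] at h2
    cases h : L[i]? with
    | none =>
      cases h' : L'[i]? with
      | none => rfl
      | some e' => simp [h, h'] at h1
    | some e =>
      cases h' : L'[i]? with
      | none => simp [h, h'] at h1
      | some e' =>
        simp only [h, h', Option.map_some, Option.some.injEq, Entry.shape, Prod.mk.injEq] at h1 h2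
        rw [Entry.ext h1 h2.1 h2.2]
  · rw [List.getElem?_eq_none (by omega), List.getElem?_eq_none (by omega)]

namespace Dim

variable (D : Dim)

/-- The shapes of the lists of entries that fit into a node. -/
def listShapes (f : ℕ) : Set (List (ℕ × (Fin f → ℕ))) :=
  {L | L.length ≤ 2 * D.B ∧ ∀ p ∈ L, p ∈ leafShapes f} ∪
    {L | L.length ≤ 2 * D.q ∧ ∀ p ∈ L, p ∈ {x | x ≤ D.V} ×ˢ {c : Fin f → ℕ | ∀ i, c i ∈ {x | x ≤ D.l}}}

/-- The critical term is `2 * q * f * l.size`, for the counts in an internal node. Leaves have many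
more entries, but those need only `f.size` bits each. -/
def listBits (f : ℕ) : ℕ :=
  2 * D.B * (f.size + 1) + 2 * D.q * (D.Z.size + f * D.l.size + 1) + 1

theorem bits_le {k : ℕ} (h : k ≤ D.Z) : Bits {x : ℕ | x ≤ k} D.Z.size :=
  (Bits.le k).mono (Nat.size_le_size h)

theorem bits_listShapes (f : ℕ) : Bits (D.listShapes f) (D.listBits f) :=
  ((bits_leafShapes f).list _).union (((D.bits_le D.V_le).prod ((Bits.le D.l).pi f)).list _)

variable {D}

theorem EntriesOK.relabel {L : List (Entry f)} (h : D.EntriesOK L) (σ : ℝ ≃o ℝ) :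
    D.EntriesOK (relabel σ L) := by
  rw [relabel_list]
  rcases h with h | h
  · refine .inl ⟨by simpa using h.1, fun e he => ?_⟩
    obtain ⟨d, hd, rfl⟩ := List.mem_map.1 he
    exact (h.2 d hd).relabel σ
  · refine .inr ⟨by simpa using h.1, fun e he => ?_⟩
    obtain ⟨d, hd, rfl⟩ := List.mem_map.1 he
    exact h.2 d hd

theorem EntriesOK.shape {L : List (Entry f)} (h : D.EntriesOK L) :
    L.map Entry.shape ∈ D.listShapes f := by
  rcases h with h | h
  · refine .inl ⟨by simpa using h.1, fun p hp => ?_⟩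
    obtain ⟨d, hd, rfl⟩ := List.mem_map.1 hp
    exact h.2 d hd
  · refine .inr ⟨by simpa using h.1, fun p hp => ?_⟩
    obtain ⟨d, hd, rfl⟩ := List.mem_map.1 hp
    exact h.2 d hd

theorem EntriesOK.length_le {L : List (Entry f)} (h : D.EntriesOK L) (hq : D.q ≤ D.B) :
    L.length ≤ 2 * D.B := by
  rcases h with h | h <;> omega

theorem NodeOK.relabel {n : Node f} (h : D.NodeOK n) (σ : ℝ ≃o ℝ) : D.NodeOK (relabel σ n) :=
  ⟨h.es.relabel σ, h.al, h.ctr⟩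

theorem StateOK.relabel {s : State f} (h : D.StateOK s) (σ : ℝ ≃o ℝ) :
    D.StateOK (relabel σ s) := by
  refine ⟨h.al, h.ctr, h.lev, h.adr, h.chd, h.idx, h.rnk, ?_, h.nd.relabel σ, h.cn.relabel σ⟩
  intro e he
  obtain ⟨d, hd, rfl⟩ := Option.mem_map.1 he
  exact h.cur d hd

theorem keys_relabel (σ : ℝ ≃o ℝ) (L : List (Entry f)) (i : ℕ) :
    (relabel σ L)[i]?.map Entry.key = (L[i]?.map Entry.key).map σ := by
  rw [getElem?_relabel]
  cases L[i]? <;> rfl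

theorem shape_relabel (σ : ℝ ≃o ℝ) (L : List (Entry f)) :
    (relabel σ L).map Entry.shape = L.map Entry.shape := by
  rw [relabel_list, List.map_map]
  rfl

/-- What a node contains apart from the keys. -/
def nodeShape (n : Node f) : List (ℕ × (Fin f → ℕ)) × Bool × ℕ × ℕ :=
  (n.es.map Entry.shape, n.flag, n.al, n.ctr)

/-- The `2 * B` words for keys serve leaves and internal nodes alike. Shapes are coded relative to
that of the empty node, so that it becomes blank. -/
theorem exists_node_code (hq : D.q ≤ D.B) {w : ℕ} {τ : Type} [Fintype τ]
    (h : D.listBits f + (1 + (D.Z.size + D.Z.size)) ≤ Fintype.card τ * w) :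
    ∃ E : Code w (Node f) (Fin (2 * D.B) ⊕ τ), (∀ n, E.valid n ↔ D.NodeOK n) ∧
      E.code (Node.ofList []) = fun _ => Word.blank w := by
  have hZ := D.n_le_Z
  obtain ⟨c, hc, hc₀⟩ := ((D.bits_listShapes f).prod (Bits.bool.prod ((D.bits_le D.V_le).prod
    (D.bits_le (k := 2 * D.n) (by omega))))).words h (nodeShape (Node.ofList []))
  refine ⟨Code.ofShape D.NodeOK (fun n r => n.es[r.1]?.map Entry.key) nodeShape c hc
    (fun n hn => ⟨hn.es.shape, trivial, hn.al, hn.ctr⟩) (fun g n hn => hn.relabel g)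
    (fun g n r => keys_relabel g n.es r.1) (fun g n => ?_) (fun n n' hn hn' hk hs => ?_),
    fun n => Iff.rfl, ?_⟩
  · exact Prod.ext (shape_relabel g n.es) rfl
  · simp only [nodeShape, Prod.mk.injEq] at hs
    exact Node.ext (list_ext (hn.es.length_le hq) (hn'.es.length_le hq) (fun r => congrFun hk r)
      hs.1) hs.2.1 hs.2.2.1 hs.2.2.2
  · funext k
    cases k with
    | inl r => rfl
    | inr k =>
      change Word.num _ = Word.num _
      exact congrArg _ (Fin.ext (hc₀ k))

/-- What a state of the simulation contains apart from real values. -/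
def stateShape (p : State f × ℕ) :
    ((Phase × Bool × Bool) × (ℕ × ℕ × ℕ × ℕ × ℕ × ℕ × ℕ)) ×
      (Option (ℕ × (Fin f → ℕ)) × List (ℕ × (Fin f → ℕ)) × List (ℕ × (Fin f → ℕ))) × ℕ :=
  (((p.1.pc, p.1.flag, p.1.reb),
    (p.1.al, p.1.ctr, p.1.lev, p.1.adr, p.1.chd, p.1.idx, p.1.rnk)),
    (p.1.cur.map Entry.shape, p.1.nd.map Entry.shape, p.1.cn.map Entry.shape), p.2)

/-- The real values in a state. -/
def stateKeys (k : ℕ) (s : State f) : Unit ⊕ (Fin k ⊕ Fin k) → Option ℝ :=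
  Sum.elim (fun _ => s.cur.map Entry.key)
    (Sum.elim (fun r => s.nd[r.1]?.map Entry.key) fun r => s.cn[r.1]?.map Entry.key)

def stateBits (D : Dim) (f K : ℕ) : ℕ :=
  ((4 + (1 + 1)) + (D.Z.size + (D.Z.size + (D.Z.size + (D.Z.size + (D.Z.size + (D.Z.size +
    D.Z.size))))))) + (((f.size + 1) + (D.listBits f + D.listBits f)) + K.size)

theorem exists_state_code (hq : D.q ≤ D.B) {w K : ℕ} {τ : Type} [Fintype τ]
    (h : D.stateBits f K ≤ Fintype.card τ * w) :
    ∃ E : Code w (State f × ℕ) ((Unit ⊕ (Fin (2 * D.B) ⊕ Fin (2 * D.B))) ⊕ τ),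
      ∀ p, E.valid p ↔ D.StateOK p.1 ∧ p.2 ≤ K := by
  have hH : D.H ≤ D.Z := by
    have h₁ := D.V_eq
    have h₂ := D.V_le
    generalize 4 * D.n / D.B = x at h₁
    omega
  obtain ⟨c, hc, -⟩ := ((bits_phase.prod (Bits.bool.prod Bits.bool)).prod ((D.bits_le D.V_le).prod
    ((D.bits_le le_rfl).prod ((D.bits_le hH).prod ((D.bits_le D.V_le).prod
    ((D.bits_le D.V_le).prod ((D.bits_le le_rfl).prod (D.bits_le le_rfl)))))))).prod
    ((((bits_leafShapes f).option.prod ((D.bits_listShapes f).prod (D.bits_listShapes f))).prod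
      (Bits.le K))) |>.words h (stateShape (machineStart (.qry ∅ 0) none, 0))
  refine ⟨Code.ofShape (fun p => D.StateOK p.1 ∧ p.2 ≤ K) (fun p => stateKeys (2 * D.B) p.1)
    stateShape c hc (fun p hp => ?_) (fun g p hp => ⟨hp.1.relabel g, hp.2⟩) (fun g p r => ?_)
    (fun g p => ?_) (fun p p' hp hp' hk hs => ?_), fun p => Iff.rfl⟩
  · obtain ⟨hp, hj⟩ := hp
    refine ⟨⟨⟨trivial, trivial, trivial⟩, hp.al, hp.ctr, hp.lev, hp.adr, hp.chd, hp.idx, hp.rnk⟩,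
      ⟨?_, hp.nd.shape, hp.cn.shape⟩, hj⟩
    intro x hx
    obtain ⟨e, he, rfl⟩ := Option.mem_map.1 hx
    exact hp.cur e he
  · rcases r with _ | r | r
    · change (p.1.cur.map (relabel g)).map Entry.key = (p.1.cur.map Entry.key).map g
      cases p.1.cur <;> rfl
    · exact keys_relabel g p.1.nd r.1
    · exact keys_relabel g p.1.cn r.1
  · refine Prod.ext rfl (Prod.ext (Prod.ext ?_ (Prod.ext (shape_relabel g p.1.nd)
      (shape_relabel g p.1.cn))) rfl)
    change (p.1.cur.map (relabel g)).map Entry.shape = p.1.cur.map Entry.shape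
    cases p.1.cur <;> rfl
  · obtain ⟨s, j⟩ := p
    obtain ⟨s', j'⟩ := p'
    simp only [stateShape, Prod.mk.injEq] at hs
    obtain ⟨⟨⟨h1, h2, h3⟩, h4, h5, h6, h7, h8, h9, h10⟩, ⟨h11, h12, h13⟩, h14⟩ := hs
    have hcur : s.cur = s'.cur := by
      have hk' : s.cur.map Entry.key = s'.cur.map Entry.key := congrFun hk (.inl ())
      cases h : s.cur with
      | none => cases h' : s'.cur with
        | none => rfl
        | some e' => simp [h, h'] at hk'
      | some e => cases h' : s'.cur with
        | none => simp [h, h'] at hk'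
        | some e' =>
          simp only [h, h', Option.map_some, Option.some.injEq, Entry.shape,
            Prod.mk.injEq] at hk' h11
          rw [Entry.ext hk' h11.1 h11.2]
    refine Prod.ext (State.ext h1 h2 h3 h4 h5 h6 h7 h8 h9 h10 hcur ?_ ?_) h14
    · exact list_ext (hp.1.nd.length_le hq) (hp'.1.nd.length_le hq)
        (fun r => congrFun hk (.inr (.inl r))) h12
    · exact list_ext (hp.1.cn.length_le hq) (hp'.1.cn.length_le hq)
        (fun r => congrFun hk (.inr (.inr r))) h13

/-- The memory holds the buffer (`B` words), the keys of `nd` and `cn` (`4 * B`), the shape of the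
state (`κ' * B`), the marker and the key of `cur` (2), and the partly read node (`(2 + κ) * B`).
Because `2 ≤ B`, this is at most `(8 + κ + κ') * B`. -/
theorem exists_fits {P : Params} (hB : D.B = P.B) (hq : D.q ≤ D.B) (hw : 0 < P.w) {κ κ' : ℕ}
    (h : D.listBits f + (1 + (D.Z.size + D.Z.size)) ≤ κ * P.B * P.w)
    (h' : D.stateBits f (2 + κ) ≤ κ' * P.B * P.w) (hM : (8 + κ + κ') * P.B ≤ P.M) :
    ∃ E : Layout P (2 + κ) (Node f) (State f), Fits D E := by
  obtain ⟨E₁, hv₁, h₀⟩ := exists_node_code (f := f) hq (w := P.w) (τ := Fin κ × Fin P.B)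
    (by simpa using h)
  obtain ⟨E₂, hv₂⟩ := exists_state_code (f := f) hq (w := P.w) (τ := Fin κ' × Fin P.B)
    (by simpa using h')
  have e : Fin (2 + κ) × Fin P.B ≃ Fin (2 * D.B) ⊕ (Fin κ × Fin P.B) :=
    Fintype.equivOfCardEq (by simp [hB]; ring)
  let I : Type := Unit ⊕ ((Unit ⊕ (Fin (2 * D.B) ⊕ Fin (2 * D.B))) ⊕ (Fin κ' × Fin P.B))
  have hcard : P.B + Fintype.card (I ⊕ (Fin (2 + κ) × Fin P.B)) ≤ P.M := by
    refine le_trans ?_ hM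
    have := P.two_le_B
    simp [I, hB]
    nlinarith
  let u := Fintype.equivFin (I ⊕ (Fin (2 + κ) × Fin P.B))
  refine ⟨{ node := E₁.reindex e
            ι := I
            st := E₂.mark hw
            st_ne_blank := fun s _ => E₂.mark_ne_blank hw s
            pos := fun k => ⟨P.B + (u k).1, by have := (u k).2; omega⟩
            pos_inj := fun k k' hk => u.injective (Fin.ext (by simpa using hk))
            le_pos := fun k => Nat.le_add_right _ _ }, by omega, fun s hs j hj => ?_,
    fun n hn => (hv₁ n).2 hn, ?_⟩
  · exact (hv₂ (s, j)).2 ⟨hs, hj⟩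
  · funext k
    exact congrFun h₀ (e k)

end Dim

/-! ### The choice of the parameters -/

/-- The height is chosen so that `n / B + 1 ≤ q ^ H`, which gives `n ≤ B * q ^ H`. As `t < q ^ t`,
it is at most `n / B`; this keeps the `O(H)` spare addresses within the space bound. -/
theorem exists_dim {B f l : ℕ} (hB : 2 ≤ B) (hf : 1 ≤ f) (hl : 1 ≤ l) :
    ∃ D : Dim, D.B = B ∧ D.l = l ∧ D.n = f * l ∧ D.q = max 2 B.sqrt ∧
      D.H = Nat.clog (max 2 B.sqrt) (f * l / B + 1) ∧ D.H ≤ f * l / B ∧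
      D.Z = 4 * (f * l) + 2 := by
  have hq : 1 < max 2 B.sqrt := lt_of_lt_of_le one_lt_two (le_max_left _ _)
  have hn : 1 ≤ f * l := Nat.mul_pos hf hl
  have hH : Nat.clog (max 2 B.sqrt) (f * l / B + 1) ≤ f * l / B :=
    Nat.clog_le_of_le_pow (Nat.lt_pow_self hq)
  have hB0 : 0 < B := by omega
  have h1 : f * l / B ≤ f * l / 2 := Nat.div_le_div_left hB two_pos
  have h2 : 4 * (f * l) / B ≤ 4 * (f * l) / 2 := Nat.div_le_div_left hB two_pos
  refine ⟨⟨B, max 2 B.sqrt, l, f * l, Nat.clog (max 2 B.sqrt) (f * l / B + 1), _, 4 * (f * l) + 2,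
    hB, le_max_left _ _, hn, ?_, rfl, by omega, by omega⟩,
    rfl, rfl, rfl, rfl, rfl, hH, rfl⟩
  calc f * l ≤ B * (f * l / B + 1) := (Nat.lt_mul_div_succ _ hB0).le
    _ ≤ _ := Nat.mul_le_mul_left _ (Nat.le_pow_clog hq _)

theorem one_le_lg (b x : ℝ) : 1 ≤ lg b x := le_max_left _ _

theorem logb_le_lg (b x : ℝ) : Real.logb b x ≤ lg b x := le_max_right _ _

/-- If the height is positive, minimality gives `q ^ (H - 1) ≤ n`. With `B ≤ q ^ 4` this yields `B ^
(H - 1) ≤ n ^ 4`, hence `H - 1 ≤ 4 * log_B n`, and the remaining 2 is absorbed by `1 ≤ lg`. -/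
theorem clog_add_one_le {B n : ℕ} (hB : 2 ≤ B) :
    (Nat.clog (max 2 B.sqrt) (n / B + 1) : ℝ) + 1 ≤ 6 * lg B n := by
  set q := max 2 B.sqrt with hq
  have hlg := one_le_lg B n
  have hq2 : 2 ≤ q := le_max_left _ _
  rcases Nat.eq_zero_or_pos (Nat.clog q (n / B + 1)) with h0 | hpos
  · rw [h0]; push_cast; linarith
  have hlt : 1 < n / B + 1 := by
    by_contra h
    rw [Nat.clog_of_right_le_one (by omega)] at hpos
    exact absurd hpos (lt_irrefl _)
  have h1 : q ^ (Nat.clog q (n / B + 1) - 1) ≤ n := by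
    have h2 := Nat.pow_pred_clog_lt_self (b := q) (by omega) hlt
    have h3 := Nat.div_le_self n B
    rw [Nat.pred_eq_sub_one] at h2
    omega
  -- `B < (√B + 1) ^ 2 ≤ (q + 1) ^ 2`, with the integer root, and `q + 1 ≤ q ^ 2` because `q ≥ 2`.
  have hBq : B ≤ q ^ 4 := by
    have h2 : B < (B.sqrt + 1) ^ 2 := by rw [sq]; exact Nat.lt_succ_sqrt B
    have h3 : B.sqrt ≤ q := le_max_right _ _
    have h4 : (B.sqrt + 1) ^ 2 ≤ (q + 1) ^ 2 := Nat.pow_le_pow_left (by omega) 2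
    nlinarith [Nat.mul_le_mul hq2 hq2]
  set k := Nat.clog q (n / B + 1) - 1 with hk
  have h2 : B ^ k ≤ n ^ 4 := by
    calc B ^ k ≤ (q ^ 4) ^ k := Nat.pow_le_pow_left hBq k
      _ = (q ^ k) ^ 4 := by rw [← pow_mul, ← pow_mul, mul_comm]
      _ ≤ n ^ 4 := Nat.pow_le_pow_left h1 4
  have hB1 : (1 : ℝ) < B := by exact_mod_cast hB
  have h3 : (k : ℝ) ≤ 4 * Real.logb B n := by
    have h4 : Real.logb B ((B : ℝ) ^ k) ≤ Real.logb B ((n : ℝ) ^ 4) :=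
      Real.logb_le_logb_of_le hB1 (by positivity) (by exact_mod_cast h2)
    rw [Real.logb_pow, Real.logb_pow, Real.logb_self_eq_one hB1] at h4
    push_cast at h4
    linarith
  have h4 := logb_le_lg B n
  have h5 : ((Nat.clog q (n / B + 1) : ℕ) : ℝ) = k + 1 := by
    have : Nat.clog q (n / B + 1) = k + 1 := by omega
    rw [this]; push_cast; rfl
  rw [h5]
  linarith

theorem size_le_logb {x : ℕ} (hx : 1 ≤ x) : (x.size : ℝ) ≤ Real.logb 2 x + 1 := by
  have h0 : 0 < x.size := Nat.size_pos.2 hx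
  have h1 : 2 ^ (x.size - 1) ≤ x := Nat.lt_size.1 (by omega)
  have h2 : Real.logb 2 ((2 : ℝ) ^ (x.size - 1)) ≤ Real.logb 2 x :=
    Real.logb_le_logb_of_le one_lt_two (by positivity) (by exact_mod_cast h1)
  rw [Real.logb_pow, Real.logb_self_eq_one one_lt_two, Nat.cast_sub h0] at h2
  push_cast at h2
  linarith

/-- A power of `L` has logarithm `c * log L`, and `log L ≤ L ^ δ / δ`; the constant term is absorbed
since `L ^ δ ≥ 1`. -/
theorem logb_le_of_le_mul_pow {a δ L : ℝ} {c l : ℕ} (hδ : 0 < δ) (hL : 1 ≤ L) (hl : 1 ≤ l)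
    (h : (l : ℝ) ≤ a * L ^ c) :
    Real.logb 2 l ≤ (Real.logb 2 (max a 1) + c / (δ * Real.log 2)) * L ^ δ := by
  have hL0 : 0 < L := by linarith
  have ha : 1 ≤ max a 1 := le_max_right _ _
  have hlog2 : 0 < Real.log 2 := Real.log_pos one_lt_two
  have h1 : Real.logb 2 l ≤ Real.logb 2 (max a 1 * L ^ c) := by
    refine Real.logb_le_logb_of_le one_lt_two (by exact_mod_cast hl) (h.trans ?_)
    gcongr
    exact le_max_left _ _
  have h2 : Real.log L ≤ L ^ δ / δ := Real.log_le_rpow_div hL0.le hδ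
  have h3 : 1 ≤ L ^ δ := Real.one_le_rpow hL hδ.le
  have h4 : 0 ≤ Real.logb 2 (max a 1) := Real.logb_nonneg one_lt_two ha
  calc Real.logb 2 l ≤ Real.logb 2 (max a 1 * L ^ c) := h1
    _ = Real.logb 2 (max a 1) + c * (Real.log L / Real.log 2) := by
        rw [Real.logb_mul (by positivity) (by positivity), Real.logb_pow, Real.logb]
        rfl
    _ ≤ Real.logb 2 (max a 1) * L ^ δ + c * (L ^ δ / δ / Real.log 2) := by
        gcongr
        exact le_mul_of_one_le_right h4 h3
    _ = _ := by field_simp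

/-- Leaves take `O(B)` times `f.size`, which is `O(L)`. For the counts of an internal node the
exponents `ε` and `1 - ε` add up to 1 and the two factors `√B`, from `q` and from `f`, multiply to
`B`. -/
theorem listBits_le {D : Dim} {f N : ℕ} {ε K₀ : ℝ} (hf : 1 ≤ f) (hl : 1 ≤ D.l)
    (hn : D.n = f * D.l) (hN : f * D.l ≤ N) (hq : D.q = max 2 D.B.sqrt) (hZ : D.Z = 4 * D.n + 2)
    (hfε : (f : ℝ) ≤ Real.sqrt D.B * lg 2 N ^ ε)
    (hK : Real.logb 2 D.l ≤ K₀ * lg 2 N ^ (1 - ε)) (hε : ε < 1) :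
    (f.size : ℝ) ≤ 2 * lg 2 N ∧ (D.Z.size : ℝ) ≤ 5 * lg 2 N ∧
      (D.listBits f : ℝ) ≤ (23 + 4 * K₀) * (D.B * lg 2 N) := by
  set L := lg 2 N with hL
  have hL1 : 1 ≤ L := one_le_lg _ _
  have hLN : Real.logb 2 N ≤ L := logb_le_lg _ _
  have hL0 : 0 < L := by linarith
  have hn1 := D.one_le_n
  have hN1 : 1 ≤ N := by omega
  have hN0 : (0 : ℝ) < N := by exact_mod_cast hN1
  have hB2 : (2 : ℝ) ≤ D.B := by exact_mod_cast D.two_le_B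
  have hfN : f ≤ N := le_trans (Nat.le_mul_of_pos_right f hl) hN
  have h1 : (f.size : ℝ) ≤ 2 * L := by
    have h2 := size_le_logb hf
    have h3 : Real.logb 2 f ≤ Real.logb 2 N :=
      Real.logb_le_logb_of_le one_lt_two (by exact_mod_cast hf) (by exact_mod_cast hfN)
    linarith
  have h2 : (D.Z.size : ℝ) ≤ 5 * L := by
    have h2 := size_le_logb (x := D.Z) (by omega)
    have h3 : Real.logb 2 D.Z ≤ Real.logb 2 (2 ^ 3 * N) := by
      refine Real.logb_le_logb_of_le one_lt_two ?_ ?_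
      · exact_mod_cast (show 0 < D.Z by omega)
      · exact_mod_cast (show D.Z ≤ 2 ^ 3 * N by omega)
    rw [Real.logb_mul (by positivity) (by positivity), Real.logb_pow,
      Real.logb_self_eq_one one_lt_two] at h3
    push_cast at h3
    linarith
  have hsq : (D.q : ℝ) ≤ 2 * Real.sqrt D.B := by
    have h4 : (D.B.sqrt : ℝ) ≤ Real.sqrt D.B := Real.nat_sqrt_le_real_sqrt
    have h5 : 1 ≤ Real.sqrt D.B := Real.one_le_sqrt.2 (by linarith)
    rw [hq]
    push_cast
    exact max_le (by linarith) (by linarith)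
  have hqB : (D.q : ℝ) ≤ D.B := by
    rw [hq]
    exact_mod_cast max_le D.two_le_B (Nat.sqrt_le_self _)
  have hls : (D.l.size : ℝ) ≤ (K₀ + 1) * L ^ (1 - ε) := by
    have h4 := size_le_logb hl
    have h5 : 1 ≤ L ^ (1 - ε) := Real.one_le_rpow hL1 (by linarith)
    linarith
  have hprod : (D.q : ℝ) * (f * D.l.size) ≤ 2 * (K₀ + 1) * (D.B * L) := by
    calc (D.q : ℝ) * (f * D.l.size)
        ≤ (2 * Real.sqrt D.B) * ((Real.sqrt D.B * L ^ ε) * ((K₀ + 1) * L ^ (1 - ε))) := by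
          gcongr
      _ = 2 * (K₀ + 1) * ((Real.sqrt D.B * Real.sqrt D.B) * (L ^ ε * L ^ (1 - ε))) := by ring
      _ = 2 * (K₀ + 1) * (D.B * L) := by
          rw [Real.mul_self_sqrt (by positivity), ← Real.rpow_add hL0]
          simp
  refine ⟨h1, h2, ?_⟩
  have h3 : (D.listBits f : ℝ) = 2 * D.B * (f.size + 1) + 2 * (D.q * (D.Z.size + 1)) +
      2 * (D.q * (f * D.l.size)) + 1 := by
    simp only [Dim.listBits]
    push_cast
    ring
  have h4 : (D.B : ℝ) * (f.size + 1) ≤ D.B * (3 * L) := by gcongr; linarith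
  have h5 : (D.q : ℝ) * (D.Z.size + 1) ≤ D.B * (6 * L) := by gcongr; linarith
  have h6 : 1 ≤ D.B * L := by nlinarith
  rw [h3]
  linarith

/-- Converts a bound in bits, proportional to `B * lg N`, into a constant number of blocks of words
of at least `cw * lg N` bits. -/
theorem nat_le_ceil_mul {x B w : ℕ} {Y cw L : ℝ} (hcw : 0 < cw) (hL : 0 ≤ L) (hw : cw * L ≤ w)
    (h : (x : ℝ) ≤ Y * (B * L)) : x ≤ ⌈Y / cw⌉₊ * B * w := by
  have h1 : (x : ℝ) ≤ (⌈Y / cw⌉₊ : ℝ) * B * w := by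
    calc (x : ℝ) ≤ Y * (B * L) := h
      _ = Y / cw * B * (cw * L) := by field_simp
      _ ≤ (⌈Y / cw⌉₊ : ℝ) * B * w := by
          gcongr
          exact Nat.le_ceil (Y / cw)
  exact_mod_cast h1

end EM

/-! ### The theorem -/

theorem lemma5 :
    ∃ c₂ : ℝ, 2 ≤ c₂ ∧
      ∀ (ε a cw : ℝ) (c : ℕ), 0 < ε → ε < 1 → 0 < cw →
        ∃ cM C : ℝ, ∀ (P : EM.Params) (N f l : ℕ),
          cM * P.B ≤ P.M → cw * EM.lg 2 N ≤ P.w →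
          1 ≤ f → 1 ≤ l → f * l ≤ N →
          (l : ℝ) ≤ a * EM.lg 2 N ^ c →
          (f : ℝ) ≤ Real.sqrt P.B * EM.lg 2 N ^ ε →
          ∃ (S : ℕ) (D : EM.GroupStructure P S f),
            (S : ℝ) ≤ C * (⌈(f * l : ℝ) / P.B⌉₊ : ℝ) ∧
            D.Solves l c₂ (C * EM.lg P.B (f * l)) := by
  refine ⟨2, le_rfl, fun ε a cw c _ hε hcw => ?_⟩
  set K₀ : ℝ := Real.logb 2 (max a 1) + c / ((1 - ε) * Real.log 2) with hK₀
  have hε' : 0 < 1 - ε := by linarith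
  have hlog2 : 0 < Real.log 2 := Real.log_pos one_lt_two
  have hK₀0 : 0 ≤ K₀ :=
    add_nonneg (Real.logb_nonneg one_lt_two (le_max_right _ _)) (by positivity)
  -- Blocks for the shape of a node: `23 + 4 * K₀` for the list, 1 for the flag and 10 for the two
  -- numbers, in units of `B * lg N` bits.
  set κ : ℕ := ⌈(34 + 4 * K₀) / cw⌉₊ with hκ
  -- Blocks for the shape of a state: twice the list bound `23 + 4 * K₀`, 35 for seven numbers, 9
  -- for the phase, the flags and `cur`, and the size of the number of blocks transferred.
  set κ' : ℕ := ⌈(90 + 8 * K₀ + (2 + κ).size) / cw⌉₊ with hκ'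
  -- An operation has amortized cost `3 * W * K = 24 * (H + 1) * K` with `K = 2 + κ`, and `H + 1 ≤ 6
  -- * lg_B (f * l)`; this gives the factor 144, which is ample for the space as well.
  refine ⟨((8 + κ + κ' : ℕ) : ℝ), ((144 * (2 + κ) : ℕ) : ℝ), ?_⟩
  intro P N f l hM hw hf hl hN hla hfε
  obtain ⟨D, hB, rfl, hn, hq, hH, hHn, hZ⟩ := EM.exists_dim (f := f) P.two_le_B hf hl
  have hqB : D.q ≤ D.B := by
    rw [hq, hB]
    exact max_le P.two_le_B (Nat.sqrt_le_self _)
  have hL1 := EM.one_le_lg 2 N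
  obtain ⟨h1, h2, h3⟩ := EM.listBits_le (D := D) (N := N) (ε := ε) (K₀ := K₀) hf hl hn hN
    (by rw [hB]; exact hq) (by rw [hn]; exact hZ) (by rw [hB]; exact hfε)
    (EM.logb_le_of_le_mul_pow hε' hL1 hl hla) hε
  rw [hB] at h3
  set L := EM.lg 2 N with hL
  have hB2 : (2 : ℝ) ≤ P.B := by exact_mod_cast P.two_le_B
  have hBL : L ≤ P.B * L := by nlinarith
  have hw0 : 0 < P.w := by
    have : (0 : ℝ) < P.w := lt_of_lt_of_le (by positivity) hw
    exact_mod_cast this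
  obtain ⟨E, hE⟩ := EM.Dim.exists_fits (f := f) hB hqB hw0 (κ := κ) (κ' := κ')
    (EM.nat_le_ceil_mul hcw (by linarith) hw (by push_cast; linarith))
    (EM.nat_le_ceil_mul hcw (by linarith) hw (by
      simp only [EM.Dim.stateBits]
      push_cast
      have : ((2 + κ).size : ℝ) ≤ (2 + κ).size * (P.B * L) :=
        le_mul_of_one_le_right (by positivity) (by linarith)
      linarith))
    (by exact_mod_cast hM)
  refine ⟨_, EM.Fits.groupStructure D E, ?_, hE.solves hn.ge ?_⟩
  · have hceil : (1 : ℝ) ≤ (⌈(f * D.l : ℝ) / P.B⌉₊ : ℝ) := by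
      have : 0 < ⌈(f * D.l : ℝ) / P.B⌉₊ := Nat.ceil_pos.2 (by positivity)
      exact_mod_cast this
    have hle : (f * D.l : ℝ) / P.B ≤ (⌈(f * D.l : ℝ) / P.B⌉₊ : ℝ) := Nat.le_ceil _
    have h4 : ((4 * D.n / D.B : ℕ) : ℝ) ≤ 4 * ((f * D.l : ℝ) / P.B) := by
      refine Nat.cast_div_le.trans_eq ?_
      rw [hn, hB]
      push_cast
      ring
    have h5 : (D.H : ℝ) ≤ (f * D.l : ℝ) / P.B := by
      refine (Nat.cast_le.2 hHn).trans (Nat.cast_div_le.trans_eq ?_)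
      push_cast
      ring
    have h6 : ((2 * D.V + 3 : ℕ) : ℝ) ≤ 144 * (⌈(f * D.l : ℝ) / P.B⌉₊ : ℝ) := by
      rw [D.V_eq]
      push_cast
      linarith
    calc (((2 * D.V + 3) * (2 + κ) : ℕ) : ℝ) = ((2 * D.V + 3 : ℕ) : ℝ) * ((2 + κ : ℕ) : ℝ) := by
          push_cast; ring
      _ ≤ 144 * (⌈(f * D.l : ℝ) / P.B⌉₊ : ℝ) * ((2 + κ : ℕ) : ℝ) := by gcongr
      _ = _ := by push_cast; ring
  · have h4 := EM.clog_add_one_le (n := f * D.l) P.two_le_B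
    rw [← hH] at h4
    push_cast at h4
    calc ((3 * D.W * (2 + κ) : ℕ) : ℝ) = 24 * ((2 + κ : ℕ) : ℝ) * (D.H + 1) := by
          simp only [EM.Dim.W]; push_cast; ring
      _ ≤ 24 * ((2 + κ : ℕ) : ℝ) * (6 * EM.lg P.B (f * D.l)) := by gcongr
      _ = _ := by push_cast; ring
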